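/- **Theorem.** A family $\mu_1,\dots,\mu_k\in\mathbb R^d$ is $\Delta$-separated if $\|\mu_i-\mu_j\|_2\ge\Delta$ for all $i\ne j$; two families $(u_j)$, $(v_j)$ of $k$ points are $\epsilon$-close if for some permutation $\sigma$ of $[k]$, $\|u_j-v_{\sigma(j)}\|_2\le\epsilon$ for every $j$. All logarithms are natural. Call $(k,d,\Delta,\epsilon)$ admissible if $k\ge 2$ and $d\ge 1$ are integers and $\Delta,\epsilon>0$ are reals with $$\epsilon<\min\Big\{\frac{\Delta}{100},\ \frac{\Delta}{32\sqrt{\min\{d,\ln k\}}}\Big\}.$$ The computational model is a randomized real RAM: exact real arithmetic ($+,-,\times,/,\sqrt{\cdot},\exp,\log,\cos$, comparisons) and integer arithmetic, with every instruction at unit cost, natural numbers as the only constants in a program, access to independent $N(0,1)$ variates, and access to independent samples from the unknown distribution on $\mathbb R^d$. For every constant $c>0$ there is one algorithm (a fixed program in this model, with input $k,d,\Delta,\epsilon$) such that the following hold. 1. There is a constant $C>0$, depending only on $c$, such that for all admissible $(k,d,\Delta,\epsilon)$ the algorithm always halts, and its runtime and the number of samples it draws are both at most $$C\Big(\frac{\Delta}{\epsilon}\Big)^4k^3\log^2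 k\cdot\max\Big\{\Big(\frac d\epsilon\Big)^{Cd},\,d^{Cd}\Big\}\cdot e^{C M^2},$$ where $$M^2=\frac1{\Delta^2}\Big(\min\{d,\log k\}+\log\frac\Delta\epsilon\Big)\Big(\min\Big\{d+\log k,\ d\log\Big(2+\frac d{\Delta^2}\Big)\Big\}+\log\frac\Delta\epsilon\Big).$$ Moreover, whenever the samples come from $P=\frac1k\sum_{j=1}^k\mathcal N(\mu_j,I_d)$ with $\Delta$-separated means $\mu_1,\dots,\mu_k\in\mathbb R^d$, the algorithm outputs $k$ vectors that are $\epsilon$-close to $\mu_1,\dots,\mu_k$ with probability at least $1-k^{-c}$. 2. For all constants $A,a,b>0$ there are natural numbers $K,k_0$ such that for all admissible $(k,d,\Delta,\epsilon)$ with $k\ge k_0$, $$d\le A\,\frac{\log k}{\log\log k},\qquad \Delta\ge a\,\frac{d}{\sqrt{\log k}}\sqrt{\log\frac{\log k}{d}},\qquad \frac\Delta\epsilon\le b\sqrt d,$$ the runtime and the number of samples of the same algorithm are at most $k^K$. -/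

import Mathlib

open MeasureTheory ProbabilityTheory

noncomputable section

namespace GMM

/-! ### Uniform mixtures of spherical Gaussians -/

/-- The points `μ j` are pairwise at Euclidean distance at least `Δ`. -/
def Separated {k d : ℕ} (Δ : ℝ) (μ : Fin k → EuclideanSpace ℝ (Fin d)) : Prop :=
  ∀ i j, i ≠ j → Δ ≤ ‖μ i - μ j‖

/-- Two families of `k` points are `ε`-close: after a permutation, corresponding points are
at Euclidean distance at most `ε`. -/
def EpsClose {k d : ℕ} (ε : ℝ) (u v : Fin k → EuclideanSpace ℝ (Fin d)) : Prop :=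
  ∃ σ : Equiv.Perm (Fin k), ∀ j, ‖u j - v (σ j)‖ ≤ ε

/-- The uniform mixture `(1/k) ∑ j, N(μ j, I_d)`. -/
def mixture {k d : ℕ} (μ : Fin k → EuclideanSpace ℝ (Fin d)) :
    Measure (EuclideanSpace ℝ (Fin d)) :=
  (k : ENNReal)⁻¹ • ∑ j, multivariateGaussian (μ j) 1

theorem isProbabilityMeasure_mixture {k d : ℕ} (hk : k ≠ 0)
    (μ : Fin k → EuclideanSpace ℝ (Fin d)) : IsProbabilityMeasure (mixture μ) := by
  constructor
  simp [mixture, ENNReal.inv_mul_cancel (by exact_mod_cast hk : (k : ENNReal) ≠ 0)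
    (ENNReal.natCast_ne_top k)]

/-! ### A randomised real RAM with sample access

There is an integer memory and a real memory, both indexed by `ℕ` with indirect addressing.
Real arithmetic is exact.  Programs are while-programs whose only numerical constants are
natural numbers, so a program is a finite combinatorial object. -/

/-- Everything random that a run can consult: the successive samples from the unknown
distribution on `ℝ^d`, and the successive outputs of an internal `N(0, 1)` generator. -/
abbrev Tape (d : ℕ) : Type := (ℕ → EuclideanSpace ℝ (Fin d)) × (ℕ → ℝ)

/-- All samples are drawn from the mixture, all internal variates from `N(0, 1)`, and everything is
independent. -/
def tapeLaw {k d : ℕ} (μ : Fin k → EuclideanSpace ℝ (Fin d)) : Measure (Tape d) :=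
  (Measure.infinitePi fun _ : ℕ => mixture μ).prod
    (Measure.infinitePi fun _ : ℕ => gaussianReal 0 1)

/-- Memory contents of the machine. -/
structure State where
  /-- integer memory -/
  int : ℕ → ℕ
  /-- real memory -/
  real : ℕ → ℝ
  /-- coordinates of the most recently drawn sample (zero before the first draw) -/
  buf : ℕ → ℝ
  /-- number of samples drawn so far -/
  drawn : ℕ
  /-- number of internal Gaussian variates used so far -/
  used : ℕ

/-- Integer expressions; `mem a` is the content of the integer cell with address `a`, and `sub` is
truncated subtraction. -/
inductive NExp where
  | lit (n : ℕ)
  | mem (a : NExp)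
  | add (a b : NExp)
  | sub (a b : NExp)
  | mul (a b : NExp)

def NExp.eval (s : State) : NExp → ℕ
  | .lit n => n
  | .mem a => s.int (a.eval s)
  | .add a b => a.eval s + b.eval s
  | .sub a b => a.eval s - b.eval s
  | .mul a b => a.eval s * b.eval s

/-- Real expressions; `mem a` is the content of the real cell with address `a`, `coord a` is the
coordinate with index `a` of the current sample, `cast` converts an integer to a real. -/
inductive RExp where
  | mem (a : NExp)
  | coord (a : NExp)
  | cast (a : NExp)
  | add (x y : RExp)
  | sub (x y : RExp)
  | mul (x y : RExp)
  | div (x y : RExp)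
  | sqrt (x : RExp)
  | exp (x : RExp)
  | log (x : RExp)
  | cos (x : RExp)

def RExp.eval (s : State) : RExp → ℝ
  | .mem a => s.real (a.eval s)
  | .coord a => s.buf (a.eval s)
  | .cast a => (a.eval s : ℝ)
  | .add x y => x.eval s + y.eval s
  | .sub x y => x.eval s - y.eval s
  | .mul x y => x.eval s * y.eval s
  | .div x y => x.eval s / y.eval s
  | .sqrt x => Real.sqrt (x.eval s)
  | .exp x => Real.exp (x.eval s)
  | .log x => Real.log (x.eval s)
  | .cos x => Real.cos (x.eval s)

/-- Tests. -/
inductive Test where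
  | nlt (a b : NExp)
  | rlt (x y : RExp)
  | neg (t : Test)
  | and (t u : Test)

def Test.Holds (s : State) : Test → Prop
  | .nlt a b => a.eval s < b.eval s
  | .rlt x y => x.eval s < y.eval s
  | .neg t => ¬ t.Holds s
  | .and t u => t.Holds s ∧ u.Holds s

/-- Programs. `setN a e` and `setR a x` store into the integer or real cell with address `a`;
`sample` draws a fresh sample from the unknown distribution into the buffer; `gauss a` draws a fresh
internal `N(0, 1)` variate into the real cell with address `a`. -/
inductive Prog where
  | skip
  | setN (a e : NExp)
  | setR (a : NExp) (x : RExp)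
  | sample
  | gauss (a : NExp)
  | seq (p q : Prog)
  | ite (t : Test) (p q : Prog)
  | while (t : Test) (p : Prog)

open Classical in
/-- One step of the machine. A configuration is the list of program pieces still to be executed
together with the memory; the machine has halted when the list is empty. A step executes one
assignment, draws one sample or variate, evaluates one test, or unfolds one sequential composition.
The sizes of the expressions in a program do not depend on its input, so, for a fixed program,
charging one unit per step is the unit-cost measure up to a constant factor. -/
def step {d : ℕ} (ω : Tape d) : List Prog × State → List Prog × State
  | ([], s) => ([], s)
  | (.skip :: K, s) => (K, s)
  | (.setN a e :: K, s) => (K, { s with int := Function.update s.int (a.eval s) (e.eval s) })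
  | (.setR a x :: K, s) => (K, { s with real := Function.update s.real (a.eval s) (x.eval s) })
  | (.sample :: K, s) =>
      (K, { s with
        buf := fun i => if h : i < d then ω.1 s.drawn ⟨i, h⟩ else 0
        drawn := s.drawn + 1 })
  | (.gauss a :: K, s) =>
      (K, { s with
        real := Function.update s.real (a.eval s) (ω.2 s.used)
        used := s.used + 1 })
  | (.seq p q :: K, s) => (p :: q :: K, s)
  | (.ite t p q :: K, s) => (if t.Holds s then p :: K else q :: K, s)
  | (.while t p :: K, s) => (if t.Holds s then p :: .while t p :: K else K, s)

/-- The initial memory: the integers `k`, `d` and the reals `Δ`, `ε` are in the cells `0` and `1`,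
everything else is zero. -/
def input (k d : ℕ) (Δ ε : ℝ) : State where
  int := fun i => if i = 0 then k else if i = 1 then d else 0
  real := fun i => if i = 0 then Δ else if i = 1 then ε else 0
  buf := fun _ => 0
  drawn := 0
  used := 0

/-- Started in memory `s₀` with randomness `ω`, the program `p` halts after at most `t` steps with
memory `s`. -/
def HaltsIn {d : ℕ} (p : Prog) (ω : Tape d) (s₀ : State) (t : ℕ) (s : State) : Prop :=
  (step ω)^[t] ([p], s₀) = ([], s)

/-- The output: `k` vectors in `ℝ^d`, stored one after the other in the real memory from the address
held by integer cell `0` on. -/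
def output (k d : ℕ) (s : State) : Fin k → EuclideanSpace ℝ (Fin d) :=
  fun j => WithLp.toLp 2 fun i : Fin d => s.real (s.int 0 + j * d + i)

/-! ### The parameters and the bounds -/

/-- Admissible parameters: at least two components, positive dimension, positive separation and
accuracy, and the accuracy below the stated threshold. -/
structure Admissible (k d : ℕ) (Δ ε : ℝ) : Prop where
  two_le : 2 ≤ k
  dim_pos : 1 ≤ d
  sep_pos : 0 < Δ
  acc_pos : 0 < ε
  acc_lt : ε < min (Δ / 100) (Δ / (32 * Real.sqrt (min (d : ℝ) (Real.log k))))

/-- `(1/Δ²) (min{d, log k} + log(Δ/ε)) (min{d + log k, d log(2 + d/Δ²)} + log(Δ/ε))`. -/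
def freqSq (k d : ℕ) (Δ ε : ℝ) : ℝ :=
  1 / Δ ^ 2 * (min (d : ℝ) (Real.log k) + Real.log (Δ / ε)) *
    (min (d + Real.log k) (d * Real.log (2 + d / Δ ^ 2)) + Real.log (Δ / ε))

/-- `C (Δ/ε)⁴ k³ log² k · max{(d/ε)^{C d}, d^{C d}} · exp(C M²)`. -/
def timeBound (C : ℝ) (k d : ℕ) (Δ ε : ℝ) : ℝ :=
  C * ((Δ / ε) ^ 4 * (k : ℝ) ^ 3 * Real.log k ^ 2) *
    max (((d : ℝ) / ε) ^ (C * d)) ((d : ℝ) ^ (C * d)) * Real.exp (C * freqSq k d Δ ε)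

/-- For every possible outcome of the randomness, `p` halts within `B` steps and has then drawn at
most `B` samples. -/
def RunsWithin (p : Prog) (k d : ℕ) (Δ ε B : ℝ) : Prop :=
  ∀ ω : Tape d, ∃ t s, HaltsIn p ω (input k d Δ ε) t s ∧ (t : ℝ) ≤ B ∧ (s.drawn : ℝ) ≤ B

end GMM

end

/-! Write e = min(ε, 1) and γ = `ratePar`, which is of order (min{d, log k} + log(Δ/e))/Δ². The
means are recovered as the points where F(x) = ∑_j exp(-(1/4 + γ)|μ_j - x|²) nearly reaches 1. For
this γ all terms except that of the closest mean are negligible compared with gap = (1/4 + γ)e², so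
F is at least 1 minus a small multiple of gap within e/4 of a mean, and at most 1 minus a larger
multiple at points farther than e from every mean (`kernelSum_ge_of_near`, `kernelSum_le_of_far`).
The bound on ε makes gap at most 1.

F can be estimated from samples. For X from N(μ, I) and a fixed frequency ζ, the expectation of
exp(-|X - x|²/2) cos(2⟨X - x, ζ⟩) is 2^(-d/2) exp(-|μ - x|²/4 - |ζ|²) cos⟨μ - x, ζ⟩. Multiplication
by exp(|ζ|²) removes the damping, and averaging over ζ from N(0, 2γI) turns the cosine into exp(-γ|μ
- x|²) (`integral_vecTerm_mixture`). To keep the terms bounded, frequencies with |ζ|² > `cutPar` are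
dropped. The window exp(-|X - x|²/2) pays off here: the truncation error is weighted by ∑_j
exp(-|μ_j - x|²/4), which a packing argument bounds independently of k (`abs_kernelSum_sub_le`).
Each term is now at most exp(`cutPar`), and Hoeffding's inequality determines the number n of
samples.

The points x that are tested are T fresh samples of the same mixture. There are enough of them that
every mean is likely to have one within e/4, and since they are independent of the samples in the
statistic, Hoeffding's inequality applies at each of them by Fubini (`measure_bad_le`). Greedy
selection with spacing Δ/2 among the candidates above the threshold then keeps exactly one vector
per mean (`epsClose_of_selected`).

The numbers of rounds depend on the parameters only, so the time bound, of order d(nT + T²), holds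
for every outcome of the randomness (`mainProg_run`). In `totalCost_le_exp` it is written as k³ log²
k times the exponential of a combination of d log(2 + d), d log(1/e) and M². The general bound
follows by absorbing the first two into (d/ε)^(Cd) or d^(Cd); in the low-dimensional regime all
three are O(log k) (`freqSq_le_log`). -/

namespace GMM

/-! ### A program logic with step counts -/

/-- Started in `s`, the program piece `p` finishes within `B` steps, whatever is still to be executed
afterwards, and then the memory satisfies `Q`. -/
def Run {d : ℕ} (ω : Tape d) (p : Prog) (s : State) (B : ℕ) (Q : State → Prop) : Prop :=
  ∃ t ≤ B, ∃ s', (∀ K, (step ω)^[t] (p :: K, s) = (K, s')) ∧ Q s'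

section Rules

variable {d : ℕ} {ω : Tape d} {p q : Prog} {s : State} {B B' : ℕ} {Q Q' : State → Prop}

theorem Run.mono (h : Run ω p s B Q) (hB : B ≤ B') (hQ : ∀ s', Q s' → Q' s') :
    Run ω p s B' Q' := by
  obtain ⟨t, ht, s', h, hs⟩ := h
  exact ⟨t, ht.trans hB, s', h, hQ _ hs⟩

theorem Run.skip (hB : 1 ≤ B) (h : Q s) : Run ω .skip s B Q :=
  ⟨1, hB, s, fun _ => rfl, h⟩

theorem Run.setN {a e : NExp} (hB : 1 ≤ B)
    (h : Q { s with int := Function.update s.int (a.eval s) (e.eval s) }) :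
    Run ω (.setN a e) s B Q :=
  ⟨1, hB, _, fun _ => rfl, h⟩

theorem Run.setR {a : NExp} {x : RExp} (hB : 1 ≤ B)
    (h : Q { s with real := Function.update s.real (a.eval s) (x.eval s) }) :
    Run ω (.setR a x) s B Q :=
  ⟨1, hB, _, fun _ => rfl, h⟩

theorem Run.sample (hB : 1 ≤ B)
    (h : Q { s with
      buf := fun i => if h : i < d then ω.1 s.drawn ⟨i, h⟩ else 0
      drawn := s.drawn + 1 }) :
    Run ω .sample s B Q :=
  ⟨1, hB, _, fun _ => rfl, h⟩

theorem Run.gauss {a : NExp} (hB : 1 ≤ B)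
    (h : Q { s with
      real := Function.update s.real (a.eval s) (ω.2 s.used)
      used := s.used + 1 }) :
    Run ω (.gauss a) s B Q :=
  ⟨1, hB, _, fun _ => rfl, h⟩

/-- The extra unit pays for unfolding the composition. While `p` runs, `q` waits in the list, which
is why `Run` quantifies over all continuations. -/
theorem Run.seq {b c : ℕ} (hB : b + c + 1 ≤ B)
    (h : Run ω p s b fun s' => Run ω q s' c Q) : Run ω (.seq p q) s B Q := by
  obtain ⟨t, ht, s', h, t', ht', s'', h', hQ⟩ := h
  refine ⟨t' + t + 1, by omega, s'', fun K => ?_, hQ⟩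
  rw [Function.iterate_add_apply, Function.iterate_add_apply]
  exact (congrArg _ (h (q :: K))).trans (h' K)

theorem Run.ite {t : Test} {b : ℕ} (hB : b + 1 ≤ B)
    (hp : t.Holds s → Run ω p s b Q) (hq : ¬ t.Holds s → Run ω q s b Q) :
    Run ω (.ite t p q) s B Q := by
  by_cases ht : t.Holds s
  · obtain ⟨n, hn, s', h, hs⟩ := hp ht
    refine ⟨n + 1, by omega, s', fun K => ?_, hs⟩
    rw [Function.iterate_add_apply]
    simpa [step, ht] using h K
  · obtain ⟨n, hn, s', h, hs⟩ := hq ht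
    refine ⟨n + 1, by omega, s', fun K => ?_, hs⟩
    rw [Function.iterate_add_apply]
    simpa [step, ht] using h K

/-- Total correctness for a loop whose number `N` of rounds is known beforehand: the invariant
carries the round index, each round costs its body and one test, and the last unit pays for the
failing test. -/
theorem Run.while {t : Test} {b : ℕ} (I : ℕ → State → Prop) (N : ℕ)
    (hB : N * (b + 1) + 1 ≤ B) (h0 : I 0 s)
    (hstep : ∀ i < N, ∀ s, I i s → t.Holds s ∧ Run ω p s b (I (i + 1)))
    (hend : ∀ s, I N s → ¬ t.Holds s ∧ Q s) : Run ω (.while t p) s B Q := by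
  have key : ∀ m i s, i + m = N → I i s → Run ω (.while t p) s (m * (b + 1) + 1) Q := by
    intro m
    induction m with
    | zero =>
      intro i s hi hs
      obtain ⟨h1, h2⟩ := hend s (by simpa [← hi] using hs)
      exact ⟨1, by omega, s, fun K => by simp [step, h1], h2⟩
    | succ m ih =>
      intro i s hi hs
      obtain ⟨h1, n, hn, s', h, hs'⟩ := hstep i (by omega) s hs
      obtain ⟨n', hn', s'', h', hs''⟩ := ih (i + 1) s' (by omega) hs'
      refine ⟨n' + n + 1, by rw [Nat.add_mul]; omega, s'', fun K => ?_, hs''⟩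
      rw [Function.iterate_add_apply, Function.iterate_add_apply, Function.iterate_one]
      have : step ω (.while t p :: K, s) = (p :: .while t p :: K, s) := by simp [step, h1]
      rw [this, h, h']
  exact (key N 0 s (by omega) h0).mono hB fun _ h => h

theorem Run.seqN {a e : NExp} {c : ℕ} (hB : c + 2 ≤ B)
    (h : Run ω q { s with int := Function.update s.int (a.eval s) (e.eval s) } c Q) :
    Run ω (.seq (.setN a e) q) s B Q :=
  .seq (b := 1) (by omega) (.setN le_rfl h)

theorem Run.seqR {a : NExp} {x : RExp} {c : ℕ} (hB : c + 2 ≤ B)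
    (h : Run ω q { s with real := Function.update s.real (a.eval s) (x.eval s) } c Q) :
    Run ω (.seq (.setR a x) q) s B Q :=
  .seq (b := 1) (by omega) (.setR le_rfl h)

theorem Run.seqSample {c : ℕ} (hB : c + 2 ≤ B)
    (h : Run ω q { s with
      buf := fun i => if h : i < d then ω.1 s.drawn ⟨i, h⟩ else 0
      drawn := s.drawn + 1 } c Q) :
    Run ω (.seq .sample q) s B Q :=
  .seq (b := 1) (by omega) (.sample le_rfl h)

theorem Run.seqGauss {a : NExp} {c : ℕ} (hB : c + 2 ≤ B)
    (h : Run ω q { s with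
      real := Function.update s.real (a.eval s) (ω.2 s.used)
      used := s.used + 1 } c Q) :
    Run ω (.seq (.gauss a) q) s B Q :=
  .seq (b := 1) (by omega) (.gauss le_rfl h)

theorem Run.haltsIn (h : Run ω p s B Q) : ∃ t s', HaltsIn p ω s t s' ∧ t ≤ B ∧ Q s' := by
  obtain ⟨t, ht, s', h, hs⟩ := h
  exact ⟨t, s', h [], ht, hs⟩

end Rules

/-! ### Syntax abbreviations -/

/-- The integer cell with the fixed address `a`. -/
abbrev nc (a : ℕ) : NExp := .mem (.lit a)

/-- The real cell with the fixed address `a`. -/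
abbrev rc (a : ℕ) : RExp := .mem (.lit a)

/-- A natural number as a real constant. -/
abbrev rl (a : ℕ) : RExp := .cast (.lit a)

/-- The smaller one of two reals. -/
def minExp (x y : RExp) : RExp :=
  .div (.sub (.add x y) (.sqrt (.mul (.sub x y) (.sub x y)))) (rl 2)

/-- Increase the integer cell `a` by one. -/
abbrev inc (a : ℕ) : Prog := .setN (.lit a) (.add (nc a) (.lit 1))

/-- The minimum is (x + y - |x - y|)/2, with the absolute value written as the root of a square. -/
theorem minExp_eval (x y : RExp) (s : State) :
    (minExp x y).eval s = min (x.eval s) (y.eval s) := by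
  simp only [minExp, RExp.eval, NExp.eval, Real.sqrt_mul_self_eq_abs]
  rcases le_total (x.eval s) (y.eval s) with h | h
  · rw [min_eq_left h, abs_of_nonpos (by linarith)]; push_cast; ring
  · rw [min_eq_right h, abs_of_nonneg (by linarith)]; push_cast; ring

end GMM

namespace GMM

/-! ### Building blocks of the program -/

/-- The coordinates of a vector, continued by zero. -/
def coords {d : ℕ} (v : EuclideanSpace ℝ (Fin d)) : ℕ → ℝ :=
  fun i => if h : i < d then v ⟨i, h⟩ else 0

/-- Store the current sample, each coordinate followed by a fresh Gaussian variate, from the address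
`32 + 2p` on, where `p` is the content of integer cell `3`. -/
def storeLoop : Prog :=
  .while (.nlt (nc 4) (nc 1))
    (.seq (.setR (.add (.lit 32) (.mul (.lit 2) (nc 3))) (.coord (nc 4)))
    (.seq (.gauss (.add (.lit 33) (.mul (.lit 2) (nc 3))))
    (.seq (inc 3) (inc 4))))

/-- Samples and variates interleave: samples at even, variates at odd addresses from 32 on. Real
cells below 32 hold parameters and scratch values, so the frame conditions are comparisons of
addresses. -/
theorem storeLoop_run {d : ℕ} (ω : Tape d) (s : State) (P : ℕ) (h1 : s.int 1 = d)
    (h3 : s.int 3 = P) (h4 : s.int 4 = 0) :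
    Run ω storeLoop s (d * 8 + 1) fun s' =>
      s'.buf = s.buf ∧ s'.drawn = s.drawn ∧ s'.used = s.used + d ∧ s'.int 3 = P + d ∧
      (∀ a, a ≠ 3 → a ≠ 4 → s'.int a = s.int a) ∧ (∀ a < 32 + 2 * P, s'.real a = s.real a) ∧
      ∀ i < d, s'.real (32 + 2 * (P + i)) = s.buf i ∧
        s'.real (33 + 2 * (P + i)) = ω.2 (s.used + i) := by
  refine Run.while (b := 7) (fun j s' =>
    s'.buf = s.buf ∧ s'.drawn = s.drawn ∧ s'.used = s.used + j ∧ s'.int 3 = P + j ∧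
    s'.int 4 = j ∧
    (∀ a, a ≠ 3 → a ≠ 4 → s'.int a = s.int a) ∧ (∀ a < 32 + 2 * P, s'.real a = s.real a) ∧
    ∀ i < j, s'.real (32 + 2 * (P + i)) = s.buf i ∧
      s'.real (33 + 2 * (P + i)) = ω.2 (s.used + i)) d le_rfl ?_ ?_ ?_
  · simp [h3, h4]
  · rintro j hj s' ⟨hb, hd, hu, hp, hi, hf, hr, hv⟩
    refine ⟨by simp [Test.Holds, NExp.eval, hi, hf, h1, hj], ?_⟩
    refine Run.seqR (c := 5) le_rfl (Run.seqGauss (c := 3) le_rfl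
      (Run.seqN (c := 1) le_rfl (Run.setN le_rfl ?_)))
    simp only [NExp.eval, RExp.eval, hp, hi, hb, hu, Function.update_apply]
    refine ⟨trivial, hd, by ring, by simp [add_assoc], by simp, ?_, ?_, ?_⟩
    · intro a h3 h4; simp [h3, h4, hf]
    · intro a ha
      rw [if_neg (by omega), if_neg (by omega), hr a ha]
    · intro i hij
      rcases Nat.lt_succ_iff_lt_or_eq.mp hij with h | rfl
      · rw [if_neg (by omega), if_neg (by omega), if_neg (by omega), if_neg (by omega)]
        exact hv i h
      · simp
  · rintro s' ⟨hb, hd, hu, hp, hi, hf, hr, hv⟩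
    exact ⟨by simp [Test.Holds, NExp.eval, hi, hf, h1], hb, hd, hu, hp, hf, hr, hv⟩

/-- Accumulate `|X - x|²`, `⟨X - x, ζ⟩` and `|ζ|²` for one stored sample `X` and the frequency `ζ`
stored with it, where `x` is the current sample. -/
def dotLoop : Prog :=
  .while (.nlt (nc 4) (nc 1))
    (.seq (.setR (.lit 21) (.sub (.mem (.add (.lit 32) (.mul (.lit 2) (nc 3)))) (.coord (nc 4))))
    (.seq (.setR (.lit 22) (.mul (rc 14) (.mem (.add (.lit 33) (.mul (.lit 2) (nc 3))))))
    (.seq (.setR (.lit 17) (.add (rc 17) (.mul (rc 21) (rc 21))))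
    (.seq (.setR (.lit 18) (.add (rc 18) (.mul (rc 21) (rc 22))))
    (.seq (.setR (.lit 19) (.add (rc 19) (.mul (rc 22) (rc 22))))
    (.seq (inc 3) (inc 4)))))))

theorem dotLoop_run {d : ℕ} (ω : Tape d) (s : State) (P : ℕ) (h1 : s.int 1 = d)
    (h3 : s.int 3 = P) (h4 : s.int 4 = 0) (X G : ℕ → ℝ)
    (hX : ∀ i < d, s.real (32 + 2 * (P + i)) = X i)
    (hG : ∀ i < d, s.real (33 + 2 * (P + i)) = G i)
    (h17 : s.real 17 = 0) (h18 : s.real 18 = 0) (h19 : s.real 19 = 0) :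
    Run ω dotLoop s (d * 14 + 1) fun s' =>
      s'.buf = s.buf ∧ s'.drawn = s.drawn ∧ s'.used = s.used ∧ s'.int 3 = P + d ∧
      (∀ a, a ≠ 3 → a ≠ 4 → s'.int a = s.int a) ∧
      (∀ a, (a < 17 ∨ 22 < a) → s'.real a = s.real a) ∧
      s'.real 17 = ∑ i ∈ Finset.range d, (X i - s.buf i) ^ 2 ∧
      s'.real 18 = ∑ i ∈ Finset.range d, (X i - s.buf i) * (s.real 14 * G i) ∧
      s'.real 19 = ∑ i ∈ Finset.range d, (s.real 14 * G i) ^ 2 := by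
  refine Run.while (b := 13) (fun j s' =>
      s'.buf = s.buf ∧ s'.drawn = s.drawn ∧ s'.used = s.used ∧ s'.int 3 = P + j ∧ s'.int 4 = j ∧
      (∀ a, a ≠ 3 → a ≠ 4 → s'.int a = s.int a) ∧
      (∀ a, (a < 17 ∨ 22 < a) → s'.real a = s.real a) ∧
      s'.real 17 = ∑ i ∈ Finset.range j, (X i - s.buf i) ^ 2 ∧
      s'.real 18 = ∑ i ∈ Finset.range j, (X i - s.buf i) * (s.real 14 * G i) ∧
      s'.real 19 = ∑ i ∈ Finset.range j, (s.real 14 * G i) ^ 2) d le_rfl ?_ ?_ ?_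
  · simp [h3, h4, h17, h18, h19]
  · rintro j hj s' ⟨hb, hd, hu, hp, hi, hf, hr, v1, v2, v3⟩
    refine ⟨by simp [Test.Holds, NExp.eval, hi, hf, h1, hj], ?_⟩
    have e1 : s'.real (32 + 2 * (P + j)) = X j := (hr _ (by omega)).trans (hX j hj)
    have e2 : s'.real (33 + 2 * (P + j)) = G j := (hr _ (by omega)).trans (hG j hj)
    have e3 : s'.real 14 = s.real 14 := hr _ (by omega)
    refine Run.seqR (c := 11) le_rfl (Run.seqR (c := 9) le_rfl (Run.seqR (c := 7) le_rfl
      (Run.seqR (c := 5) le_rfl (Run.seqR (c := 3) le_rfl (Run.seqN (c := 1) le_rfl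
      (Run.setN le_rfl ?_))))))
    simp only [NExp.eval, RExp.eval, hp, hi, hb, hu, Function.update_apply]
    refine ⟨trivial, hd, trivial, by simp [add_assoc], by simp, ?_, ?_, ?_, ?_, ?_⟩
    · intro a h3 h4; simp [h3, h4, hf]
    · intro a ha
      rw [if_neg (by omega), if_neg (by omega), if_neg (by omega), if_neg (by omega),
        if_neg (by omega), hr a ha]
    · simp [Finset.sum_range_succ, v1, e1, sq]
    · have : ¬ 33 + 2 * (P + j) = 21 := by omega
      simp [Finset.sum_range_succ, v2, e1, e2, e3, this]
    · have : ¬ 33 + 2 * (P + j) = 21 := by omega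
      simp [Finset.sum_range_succ, v3, e2, e3, sq, this]
  · rintro s' ⟨hb, hd, hu, hp, hi, hf, hr, v1, v2, v3⟩
    exact ⟨by simp [Test.Holds, NExp.eval, hi, hf, h1], hb, hd, hu, hp, hf, hr, v1, v2, v3⟩

/-- The contribution of one sample `X` with Gaussian variates `G` to the statistic at `x`:
with `ζ = r G`, it is `exp (|ζ|² - |X - x|² / 2) cos (2 ⟨X - x, ζ⟩)` if `|ζ|² ≤ M2`, else `0`. -/
noncomputable def statTerm (d : ℕ) (r M2 : ℝ) (X G x : ℕ → ℝ) : ℝ :=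
  if M2 < ∑ i ∈ Finset.range d, (r * G i) ^ 2 then 0 else
    Real.exp (∑ i ∈ Finset.range d, (r * G i) ^ 2 -
      (∑ i ∈ Finset.range d, (X i - x i) ^ 2) / 2) *
    Real.cos (2 * ∑ i ∈ Finset.range d, (X i - x i) * (r * G i))

/-- Accumulate the statistic at the current sample in real cell `16`. -/
def statLoop : Prog :=
  .while (.nlt (nc 5) (nc 2))
    (.seq (.setR (.lit 17) (rl 0))
    (.seq (.setR (.lit 18) (rl 0))
    (.seq (.setR (.lit 19) (rl 0))
    (.seq (.setN (.lit 4) (.lit 0))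
    (.seq dotLoop
    (.seq (.ite (.rlt (rc 9) (rc 19)) .skip
      (.setR (.lit 16) (.add (rc 16) (.mul (.exp (.sub (rc 19) (.div (rc 17) (rl 2))))
        (.cos (.mul (rl 2) (rc 18)))))))
    (inc 5)))))))

theorem statLoop_run {d : ℕ} (ω : Tape d) (s : State) (n : ℕ) (h1 : s.int 1 = d)
    (h2 : s.int 2 = n) (h3 : s.int 3 = 0) (h5 : s.int 5 = 0) (X G : ℕ → ℕ → ℝ)
    (hX : ∀ l < n, ∀ i < d, s.real (32 + 2 * (l * d + i)) = X l i)
    (hG : ∀ l < n, ∀ i < d, s.real (33 + 2 * (l * d + i)) = G l i)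
    (h16 : s.real 16 = 0) :
    Run ω statLoop s (n * (d * 14 + 15) + 1) fun s' =>
      s'.buf = s.buf ∧ s'.drawn = s.drawn ∧ s'.used = s.used ∧
      (∀ a, a ≠ 3 → a ≠ 4 → a ≠ 5 → s'.int a = s.int a) ∧
      (∀ a, (a < 16 ∨ 22 < a) → s'.real a = s.real a) ∧
      s'.real 16 = ∑ l ∈ Finset.range n,
        statTerm d (s.real 14) (s.real 9) (X l) (G l) s.buf := by
  refine Run.while (b := d * 14 + 14) (fun l s' =>
      s'.buf = s.buf ∧ s'.drawn = s.drawn ∧ s'.used = s.used ∧ s'.int 3 = l * d ∧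
      s'.int 5 = l ∧ (∀ a, a ≠ 3 → a ≠ 4 → a ≠ 5 → s'.int a = s.int a) ∧
      (∀ a, (a < 16 ∨ 22 < a) → s'.real a = s.real a) ∧
      s'.real 16 = ∑ l ∈ Finset.range l,
        statTerm d (s.real 14) (s.real 9) (X l) (G l) s.buf) n le_rfl ?_ ?_ ?_
  · simp [h3, h5, h16]
  · rintro l hl s' ⟨hb, hd, hu, hp, hi, hf, hr, v⟩
    refine ⟨by simp [Test.Holds, NExp.eval, hi, hf, h2, hl], ?_⟩
    refine Run.seqR (c := d * 14 + 12) le_rfl (Run.seqR (c := d * 14 + 10) le_rfl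
      (Run.seqR (c := d * 14 + 8) le_rfl (Run.seqN (c := d * 14 + 6) le_rfl
      (Run.seq (b := d * 14 + 1) (c := 4) le_rfl ?_))))
    refine (dotLoop_run ω _ (l * d) ?_ ?_ ?_ (X l) (G l) ?_ ?_ ?_ ?_ ?_).mono le_rfl ?_
    · simp [NExp.eval, hf, h1]
    · simp [NExp.eval, hp]
    · simp [NExp.eval]
    · intro i hi
      simp only [NExp.eval, Function.update_apply]
      rw [if_neg (by omega), if_neg (by omega), if_neg (by omega), hr _ (by omega), hX l hl i hi]
    · intro i hi
      simp only [NExp.eval, Function.update_apply]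
      rw [if_neg (by omega), if_neg (by omega), if_neg (by omega), hr _ (by omega), hG l hl i hi]
    · simp [NExp.eval, RExp.eval]
    · simp [NExp.eval, RExp.eval]
    · simp [NExp.eval, RExp.eval]
    · rintro s'' ⟨hb', hd', hu', hp', hf', hr', v1, v2, v3⟩
      simp only [NExp.eval, RExp.eval, Function.update_apply] at hf' hr'
      have e14 : s'.real 14 = s.real 14 := hr _ (by omega)
      have e9 : s''.real 9 = s.real 9 := (hr' 9 (by omega)).trans (hr _ (by omega))
      have e16 : s''.real 16 = s'.real 16 := hr' 16 (by omega)
      simp only [NExp.eval, Function.update_apply, hb] at v1 v2 v3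
      simp only [Nat.reduceEqDiff, if_false, e14] at v1 v2 v3
      -- Both branches of the test end with the same increment. The invariant is restored once, for
      -- any real memory that differs from that of `s''` only in the accumulator 16.
      have hI : ∀ x : ℝ, x = ∑ l ∈ Finset.range (l + 1),
            statTerm d (s.real 14) (s.real 9) (X l) (G l) s.buf →
          ∀ R : ℕ → ℝ, (∀ a, a ≠ 16 → R a = s''.real a) → R 16 = x →
          Run ω (inc 5) { s'' with real := R } 1 fun s' =>
            s'.buf = s.buf ∧ s'.drawn = s.drawn ∧ s'.used = s.used ∧ s'.int 3 = (l + 1) * d ∧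
            s'.int 5 = l + 1 ∧ (∀ a, a ≠ 3 → a ≠ 4 → a ≠ 5 → s'.int a = s.int a) ∧
            (∀ a, (a < 16 ∨ 22 < a) → s'.real a = s.real a) ∧
            s'.real 16 = ∑ l ∈ Finset.range (l + 1),
              statTerm d (s.real 14) (s.real 9) (X l) (G l) s.buf := by
        intro x hx R hR hR'
        refine Run.setN le_rfl ⟨by simp [hb', hb], by simp [hd', hd], by simp [hu', hu], ?_, ?_,
          ?_, ?_, hR'.trans hx⟩
        · simp [NExp.eval, hp', add_mul]
        · have : s''.int 5 = l := by simpa [hi] using hf' 5 (by omega) (by omega)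
          simp [NExp.eval, this]
        · intro a a3 a4 a5
          have := hf' a a3 a4
          simp [NExp.eval, a5, this, a4, hf a a3 a4 a5]
        · intro a ha
          have := hr' a (by omega)
          rw [if_neg (by omega), if_neg (by omega), if_neg (by omega), hr a ha] at this
          simpa [hR a (by omega)] using this
      refine Run.seq (b := 2) (c := 1) le_rfl (Run.ite (b := 1) le_rfl (fun ht => ?_) fun ht => ?_)
      · refine Run.skip le_rfl (hI _ ?_ s''.real (fun _ _ => rfl) rfl)
        simp only [Test.Holds, RExp.eval, NExp.eval, e9, v3] at ht
        rw [Finset.sum_range_succ, statTerm, if_pos ht, e16, v, add_zero]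
      · refine Run.setR le_rfl (hI _ ?_ _ (fun a ha => ?_) rfl)
        · simp only [Test.Holds, RExp.eval, NExp.eval, e9, v3] at ht
          rw [Finset.sum_range_succ, statTerm, if_neg ht]
          simp [NExp.eval, RExp.eval, e16, v, v1, v2, v3]
        · simp [NExp.eval, ha]
  · rintro s' ⟨hb, hd, hu, hp, hi, hf, hr, v⟩
    exact ⟨by simp [Test.Holds, NExp.eval, hi, hf, h2], hb, hd, hu, hf, hr, v⟩

end GMM

/-! ### Greedy selection of separated candidates -/

namespace GMM

/-- The squared distance of two vectors given by their coordinates. -/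
noncomputable def sqDist (d : ℕ) (x y : ℕ → ℝ) : ℝ := ∑ i ∈ Finset.range d, (x i - y i) ^ 2

/-- Add to real cell `20` the squared distance between the current sample and the vector stored at
the address held by integer cell `11`. -/
def distLoop : Prog :=
  .while (.nlt (nc 4) (nc 1))
    (.seq (.setR (.lit 21) (.sub (.mem (nc 11)) (.coord (nc 4))))
    (.seq (.setR (.lit 20) (.add (rc 20) (.mul (rc 21) (rc 21))))
    (.seq (inc 11) (inc 4))))

/-- The condition `23 ≤ q` keeps the stored vector clear of the scratch cells that the loop
overwrites. -/
theorem distLoop_run {d : ℕ} (ω : Tape d) (s : State) (q : ℕ) (hq : 23 ≤ q) (h1 : s.int 1 = d)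
    (h11 : s.int 11 = q) (h4 : s.int 4 = 0) (h20 : s.real 20 = 0) (X : ℕ → ℝ)
    (hX : ∀ i < d, s.real (q + i) = X i) :
    Run ω distLoop s (d * 8 + 1) fun s' =>
      s'.buf = s.buf ∧ s'.drawn = s.drawn ∧ s'.used = s.used ∧ s'.int 11 = q + d ∧
      (∀ a, a ≠ 4 → a ≠ 11 → s'.int a = s.int a) ∧
      (∀ a, (a < 20 ∨ 21 < a) → s'.real a = s.real a) ∧
      s'.real 20 = sqDist d X s.buf := by
  refine Run.while (b := 7) (fun j s' =>
      s'.buf = s.buf ∧ s'.drawn = s.drawn ∧ s'.used = s.used ∧ s'.int 11 = q + j ∧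
      s'.int 4 = j ∧ (∀ a, a ≠ 4 → a ≠ 11 → s'.int a = s.int a) ∧
      (∀ a, (a < 20 ∨ 21 < a) → s'.real a = s.real a) ∧
      s'.real 20 = sqDist j X s.buf) d le_rfl ?_ ?_ ?_
  · simp [h11, h4, h20, sqDist]
  · rintro j hj s' ⟨hb, hd, hu, hp, hi, hf, hr, v⟩
    refine ⟨by simp [Test.Holds, NExp.eval, hi, hf, h1, hj], ?_⟩
    have e1 : s'.real (q + j) = X j := (hr _ (by omega)).trans (hX j hj)
    refine Run.seqR (c := 5) le_rfl (Run.seqR (c := 3) le_rfl (Run.seqN (c := 1) le_rfl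
      (Run.setN le_rfl ?_)))
    simp only [NExp.eval, RExp.eval, hp, hi, hb, hu, Function.update_apply]
    refine ⟨trivial, hd, trivial, by simp [add_assoc], by simp, ?_, ?_, ?_⟩
    · intro a h4 h11; simp [h4, h11, hf]
    · intro a ha
      rw [if_neg (by omega), if_neg (by omega), hr a ha]
    · simp only [sqDist] at v
      simp [sqDist, Finset.sum_range_succ, v, e1, sq]
  · rintro s' ⟨hb, hd, hu, hp, hi, hf, hr, v⟩
    exact ⟨by simp [Test.Holds, NExp.eval, hi, hf, h1], hb, hd, hu, hp, hf, hr, v⟩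

/-- Set integer cell `9` to zero if the current sample is at distance less than `Δ / 2` from one of
the vectors selected so far. -/
def checkLoop : Prog :=
  .while (.nlt (nc 8) (nc 7))
    (.seq (.setR (.lit 20) (rl 0))
    (.seq (.setN (.lit 4) (.lit 0))
    (.seq distLoop
    (.seq (.ite (.rlt (rc 20) (.div (.mul (rc 0) (rc 0)) (rl 4))) (.setN (.lit 9) (.lit 0)) .skip)
    (inc 8)))))

/-- The flag in integer cell 9 starts at 1 and can only be cleared, so at the end it tells whether
every comparison succeeded. -/
theorem checkLoop_run {d : ℕ} (ω : Tape d) (s : State) (b m : ℕ) (hb : 23 ≤ b)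
    (h1 : s.int 1 = d) (h7 : s.int 7 = m) (h8 : s.int 8 = 0) (h9 : s.int 9 = 1)
    (h11 : s.int 11 = b) (X : ℕ → ℕ → ℝ) (hX : ∀ j < m, ∀ i < d, s.real (b + j * d + i) = X j i) :
    Run ω checkLoop s (m * (d * 8 + 11) + 1) fun s' =>
      s'.buf = s.buf ∧ s'.drawn = s.drawn ∧ s'.used = s.used ∧ s'.int 11 = b + m * d ∧
      (∀ a, a ≠ 4 → a ≠ 8 → a ≠ 9 → a ≠ 11 → s'.int a = s.int a) ∧
      (∀ a, (a < 20 ∨ 21 < a) → s'.real a = s.real a) ∧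
      (0 < s'.int 9 ↔ ∀ j < m, ¬ sqDist d (X j) s.buf < s.real 0 * s.real 0 / 4) := by
  refine Run.while (b := d * 8 + 10) (fun j s' =>
      s'.buf = s.buf ∧ s'.drawn = s.drawn ∧ s'.used = s.used ∧ s'.int 11 = b + j * d ∧
      s'.int 8 = j ∧ (∀ a, a ≠ 4 → a ≠ 8 → a ≠ 9 → a ≠ 11 → s'.int a = s.int a) ∧
      (∀ a, (a < 20 ∨ 21 < a) → s'.real a = s.real a) ∧
      (0 < s'.int 9 ↔ ∀ i < j, ¬ sqDist d (X i) s.buf < s.real 0 * s.real 0 / 4)) m le_rfl ?_ ?_ ?_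
  · simp [h8, h9, h11]
  · rintro j hj s' ⟨hbuf, hd, hu, hp, hi, hf, hr, v⟩
    refine ⟨by simp [Test.Holds, NExp.eval, hi, hf, h7, hj], ?_⟩
    refine Run.seqR (c := d * 8 + 8) le_rfl (Run.seqN (c := d * 8 + 6) le_rfl
      (Run.seq (b := d * 8 + 1) (c := 4) le_rfl ?_))
    refine (distLoop_run ω _ (b + j * d) (by omega) ?_ ?_ ?_ ?_ (X j) ?_).mono le_rfl ?_
    · simp [NExp.eval, hf, h1]
    · simp [NExp.eval, hp]
    · simp [NExp.eval]
    · simp [NExp.eval, RExp.eval]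
    · intro i hi
      simp only [NExp.eval, Function.update_apply]
      rw [if_neg (by omega), hr _ (by omega), hX j hj i hi]
    · rintro s'' ⟨hb', hd', hu', hp', hf', hr', v'⟩
      simp only [NExp.eval, RExp.eval, Function.update_apply] at hf' hr'
      simp only [hbuf] at v'
      -- Common end of both branches, for any integer memory that differs from that of `s''` only in
      -- the flag.
      have hI : ∀ I : ℕ → ℕ, (∀ a, a ≠ 9 → I a = s''.int a) →
          (0 < I 9 ↔ ∀ i < j + 1, ¬ sqDist d (X i) s.buf < s.real 0 * s.real 0 / 4) →
          Run ω (inc 8) { s'' with int := I } 1 fun s' =>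
            s'.buf = s.buf ∧ s'.drawn = s.drawn ∧ s'.used = s.used ∧ s'.int 11 = b + (j + 1) * d ∧
            s'.int 8 = j + 1 ∧ (∀ a, a ≠ 4 → a ≠ 8 → a ≠ 9 → a ≠ 11 → s'.int a = s.int a) ∧
            (∀ a, (a < 20 ∨ 21 < a) → s'.real a = s.real a) ∧
            (0 < s'.int 9 ↔ ∀ i < j + 1, ¬ sqDist d (X i) s.buf < s.real 0 * s.real 0 / 4) := by
        intro I hI hI9
        refine Run.setN le_rfl ⟨by simp [hb', hbuf], by simp [hd', hd], by simp [hu', hu], ?_, ?_,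
          ?_, ?_, ?_⟩
        · simp [NExp.eval, hI, hp', add_mul, add_assoc]
        · have : s''.int 8 = j := by simpa [hi] using hf' 8 (by omega) (by omega)
          simp [NExp.eval, hI, this]
        · intro a a4 a8 a9 a11
          have := hf' a a4 a11
          simp [NExp.eval, a8, this, hI, a9, a4, hf a a4 a8 a9 a11]
        · intro a ha
          have := hr' a ha
          rwa [if_neg (by omega), hr a ha] at this
        · simpa [NExp.eval] using hI9
      have e0 : s''.real 0 = s.real 0 := by
        have := hr' 0 (by omega)
        rwa [if_neg (by omega), hr 0 (by omega)] at this
      have e9 : s''.int 9 = s'.int 9 := by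
        have := hf' 9 (by omega) (by omega)
        rwa [if_neg (by omega)] at this
      refine Run.seq (b := 2) (c := 1) le_rfl (Run.ite (b := 1) le_rfl (fun ht => ?_) fun ht => ?_)
      · refine Run.setN le_rfl (hI _ (fun a ha => ?_) ?_)
        · simp [NExp.eval, ha]
        · simp only [Test.Holds, RExp.eval, NExp.eval, e0, v', Nat.cast_ofNat] at ht
          simp only [NExp.eval, Function.update_self, lt_self_iff_false, false_iff, not_forall]
          exact ⟨j, by omega, fun h => h ht⟩
      · refine Run.skip le_rfl (hI s''.int (fun a ha => rfl) ?_)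
        simp only [Test.Holds, RExp.eval, NExp.eval, e0, v', Nat.cast_ofNat] at ht
        rw [e9, v]
        refine ⟨fun h i hi => ?_, fun h i hi => h i (by omega)⟩
        rcases Nat.lt_succ_iff_lt_or_eq.mp hi with h' | rfl
        · exact h i h'
        · exact ht
  · rintro s' ⟨hb, hd, hu, hp, hi, hf, hr, v⟩
    exact ⟨by simp [Test.Holds, NExp.eval, hi, hf, h7], hb, hd, hu, hp, hf, hr, v⟩

/-- Copy the current sample to the address held by integer cell `11`. -/
def copyLoop : Prog :=
  .while (.nlt (nc 4) (nc 1))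
    (.seq (.setR (nc 11) (.coord (nc 4))) (.seq (inc 11) (inc 4)))

theorem copyLoop_run {d : ℕ} (ω : Tape d) (s : State) (q : ℕ) (h1 : s.int 1 = d)
    (h11 : s.int 11 = q) (h4 : s.int 4 = 0) :
    Run ω copyLoop s (d * 6 + 1) fun s' =>
      s'.buf = s.buf ∧ s'.drawn = s.drawn ∧ s'.used = s.used ∧
      (∀ a, a ≠ 4 → a ≠ 11 → s'.int a = s.int a) ∧ (∀ a < q, s'.real a = s.real a) ∧
      ∀ i < d, s'.real (q + i) = s.buf i := by
  refine Run.while (b := 5) (fun j s' =>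
    s'.buf = s.buf ∧ s'.drawn = s.drawn ∧ s'.used = s.used ∧ s'.int 11 = q + j ∧ s'.int 4 = j ∧
    (∀ a, a ≠ 4 → a ≠ 11 → s'.int a = s.int a) ∧ (∀ a < q, s'.real a = s.real a) ∧
      ∀ i < j, s'.real (q + i) = s.buf i) d le_rfl ?_ ?_ ?_
  · simp [h11, h4]
  · rintro j hj s' ⟨hb, hd, hu, hp, hi, hf, hr, v⟩
    refine ⟨by simp [Test.Holds, NExp.eval, hi, hf, h1, hj], ?_⟩
    refine Run.seqR (c := 3) le_rfl (Run.seqN (c := 1) le_rfl (Run.setN le_rfl ?_))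
    simp only [NExp.eval, RExp.eval, hp, hi, hb, hu, Function.update_apply]
    refine ⟨trivial, hd, trivial, by simp [add_assoc], by simp, ?_, ?_, ?_⟩
    · intro a h4 h11; simp [h4, h11, hf]
    · intro a ha
      rw [if_neg (by omega), hr a ha]
    · intro i hi'
      rcases Nat.lt_succ_iff_lt_or_eq.mp hi' with h | rfl
      · rw [if_neg (by omega)]
        exact v i h
      · simp
  · rintro s' ⟨hb, hd, hu, hp, hi, hf, hr, v⟩
    exact ⟨by simp [Test.Holds, NExp.eval, hi, hf, h1], hb, hd, hu, hf, hr, v⟩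

open Classical in
/-- The list of selected vectors after the first `t` candidates: a candidate is selected if its
statistic exceeds the threshold and its squared distance to all selected vectors is at least
`D`. -/
noncomputable def selected (d : ℕ) (thr D : ℝ) (stat : (ℕ → ℝ) → ℝ) (x : ℕ → ℕ → ℝ) :
    ℕ → List (ℕ → ℝ)
  | 0 => []
  | t + 1 =>
    if thr < stat (x t) ∧ ∀ y ∈ selected d thr D stat x t, ¬ sqDist d y (x t) < D then
      selected d thr D stat x t ++ [x t]
    else selected d thr D stat x t

/-- Append the current sample to the selected vectors if it is far from all of them. -/
def appendProg : Prog :=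
  .seq (.setN (.lit 9) (.lit 1))
  (.seq (.setN (.lit 8) (.lit 0))
  (.seq (.setN (.lit 11) (nc 10))
  (.seq checkLoop
  (.ite (.nlt (.lit 0) (nc 9)) (.seq (.setN (.lit 4) (.lit 0)) (.seq copyLoop (inc 7))) .skip))))

theorem length_selected_le (d : ℕ) (thr D : ℝ) (stat : (ℕ → ℝ) → ℝ) (x : ℕ → ℕ → ℝ) (t : ℕ) :
    (selected d thr D stat x t).length ≤ t := by
  induction t with
  | zero => simp [selected]
  | succ t ih => rw [selected]; split_ifs <;> grind

open Classical in
-- The selected vectors form a contiguous block starting at `b`; appending writes at its end and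
-- leaves the earlier entries intact.
theorem appendProg_run {d : ℕ} (ω : Tape d) (s : State) (b : ℕ) (hb : 23 ≤ b) (l : List (ℕ → ℝ))
    (h1 : s.int 1 = d) (h7 : s.int 7 = l.length) (h10 : s.int 10 = b)
    (hl : ∀ j (hj : j < l.length), ∀ i < d, s.real (b + j * d + i) = l[j] i) :
    Run ω appendProg s (l.length * (d * 8 + 11) + d * 6 + 14) fun s' =>
      let l' := if ∀ y ∈ l, ¬ sqDist d y s.buf < s.real 0 * s.real 0 / 4 then l ++ [s.buf] else l
      s'.buf = s.buf ∧ s'.drawn = s.drawn ∧ s'.used = s.used ∧ s'.int 7 = l'.length ∧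
      (∀ a, (a < 4 ∨ a = 5 ∨ a = 6 ∨ a = 10) → s'.int a = s.int a) ∧
      (∀ a < b, (a < 20 ∨ 21 < a) → s'.real a = s.real a) ∧
      ∀ j (hj : j < l'.length), ∀ i < d, s'.real (b + j * d + i) = l'[j] i := by
  refine Run.seqN (c := l.length * (d * 8 + 11) + d * 6 + 12) le_rfl
    (Run.seqN (c := l.length * (d * 8 + 11) + d * 6 + 10) le_rfl
    (Run.seqN (c := l.length * (d * 8 + 11) + d * 6 + 8) le_rfl
    (Run.seq (b := l.length * (d * 8 + 11) + 1) (c := d * 6 + 6) (by omega) ?_)))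
  refine (checkLoop_run ω _ b l.length hb ?_ ?_ ?_ ?_ ?_ (fun j => l.getD j 0) ?_).mono le_rfl ?_
  · simp [NExp.eval, h1]
  · simp [NExp.eval, h7]
  · simp [NExp.eval]
  · simp [NExp.eval]
  · simp [NExp.eval, h10]
  · intro j hj i hi
    simp [hl j hj i hi, hj]
  rintro s' ⟨hb', hd', hu', hp', hf', hr', v'⟩
  simp only [NExp.eval] at hb' hd' hu' hr' hf' v'
  have hf : ∀ a, a ≠ 4 → a ≠ 8 → a ≠ 9 → a ≠ 11 → s'.int a = s.int a := by
    intro a a4 a8 a9 a11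
    simpa [a4, a8, a9, a11] using hf' a a4 a8 a9 a11
  have hv : 0 < s'.int 9 ↔ ∀ y ∈ l, ¬ sqDist d y s.buf < s.real 0 * s.real 0 / 4 := by
    rw [v', List.forall_mem_iff_getElem]
    refine forall_congr' fun j => forall_congr' fun hj => ?_
    simp [hj]
  refine Run.ite (b := d * 6 + 5) (by omega) (fun ht => ?_) (fun ht => ?_)
  · simp only [Test.Holds, NExp.eval, hv] at ht
    rw [if_pos ht]
    refine Run.seqN (c := d * 6 + 3) (by omega) (Run.seq (b := d * 6 + 1) (c := 1) (by omega) ?_)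
    refine (copyLoop_run ω _ (b + l.length * d) ?_ ?_ ?_).mono le_rfl ?_
    · simp [NExp.eval, hf, h1]
    · simp [NExp.eval, hp']
    · simp [NExp.eval]
    rintro s'' ⟨hb'', hd'', hu'', hf'', hr'', v''⟩
    simp only [NExp.eval, hb'] at hb'' hd'' hu'' hr'' hf'' v''
    refine Run.setN le_rfl ⟨by simp [hb''], by simp [hd'', hd'], by simp [hu'', hu'], ?_, ?_, ?_, ?_⟩
    · have : s''.int 7 = l.length := by
        rw [hf'' 7 (by omega) (by omega), Function.update_of_ne (by omega),
          hf 7 (by omega) (by omega) (by omega) (by omega), h7]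
      simp [NExp.eval, this]
    · intro a ha
      simp only [NExp.eval]
      rw [Function.update_of_ne (by omega), hf'' a (by omega) (by omega),
        Function.update_of_ne (by omega), hf a (by omega) (by omega) (by omega) (by omega)]
    · intro a ha ha'
      exact (hr'' a (by omega)).trans (hr' a ha')
    · intro j hj i hi
      simp only [List.length_append, List.length_cons, List.length_nil, zero_add] at hj
      rcases Nat.lt_succ_iff_lt_or_eq.mp hj with h | rfl
      · rw [List.getElem_append_left h, ← hl j h i hi]
        have : b + j * d + i < b + l.length * d := by nlinarith
        exact (hr'' _ this).trans (hr' _ (by omega))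
      · simpa using v'' i hi
  · simp only [Test.Holds, NExp.eval, hv] at ht
    rw [if_neg ht]
    refine Run.skip (by omega) ⟨hb', hd', hu', ?_, ?_, ?_, ?_⟩
    · rw [hf 7 (by omega) (by omega) (by omega) (by omega), h7]
    · intro a ha
      exact hf a (by omega) (by omega) (by omega) (by omega)
    · intro a _ ha'
      exact hr' a ha'
    · intro j hj i hi
      rw [← hl j hj i hi]
      exact hr' _ (by omega)

end GMM

/-! ### The two sampling loops -/

namespace GMM

/-- Draw and store the samples for the statistic, together with the Gaussian variates. -/
def collectLoop : Prog :=
  .while (.rlt (.cast (nc 2)) (rc 13))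
    (.seq .sample (.seq (.setN (.lit 4) (.lit 0)) (.seq storeLoop (inc 2))))

/-- An integer counter is compared with a real bound, so the loop stops exactly at the ceiling of
the bound; this rounds the bound without a rounding instruction. Sample `l` is paired with the
variates `l * d`, …, `l * d + d - 1`. -/
theorem collectLoop_run {d : ℕ} (ω : Tape d) (s : State) (h1 : s.int 1 = d) (h2 : s.int 2 = 0)
    (h3 : s.int 3 = 0) (hd : s.drawn = 0) (hu : s.used = 0) :
    Run ω collectLoop s (⌈s.real 13⌉₊ * (d * 8 + 8) + 1) fun s' =>
      s'.drawn = ⌈s.real 13⌉₊ ∧ s'.int 2 = ⌈s.real 13⌉₊ ∧ s'.int 3 = ⌈s.real 13⌉₊ * d ∧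
      (∀ a, a ≠ 2 → a ≠ 3 → a ≠ 4 → s'.int a = s.int a) ∧
      (∀ a < 32, s'.real a = s.real a) ∧
      ∀ l < ⌈s.real 13⌉₊, ∀ i < d, s'.real (32 + 2 * (l * d + i)) = coords (ω.1 l) i ∧
        s'.real (33 + 2 * (l * d + i)) = ω.2 (l * d + i) := by
  refine Run.while (b := d * 8 + 7) (fun n s' =>
      s'.drawn = n ∧ s'.used = n * d ∧ s'.int 2 = n ∧ s'.int 3 = n * d ∧
      (∀ a, a ≠ 2 → a ≠ 3 → a ≠ 4 → s'.int a = s.int a) ∧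
      (∀ a < 32, s'.real a = s.real a) ∧
      ∀ l < n, ∀ i < d, s'.real (32 + 2 * (l * d + i)) = coords (ω.1 l) i ∧
        s'.real (33 + 2 * (l * d + i)) = ω.2 (l * d + i)) _ le_rfl ?_ ?_ ?_
  · simp [h2, h3, hd, hu]
  · rintro n hn s' ⟨hd, hu, e2, e3, hf, hr, hv⟩
    refine ⟨?_, ?_⟩
    · simpa [Test.Holds, RExp.eval, NExp.eval, e2, hr 13 (by omega)] using Nat.lt_ceil.mp hn
    refine Run.seqSample (c := d * 8 + 5) le_rfl (Run.seqN (c := d * 8 + 3) le_rfl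
      (Run.seq (b := d * 8 + 1) (c := 1) le_rfl ?_))
    refine (storeLoop_run ω _ (n * d) ?_ ?_ ?_).mono le_rfl ?_
    · simp [NExp.eval, hf, h1]
    · simp [NExp.eval, e3]
    · simp [NExp.eval]
    rintro s'' ⟨hb', hd', hu', e3', hf', hr', v'⟩
    simp only [NExp.eval, hd, hu] at hb' hd' hu' hf' hr' v'
    refine Run.setN le_rfl ⟨by simp [hd'], by simp [hu', add_mul], ?_, ?_, ?_, ?_, ?_⟩
    · have := hf' 2 (by omega) (by omega)
      rw [Function.update_of_ne (by omega), e2] at this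
      simp [NExp.eval, this]
    · simp [NExp.eval, e3', add_mul]
    · intro a a2 a3 a4
      have := hf' a a3 a4
      rw [Function.update_of_ne (by omega), hf a a2 a3 a4] at this
      simp [NExp.eval, this, a2]
    · intro a ha
      exact (hr' a (by omega)).trans (hr a ha)
    · intro l hl i hi
      rcases Nat.lt_succ_iff_lt_or_eq.mp hl with h | rfl
      · have : (l + 1) * d ≤ n * d := Nat.mul_le_mul_right _ h
        rw [add_mul, one_mul] at this
        rw [← (hv l h i hi).1, ← (hv l h i hi).2]
        exact ⟨hr' _ (by omega), hr' _ (by omega)⟩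
      · exact v' i hi
  · rintro s' ⟨hd, hu, e2, e3, hf, hr, hv⟩
    refine ⟨?_, hd, e2, e3, hf, hr, hv⟩
    simpa [Test.Holds, RExp.eval, NExp.eval, e2, hr 13 (by omega)] using Nat.le_ceil _

/-- Draw the candidates and select among them. -/
def candidateLoop : Prog :=
  .while (.rlt (.cast (nc 6)) (rc 11))
    (.seq .sample
    (.seq (.setR (.lit 16) (rl 0))
    (.seq (.setN (.lit 3) (.lit 0))
    (.seq (.setN (.lit 5) (.lit 0))
    (.seq statLoop
    (.seq (.ite (.rlt (rc 15) (rc 16)) appendProg .skip)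
    (inc 6)))))))

/-- The number of steps of one round of `candidateLoop`. -/
def roundCost (n T d : ℕ) : ℕ := n * (d * 14 + 15) + T * (d * 8 + 11) + d * 6 + 28

open Classical in
-- Candidates are the samples that follow those already drawn. At most one vector is selected per
-- round, so `T` bounds the number of comparisons that one candidate needs.
theorem candidateLoop_run {d : ℕ} (ω : Tape d) (s : State) (n b : ℕ) (h1 : s.int 1 = d)
    (h2 : s.int 2 = n) (h6 : s.int 6 = 0) (h7 : s.int 7 = 0) (h10 : s.int 10 = b)
    (hb : b = 32 + 2 * (n * d)) (X G : ℕ → ℕ → ℝ)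
    (hX : ∀ l < n, ∀ i < d, s.real (32 + 2 * (l * d + i)) = X l i)
    (hG : ∀ l < n, ∀ i < d, s.real (33 + 2 * (l * d + i)) = G l i) :
    Run ω candidateLoop s (⌈s.real 11⌉₊ * roundCost n ⌈s.real 11⌉₊ d + 1) fun s' =>
      let sel := selected d (s.real 15) (s.real 0 * s.real 0 / 4)
        (fun x => ∑ l ∈ Finset.range n, statTerm d (s.real 14) (s.real 9) (X l) (G l) x)
        (fun t => coords (ω.1 (s.drawn + t))) ⌈s.real 11⌉₊
      s'.drawn = s.drawn + ⌈s.real 11⌉₊ ∧ s'.int 10 = b ∧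
      ∀ j (hj : j < sel.length), ∀ i < d, s'.real (b + j * d + i) = sel[j] i := by
  set T := ⌈s.real 11⌉₊ with hT
  set sel := selected d (s.real 15) (s.real 0 * s.real 0 / 4)
        (fun x => ∑ l ∈ Finset.range n, statTerm d (s.real 14) (s.real 9) (X l) (G l) x)
        (fun t => coords (ω.1 (s.drawn + t))) with hsel
  refine Run.while (b := n * (d * 14 + 15) + T * (d * 8 + 11) + d * 6 + 27) (fun t s' =>
      s'.drawn = s.drawn + t ∧ s'.int 6 = t ∧ s'.int 7 = (sel t).length ∧
      (∀ a, (a = 1 ∨ a = 2 ∨ a = 10) → s'.int a = s.int a) ∧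
      (∀ a < b, (a < 16 ∨ 22 < a) → s'.real a = s.real a) ∧
      ∀ j (hj : j < (sel t).length), ∀ i < d, s'.real (b + j * d + i) = (sel t)[j] i) T
      (by simp only [roundCost]; exact le_of_eq (by ring)) ?_ ?_ ?_
  · simp [h6, h7, hsel, selected]
  · rintro t ht s' ⟨hd, e6, e7, hf, hr, hv⟩
    refine ⟨?_, ?_⟩
    · simpa [Test.Holds, RExp.eval, NExp.eval, e6, hr 11 (by omega)] using Nat.lt_ceil.mp ht
    have hlen : (sel t).length ≤ T := (length_selected_le _ _ _ _ _ t).trans ht.le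
    have hlen' := Nat.mul_le_mul_right (d * 8 + 11) hlen
    refine Run.seqSample (c := n * (d * 14 + 15) + T * (d * 8 + 11) + d * 6 + 25) le_rfl
      (Run.seqR (c := n * (d * 14 + 15) + T * (d * 8 + 11) + d * 6 + 23) le_rfl
      (Run.seqN (c := n * (d * 14 + 15) + T * (d * 8 + 11) + d * 6 + 21) le_rfl
      (Run.seqN (c := n * (d * 14 + 15) + T * (d * 8 + 11) + d * 6 + 19) le_rfl
      (Run.seq (b := n * (d * 14 + 15) + 1) (c := T * (d * 8 + 11) + d * 6 + 17) (by omega) ?_))))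
    refine (statLoop_run ω _ n ?_ ?_ ?_ ?_ X G ?_ ?_ ?_).mono le_rfl ?_
    · simp [NExp.eval, hf, h1]
    · simp [NExp.eval, hf, h2]
    · simp [NExp.eval]
    · simp [NExp.eval]
    · intro l hl i hi
      have : (l + 1) * d ≤ n * d := Nat.mul_le_mul_right _ hl
      rw [add_mul, one_mul] at this
      simp only [NExp.eval, Function.update_apply]
      rw [if_neg (by omega), hr _ (by omega) (by omega), hX l hl i hi]
    · intro l hl i hi
      have : (l + 1) * d ≤ n * d := Nat.mul_le_mul_right _ hl
      rw [add_mul, one_mul] at this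
      simp only [NExp.eval, Function.update_apply]
      rw [if_neg (by omega), hr _ (by omega) (by omega), hG l hl i hi]
    · simp [NExp.eval, RExp.eval]
    rintro s'' ⟨hb', hd', hu', hf', hr', v'⟩
    simp only [NExp.eval, RExp.eval, hd] at hb' hd' hu' hf' hr' v'
    have hbuf : s''.buf = coords (ω.1 (s.drawn + t)) := hb'
    have hr2 : ∀ a, (a < 16 ∨ 22 < a) → s''.real a = s'.real a := by
      intro a ha
      rw [hr' a ha, Function.update_of_ne (by omega)]
    have hf2 : ∀ a, a ≠ 3 → a ≠ 4 → a ≠ 5 → s''.int a = s'.int a := by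
      intro a a3 a4 a5
      rw [hf' a a3 a4 a5, Function.update_of_ne a5, Function.update_of_ne a3]
    have e14 : s'.real 14 = s.real 14 := hr 14 (by omega) (by omega)
    have e9 : s'.real 9 = s.real 9 := hr 9 (by omega) (by omega)
    have e15 : s''.real 15 = s.real 15 := (hr2 15 (by omega)).trans (hr 15 (by omega) (by omega))
    have e0 : s''.real 0 = s.real 0 := (hr2 0 (by omega)).trans (hr 0 (by omega) (by omega))
    rw [Function.update_of_ne (by omega), Function.update_of_ne (by omega), e14, e9] at v'
    change s''.real 16 = ∑ l ∈ Finset.range n, statTerm d (s.real 14) (s.real 9) (X l) (G l)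
      (coords (ω.1 (s.drawn + t))) at v'
    have hv2 : ∀ j (hj : j < (sel t).length), ∀ i < d,
        s''.real (b + j * d + i) = (sel t)[j] i := by
      intro j hj i hi
      rw [← hv j hj i hi, hr2 _ (by omega)]
    -- The program tests the threshold and the distances one after the other, the recursion tests
    -- their conjunction.
    have hsucc : sel (t + 1) = if s''.real 15 < s''.real 16 ∧ ∀ y ∈ sel t,
        ¬ sqDist d y s''.buf < s''.real 0 * s''.real 0 / 4 then sel t ++ [s''.buf] else sel t := by
      rw [hsel, selected, e15, e0, v', hbuf]
    refine Run.seq (b := T * (d * 8 + 11) + d * 6 + 15) (c := 1) (by omega)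
      (Run.ite (b := T * (d * 8 + 11) + d * 6 + 14) le_rfl (fun hc => ?_) (fun hc => ?_))
    · simp only [Test.Holds, RExp.eval, NExp.eval] at hc
      refine (appendProg_run ω s'' b (by omega) (sel t) ?_ ?_ ?_ hv2).mono (by omega) ?_
      · rw [hf2 1 (by omega) (by omega) (by omega), hf 1 (by omega), h1]
      · rw [hf2 7 (by omega) (by omega) (by omega), e7]
      · rw [hf2 10 (by omega) (by omega) (by omega), hf 10 (by omega), h10]
      rintro s₃ ⟨hb₃, hd₃, hu₃, e7₃, hf₃, hr₃, hv₃⟩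
      have : (if ∀ y ∈ sel t, ¬ sqDist d y s''.buf < s''.real 0 * s''.real 0 / 4 then
          sel t ++ [s''.buf] else sel t) = sel (t + 1) := by
        rw [hsucc]; simp [hc]
      rw [this] at e7₃
      refine Run.setN le_rfl ⟨?_, ?_, ?_, ?_, ?_, ?_⟩
      · simp [hd₃, hd', add_assoc]
      · simp [NExp.eval, hf₃ 6 (by omega), hf2 6, e6]
      · simpa [NExp.eval] using e7₃
      · intro a ha
        simp only [NExp.eval]
        rw [Function.update_of_ne (by omega), hf₃ a (by omega), hf2 a (by omega) (by omega)
          (by omega), hf a ha]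
      · intro a ha ha'
        exact (hr₃ a ha (by omega)).trans ((hr2 a ha').trans (hr a ha ha'))
      · exact this ▸ hv₃
    · simp only [Test.Holds, RExp.eval, NExp.eval] at hc
      have : sel (t + 1) = sel t := by rw [hsucc]; simp [hc]
      refine Run.skip (by omega) (Run.setN le_rfl ⟨?_, ?_, ?_, ?_, ?_, ?_⟩)
      · simp [hd', add_assoc]
      · simp [NExp.eval, hf2 6, e6]
      · simp [NExp.eval, hf2 7, e7, this]
      · intro a ha
        simp only [NExp.eval]
        rw [Function.update_of_ne (by omega), hf2 a (by omega) (by omega) (by omega), hf a ha]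
      · intro a ha ha'
        exact (hr2 a ha').trans (hr a ha ha')
      · exact this.symm ▸ hv2
  · rintro s' ⟨hd, e6, e7, hf, hr, hv⟩
    refine ⟨?_, hd, (hf 10 (by omega)).trans h10, hv⟩
    simpa [Test.Holds, RExp.eval, NExp.eval, e6, hr 11 (by omega)] using Nat.le_ceil _

end GMM

namespace GMM

noncomputable section

/-! ### The parameters of the algorithm -/

variable (c k d : ℕ) (Δ ε : ℝ)

/-- The accuracy that the algorithm aims at. -/
def accPar : ℝ := min ε 1

/-- Logarithm of the ratio of separation and accuracy. -/
def logPar : ℝ := Real.log (Δ / accPar ε)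

/-- The first factor of the squared frequency cut-off. -/
def packPar : ℝ := min (d : ℝ) (Real.log k) + logPar Δ ε

/-- The second factor of the squared frequency cut-off. -/
def windowPar : ℝ :=
  min (d + Real.log k) (d * Real.log (2 + d / (Δ * Δ))) + logPar Δ ε

/-- The kernel without window is `exp (-ratePar |u|²)`. -/
def ratePar : ℝ := 16 * packPar k d Δ ε / (Δ * Δ)

/-- The kernel with window is `exp (-kernelPar |u|²)`. -/
def kernelPar : ℝ := 1 / 4 + ratePar k d Δ ε

/-- The squared frequency cut-off. -/
def cutPar : ℝ := 40 * ratePar k d Δ ε * windowPar k d Δ ε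

/-- An upper bound for the number of samples needed to hit a ball of radius `accPar ε / 4` around
the mean of one Gaussian. -/
def hitPar : ℝ := Real.exp (d * Real.log (12 * d / accPar ε))

/-- The number of candidates, before rounding. -/
def candPar : ℝ := (c + 2) * (k * Real.log k) * hitPar d ε

/-- Logarithm of the inverse of the failure probability allowed for one candidate. -/
def failPar : ℝ := c * Real.log k + Real.log (8 * candPar c k d ε)

/-- The separation between large and small values of the statistic, up to a constant. -/
def gapPar : ℝ := kernelPar k d Δ ε * (accPar ε * accPar ε)

/-- The number of samples for the statistic, before rounding. -/
def sizePar : ℝ :=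
  failPar c k d ε * 512 * Real.exp (d * Real.log 2) * Real.exp (2 * cutPar k d Δ ε) * (k * k) /
    (gapPar k d Δ ε * gapPar k d Δ ε)

/-- The threshold for the statistic. -/
def threshold : ℝ :=
  ⌈sizePar c k d Δ ε⌉₊ * (1 - gapPar k d Δ ε / 4) / (k * √(Real.exp (d * Real.log 2)))

/-- The statistic at the point with coordinates `x`. -/
def statSum {d : ℕ} (ω : Tape d) (r M2 : ℝ) (n : ℕ) (x : ℕ → ℝ) : ℝ :=
  ∑ l ∈ Finset.range n, statTerm d r M2 (coords (ω.1 l)) (fun i => ω.2 (l * d + i)) x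

/-! ### The program -/

/-- The part of the program after the computation of the parameters. -/
def mainTail : Prog :=
  .seq collectLoop
  (.seq (.setR (.lit 15) (.div (.mul (.cast (nc 2)) (.sub (rl 1) (.div (rc 8) (rl 4))))
    (.mul (.cast (nc 0)) (.sqrt (rc 10)))))
  (.seq (.setN (.lit 10) (.add (.lit 32) (.mul (.lit 2) (nc 3))))
  (.seq candidateLoop
  (.setN (.lit 0) (nc 10)))))

/-- The whole program. -/
def mainProg : Prog :=
  .seq (.setR (.lit 2) (minExp (rc 1) (rl 1)))
  (.seq (.setR (.lit 3) (.log (.div (rc 0) (rc 2))))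
  (.seq (.setR (.lit 4) (.log (.cast (nc 0))))
  (.seq (.setR (.lit 5) (.add (minExp (.cast (nc 1)) (rc 4)) (rc 3)))
  (.seq (.setR (.lit 6) (.add (minExp (.add (.cast (nc 1)) (rc 4)) (.mul (.cast (nc 1))
    (.log (.add (rl 2) (.div (.cast (nc 1)) (.mul (rc 0) (rc 0))))))) (rc 3)))
  (.seq (.setR (.lit 7) (.div (.mul (rl 16) (rc 5)) (.mul (rc 0) (rc 0))))
  (.seq (.setR (.lit 8) (.add (.div (rl 1) (rl 4)) (rc 7)))
  (.seq (.setR (.lit 9) (.mul (.mul (rl 40) (rc 7)) (rc 6)))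
  (.seq (.setR (.lit 10) (.exp (.mul (.cast (nc 1)) (.log (.div (.mul (rl 12) (.cast (nc 1)))
    (rc 2))))))
  (.seq (.setR (.lit 11) (.mul (.mul (.add (rl c) (rl 2)) (.mul (.cast (nc 0)) (rc 4))) (rc 10)))
  (.seq (.setR (.lit 12) (.add (.mul (rl c) (rc 4)) (.log (.mul (rl 8) (rc 11)))))
  (.seq (.setR (.lit 8) (.mul (rc 8) (.mul (rc 2) (rc 2))))
  (.seq (.setR (.lit 10) (.exp (.mul (.cast (nc 1)) (.log (rl 2)))))
  (.seq (.setR (.lit 13) (.div (.mul (.mul (.mul (.mul (rc 12) (rl 512)) (rc 10))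
    (.exp (.mul (rl 2) (rc 9)))) (.mul (.cast (nc 0)) (.cast (nc 0)))) (.mul (rc 8) (rc 8))))
  (.seq (.setR (.lit 14) (.sqrt (.mul (rl 2) (rc 7))))
  mainTail))))))))))))))

/-- The number of steps of the program. -/
def totalCost (n T d : ℕ) : ℕ := n * (d * 8 + 8) + T * roundCost n T d + 40

end

/-- The stored value is replaced by its meaning `v`, so that named parameters and not nested
expressions enter the later states. -/
theorem Run.seqRVal {d : ℕ} {ω : Tape d} {q : Prog} {s : State} {B : ℕ} {Q : State → Prop}
    {a : ℕ} {x : RExp} {c : ℕ} (v : ℝ) (hx : x.eval s = v) (hB : c + 2 ≤ B)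
    (h : Run ω q { s with real := Function.update s.real a v } c Q) :
    Run ω (.seq (.setR (.lit a) x) q) s B Q :=
  .seqR hB (by rw [hx]; exact h)

/-- The contents of the parameter cells are kept abstract, so that the formulas for the parameters
play no role in the treatment of the loops. -/
theorem mainTail_run {d : ℕ} (ω : Tape d) (s : State) (k : ℕ) (Δ gap r M2 E sz cand : ℝ)
    (hd : s.drawn = 0) (hu : s.used = 0) (i0 : s.int 0 = k) (i1 : s.int 1 = d) (i2 : s.int 2 = 0)
    (i3 : s.int 3 = 0) (i6 : s.int 6 = 0) (i7 : s.int 7 = 0) (r0 : s.real 0 = Δ)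
    (r8 : s.real 8 = gap) (r9 : s.real 9 = M2) (r10 : s.real 10 = E) (r11 : s.real 11 = cand)
    (r13 : s.real 13 = sz) (r14 : s.real 14 = r) :
    let sel := selected d (⌈sz⌉₊ * (1 - gap / 4) / (k * √E)) (Δ * Δ / 4) (statSum ω r M2 ⌈sz⌉₊)
      (fun t => coords (ω.1 (⌈sz⌉₊ + t))) ⌈cand⌉₊
    Run ω mainTail s (⌈sz⌉₊ * (d * 8 + 8) + ⌈cand⌉₊ * roundCost ⌈sz⌉₊ ⌈cand⌉₊ d + 10) fun s =>
      s.drawn = ⌈sz⌉₊ + ⌈cand⌉₊ ∧ ∀ j (hj : j < sel.length), ∀ i < d,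
        s.real (s.int 0 + j * d + i) = sel[j] i := by
  intro sel
  set n := ⌈sz⌉₊
  set T := ⌈cand⌉₊
  refine Run.seq (b := n * (d * 8 + 8) + 1) (c := T * roundCost n T d + 8) (by omega) ?_
  refine (collectLoop_run ω _ i1 i2 i3 hd hu).mono (by rw [r13]) ?_
  rintro s' ⟨hd, e2, e3, hf, hr, hv⟩
  rw [r13] at hd e2 e3 hv
  rw [← hr 0 (by omega)] at r0
  rw [← hr 8 (by omega)] at r8
  rw [← hr 9 (by omega)] at r9
  rw [← hr 10 (by omega)] at r10
  rw [← hr 11 (by omega)] at r11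
  rw [← hr 14 (by omega)] at r14
  rw [← hf 0 (by omega) (by omega) (by omega)] at i0
  rw [← hf 1 (by omega) (by omega) (by omega)] at i1
  rw [← hf 6 (by omega) (by omega) (by omega)] at i6
  rw [← hf 7 (by omega) (by omega) (by omega)] at i7
  refine Run.seqRVal (n * (1 - gap / 4) / (k * √E)) ?_ (c := T * roundCost n T d + 6)
    le_rfl (Run.seqN (c := T * roundCost n T d + 4) le_rfl
    (Run.seq (b := T * roundCost n T d + 1) (c := 1) (by omega) ?_))
  · simp [RExp.eval, NExp.eval, r8, r10, i0, e2, n]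
  refine (candidateLoop_run ω _ n (32 + 2 * (n * d)) ?_ ?_ ?_ ?_ ?_ rfl
    (fun l => coords (ω.1 l)) (fun l i => ω.2 (l * d + i)) ?_ ?_).mono (le_of_eq ?_) ?_
  · simp [NExp.eval, i1]
  · simp [NExp.eval, e2, n]
  · simp [NExp.eval, i6]
  · simp [NExp.eval, i7]
  · simp [NExp.eval, e3, n]
  · intro l hl i hi
    rw [← (hv l hl i hi).1]
    exact Function.update_of_ne (by omega) _ _
  · intro l hl i hi
    rw [← (hv l hl i hi).2]
    exact Function.update_of_ne (by omega) _ _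
  · simp [r11, T]
  rintro s'' ⟨hd', i10, hv'⟩
  simp only [NExp.eval] at hd' hv'
  refine Run.setN le_rfl ⟨by simpa [hd, r11] using hd', fun j hj i hi => ?_⟩
  have hsel : sel = selected d (Function.update s'.real 15 (n * (1 - gap / 4) / (k * √E)) 15)
      (Function.update s'.real 15 (n * (1 - gap / 4) / (k * √E)) 0 *
        Function.update s'.real 15 (n * (1 - gap / 4) / (k * √E)) 0 / 4)
      (fun x => ∑ l ∈ Finset.range n,
        statTerm d (Function.update s'.real 15 (n * (1 - gap / 4) / (k * √E)) 14)
          (Function.update s'.real 15 (n * (1 - gap / 4) / (k * √E)) 9) (coords (ω.1 l))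
          (fun i => ω.2 (l * d + i)) x)
      (fun t => coords (ω.1 (s'.drawn + t)))
      ⌈Function.update s'.real 15 (n * (1 - gap / 4) / (k * √E)) 11⌉₊ := by
    simp [sel, r0, r9, r11, r14, hd, n]
    rfl
  rw [List.getElem_of_eq hsel hj, ← hv' j (hsel ▸ hj) i hi]
  simp [NExp.eval, i10]

/-- The link between machine and mathematics: on every tape the output block is the value of
`selected`, and the cost depends on the parameters only. Real cells 8 and 10 serve twice, first for
`kernelPar` and `hitPar`, then for `gapPar` and 2^d. -/
theorem mainProg_run (c k d : ℕ) (Δ ε : ℝ) (ω : Tape d) :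
    let n := ⌈sizePar c k d Δ ε⌉₊
    let T := ⌈candPar c k d ε⌉₊
    let sel := selected d (threshold c k d Δ ε) (Δ * Δ / 4)
      (statSum ω √(2 * ratePar k d Δ ε) (cutPar k d Δ ε) n) (fun t => coords (ω.1 (n + t))) T
    Run ω (mainProg c) (input k d Δ ε) (totalCost n T d) fun s =>
      s.drawn = n + T ∧ ∀ j (hj : j < sel.length), ∀ i < d,
        s.real (s.int 0 + j * d + i) = sel[j] i := by
  intro n T sel
  -- With the cost of the loops hidden in `b`, the steps of the parameter assignments are counted by
  -- definitional equality.
  obtain ⟨b, hb⟩ : ∃ b, b = n * (d * 8 + 8) + T * roundCost n T d := ⟨_, rfl⟩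
  rw [totalCost, ← hb]
  refine Run.seqRVal (accPar ε) ?_ (c := b + 38) le_rfl
    (Run.seqRVal (logPar Δ ε) ?_ (c := b + 36) le_rfl
    (Run.seqRVal (Real.log k) ?_ (c := b + 34) le_rfl
    (Run.seqRVal (packPar k d Δ ε) ?_ (c := b + 32) le_rfl
    (Run.seqRVal (windowPar k d Δ ε) ?_ (c := b + 30) le_rfl
    (Run.seqRVal (ratePar k d Δ ε) ?_ (c := b + 28) le_rfl
    (Run.seqRVal (kernelPar k d Δ ε) ?_ (c := b + 26) le_rfl
    (Run.seqRVal (cutPar k d Δ ε) ?_ (c := b + 24) le_rfl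
    (Run.seqRVal (hitPar d ε) ?_ (c := b + 22) le_rfl
    (Run.seqRVal (candPar c k d ε) ?_ (c := b + 20) le_rfl
    (Run.seqRVal (failPar c k d ε) ?_ (c := b + 18) le_rfl
    (Run.seqRVal (gapPar k d Δ ε) ?_ (c := b + 16) le_rfl
    (Run.seqRVal (Real.exp (d * Real.log 2)) ?_ (c := b + 14) le_rfl
    (Run.seqRVal (sizePar c k d Δ ε) ?_ (c := b + 12) le_rfl
    (Run.seqRVal (√(2 * ratePar k d Δ ε)) ?_ (c := b + 10) le_rfl ?_))))))))))))))
  · simp [minExp_eval, RExp.eval, NExp.eval, input, accPar]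
  · simp [RExp.eval, NExp.eval, input, logPar]
  · simp [RExp.eval, NExp.eval, input]
  · simp [minExp_eval, RExp.eval, NExp.eval, input, packPar]
  · simp [minExp_eval, RExp.eval, NExp.eval, input, windowPar]
  · simp [RExp.eval, NExp.eval, input, ratePar]
  · simp [RExp.eval, NExp.eval, input, kernelPar]
  · simp [RExp.eval, NExp.eval, input, cutPar]
  · simp [RExp.eval, NExp.eval, input, hitPar]
  · simp [RExp.eval, NExp.eval, input, candPar]
  · simp [RExp.eval, NExp.eval, input, failPar]
  · simp [RExp.eval, NExp.eval, input, gapPar]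
  · simp [RExp.eval, NExp.eval, input]
  · simp [RExp.eval, NExp.eval, input, sizePar]
  · simp [RExp.eval, NExp.eval, input]
  refine (mainTail_run ω _ k Δ (gapPar k d Δ ε) √(2 * ratePar k d Δ ε) (cutPar k d Δ ε)
    (Real.exp (d * Real.log 2)) (sizePar c k d Δ ε) (candPar c k d ε) rfl rfl rfl rfl rfl rfl rfl
    rfl ?_ ?_ ?_ ?_ ?_ ?_ ?_).mono (by rw [hb]) fun _ h => h <;> simp [input]

end GMM

/-! ### Gaussian integrals -/

namespace GMM

theorem re_cexp_add_mul_I (a b : ℝ) :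
    (Complex.exp ((a : ℂ) + (b : ℂ) * Complex.I)).re = Real.exp a * Real.cos b := by
  rw [Complex.exp_add, ← Complex.ofReal_exp, Complex.re_ofReal_mul, Complex.exp_ofReal_mul_I_re]

open Complex in
-- Together with the density the integrand is a multiple of exp(-y² + (u + 2iz)y - u²/2). Completing
-- the square leaves (u + 2iz)²/4 - u²/2 in the exponent.
theorem integral_cexp_window (u z : ℝ) :
    ∫ y : ℝ, cexp (-(y : ℂ) ^ 2 / 2 + 2 * z * y * I) ∂gaussianReal u 1 =
      ((√2)⁻¹ : ℝ) * cexp (-(u : ℂ) ^ 2 / 4 - z ^ 2 + z * u * I) := by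
  rw [integral_gaussianReal_eq_integral_smul one_ne_zero]
  have h : ∀ y : ℝ, gaussianPDFReal u 1 y • cexp (-(y : ℂ) ^ 2 / 2 + 2 * z * y * I) =
      ((√(2 * Real.pi))⁻¹ : ℝ) * cexp (-1 * (y : ℂ) ^ 2 + (u + 2 * z * I) * y + -(u : ℂ) ^ 2 / 2) := by
    intro y
    rw [gaussianPDFReal, real_smul, ofReal_mul, mul_assoc, ofReal_exp, ← Complex.exp_add]
    simp only [NNReal.coe_one, mul_one]
    congr 2
    push_cast
    ring
  simp_rw [h]
  rw [integral_const_mul, integral_cexp_quadratic (by simp)]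
  have hpi : ((Real.pi : ℂ) / -(-1)) ^ (1 / 2 : ℂ) = (√Real.pi : ℝ) := by
    rw [neg_neg, div_one, Real.sqrt_eq_rpow, ofReal_cpow Real.pi_pos.le]
    simp
  rw [hpi, ← mul_assoc, ← ofReal_mul]
  have h2 : (√(2 * Real.pi))⁻¹ * √Real.pi = (√2)⁻¹ := by
    have : √Real.pi ≠ 0 := (Real.sqrt_pos.mpr Real.pi_pos).ne'
    rw [Real.sqrt_mul zero_le_two]
    field_simp
  rw [h2]
  congr 2
  linear_combination (z : ℂ) ^ 2 * I_sq

theorem integral_exp_sq_quarter :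
    ∫ y : ℝ, Real.exp (y ^ 2 / 4) ∂gaussianReal 0 1 = √2 := by
  rw [integral_gaussianReal_eq_integral_smul one_ne_zero]
  have h : ∀ y : ℝ, gaussianPDFReal 0 1 y • Real.exp (y ^ 2 / 4) =
      (√(2 * Real.pi))⁻¹ * Real.exp (-(1 / 4) * y ^ 2) := by
    intro y
    rw [gaussianPDFReal, smul_eq_mul, mul_assoc, ← Real.exp_add]
    simp only [NNReal.coe_one, mul_one]
    congr 2
    ring
  simp_rw [h]
  rw [integral_const_mul, integral_gaussian, ← Real.sqrt_inv, ← Real.sqrt_mul (by positivity)]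
  congr 1
  have := Real.pi_ne_zero
  field_simp
  norm_num

variable {d : ℕ}

local notation "E" d => EuclideanSpace ℝ (Fin d)

/-- The characteristic functions agree. The product form makes the integrals below factor into
one-dimensional ones. -/
theorem multivariateGaussian_one_eq_map_pi (u : E d) :
    multivariateGaussian u 1 =
      (Measure.pi fun i => gaussianReal (u i) 1).map (WithLp.toLp 2) := by
  apply Measure.ext_of_charFun
  ext t
  rw [charFun_multivariateGaussian Matrix.PosSemidef.one, charFun_pi]
  simp_rw [charFun_gaussianReal, ← Complex.exp_sum]
  congr 1
  simp only [Matrix.one_mulVec, PiLp.inner_apply, Finset.sum_sub_distrib, NNReal.coe_one]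
  push_cast
  simp [dotProduct, Finset.sum_mul, Finset.sum_div, sq, mul_comm (u _ : ℂ)]

theorem stdGaussian_eq_map_pi :
    stdGaussian (E d) = (Measure.pi fun _ => gaussianReal 0 1).map (WithLp.toLp 2) :=
  map_pi_eq_stdGaussian.symm

instance (u : E d) : IsProbabilityMeasure (multivariateGaussian u 1) := by
  rw [multivariateGaussian_one_eq_map_pi]
  exact Measure.isProbabilityMeasure_map (by fun_prop)

theorem multivariateGaussian_map_sub (u x : E d) :
    (multivariateGaussian u 1).map (fun y => y - x) = multivariateGaussian (u - x) 1 := by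
  rw [multivariateGaussian, Measure.map_map (by fun_prop) (by fun_prop), multivariateGaussian]
  congr 1
  ext1 y
  simp only [Function.comp]
  abel

open Complex in
-- The cosine does not factor over the coordinates but the complex exponential does, so the real
-- part is taken only at the end.
theorem integral_exp_mul_cos_window (u z : E d) :
    ∫ y, Real.exp (-‖y‖ ^ 2 / 2) * Real.cos (2 * inner ℝ y z) ∂multivariateGaussian u 1 =
      (√2)⁻¹ ^ d * (Real.exp (-‖u‖ ^ 2 / 4 - ‖z‖ ^ 2) * Real.cos (inner ℝ u z)) := by
  have key : ∫ y, cexp (-(‖y‖ : ℂ) ^ 2 / 2 + 2 * (inner ℝ y z : ℝ) * I)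
      ∂multivariateGaussian u 1 = (((√2)⁻¹ ^ d : ℝ) : ℂ) *
        cexp (-(‖u‖ : ℂ) ^ 2 / 4 - (‖z‖ : ℂ) ^ 2 + (inner ℝ u z : ℝ) * I) := by
    rw [multivariateGaussian_one_eq_map_pi, integral_map (by fun_prop)
      (Measurable.aestronglyMeasurable (by fun_prop))]
    have h : ∀ y : Fin d → ℝ, cexp (-(‖WithLp.toLp 2 y‖ : ℂ) ^ 2 / 2 +
        2 * (inner ℝ (WithLp.toLp 2 y) z : ℝ) * I) =
        ∏ i, cexp (-(y i : ℂ) ^ 2 / 2 + 2 * z i * y i * I) := by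
      intro y
      rw [← Complex.exp_sum, ← ofReal_pow, EuclideanSpace.real_norm_sq_eq]
      congr 1
      simp only [PiLp.inner_apply, Finset.sum_add_distrib]
      push_cast
      simp [Finset.mul_sum, Finset.sum_div, neg_div, mul_comm, mul_left_comm]
    simp_rw [h]
    rw [integral_fintype_prod_eq_prod (f := fun i (y : ℝ) =>
      cexp (-(y : ℂ) ^ 2 / 2 + 2 * z i * y * I))]
    simp_rw [integral_cexp_window, Finset.prod_mul_distrib, ← Complex.exp_sum]
    rw [Finset.prod_const, Finset.card_univ, Fintype.card_fin, ← ofReal_pow]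
    congr 2
    rw [← ofReal_pow, ← ofReal_pow, EuclideanSpace.real_norm_sq_eq,
      EuclideanSpace.real_norm_sq_eq]
    simp only [PiLp.inner_apply, Finset.sum_add_distrib, Finset.sum_sub_distrib]
    push_cast
    simp [Finset.sum_mul, Finset.sum_div, neg_div]
  have hre : ∀ a b c : ℝ, (cexp (-(a : ℂ) ^ 2 / 2 + 2 * (b : ℝ) * I)).re =
      Real.exp (-a ^ 2 / 2) * Real.cos (2 * b) := by
    intro a b _
    rw [show -(a : ℂ) ^ 2 / 2 + 2 * (b : ℝ) * I = ((-a ^ 2 / 2 : ℝ) : ℂ) + ((2 * b : ℝ) : ℂ) * I by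
      push_cast; ring]
    rw [re_cexp_add_mul_I]
  have hint : Integrable (fun y : E d => cexp (-(‖y‖ : ℂ) ^ 2 / 2 + 2 * (inner ℝ y z : ℝ) * I))
      (multivariateGaussian u 1) := by
    refine Integrable.of_bound (Measurable.aestronglyMeasurable (by fun_prop)) 1
      (Filter.Eventually.of_forall fun y => ?_)
    rw [show -(‖y‖ : ℂ) ^ 2 / 2 + 2 * (inner ℝ y z : ℝ) * I =
      ((-‖y‖ ^ 2 / 2 : ℝ) : ℂ) + ((2 * inner ℝ y z : ℝ) : ℂ) * I by push_cast; ring]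
    rw [Complex.norm_exp]
    simp only [add_re, ofReal_re, mul_re, I_re, mul_zero, ofReal_im, I_im, mul_one, sub_self,
      add_zero]
    exact Real.exp_le_one_iff.mpr (by have := sq_nonneg ‖y‖; linarith)
  have h2 := congrArg Complex.re key
  rw [← RCLike.re_eq_complex_re, ← integral_re hint] at h2
  simp only [RCLike.re_eq_complex_re] at h2
  simp_rw [fun y : E d => hre ‖y‖ (inner ℝ y z) 0] at h2
  rw [h2, re_ofReal_mul]
  congr 1
  rw [show -(‖u‖ : ℂ) ^ 2 / 4 - (‖z‖ : ℂ) ^ 2 + (inner ℝ u z : ℝ) * I =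
    ((-‖u‖ ^ 2 / 4 - ‖z‖ ^ 2 : ℝ) : ℂ) + ((inner ℝ u z : ℝ) : ℂ) * I by push_cast; ring]
  rw [re_cexp_add_mul_I]

open Complex in
theorem integral_cos_inner_stdGaussian (t : E d) :
    ∫ g, Real.cos (inner ℝ t g) ∂stdGaussian (E d) = Real.exp (-‖t‖ ^ 2 / 2) := by
  have h := congrArg Complex.re (charFun_stdGaussian t)
  rw [charFun_apply, ← RCLike.re_eq_complex_re, ← integral_re] at h
  · simp only [RCLike.re_eq_complex_re, Complex.exp_ofReal_mul_I_re] at h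
    rw [show (-(‖t‖ : ℂ) ^ 2 / 2) = ((-‖t‖ ^ 2 / 2 : ℝ) : ℂ) by push_cast; ring,
      Complex.exp_ofReal_re] at h
    simpa only [real_inner_comm] using h
  · refine Integrable.of_bound (Measurable.aestronglyMeasurable (by fun_prop)) 1
      (Filter.Eventually.of_forall fun y => ?_)
    rw [Complex.norm_exp_ofReal_mul_I]

theorem integral_exp_norm_sq_quarter_stdGaussian :
    Integrable (fun g : E d => Real.exp (‖g‖ ^ 2 / 4)) (stdGaussian (E d)) ∧
      ∫ g, Real.exp (‖g‖ ^ 2 / 4) ∂stdGaussian (E d) = √2 ^ d := by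
  have h : ∀ y : Fin d → ℝ, Real.exp (‖WithLp.toLp 2 y‖ ^ 2 / 4) =
      ∏ i, Real.exp (y i ^ 2 / 4) := by
    intro y
    rw [EuclideanSpace.real_norm_sq_eq, ← Real.exp_sum, Finset.sum_div]
  rw [stdGaussian_eq_map_pi, integral_map (by fun_prop)
    (Measurable.aestronglyMeasurable (by fun_prop)),
    integrable_map_measure (Measurable.aestronglyMeasurable (by fun_prop)) (by fun_prop)]
  simp_rw [Function.comp_def, h]
  constructor
  · refine Integrable.fintype_prod (f := fun _ (y : ℝ) => Real.exp (y ^ 2 / 4))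
      (μ := fun _ => gaussianReal 0 1) fun i => ?_
    -- A non-integrable function would have integral 0 by convention, but this integral is √2.
    by_contra hi
    have := integral_undef hi
    rw [integral_exp_sq_quarter] at this
    exact absurd this (by positivity)
  · rw [integral_fintype_prod_eq_prod (f := fun i (y : ℝ) => Real.exp (y ^ 2 / 4))]
    simp [integral_exp_sq_quarter]

/-- The tail of the norm of a standard Gaussian vector. -/
theorem stdGaussian_norm_sq_gt_le (R : ℝ) :
    (stdGaussian (E d)).real {g | R < ‖g‖ ^ 2} ≤ √2 ^ d * Real.exp (-R / 4) := by
  obtain ⟨hi, h⟩ := integral_exp_norm_sq_quarter_stdGaussian (d := d)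
  -- Markov's inequality for exp(|g|²/4).
  have := mul_meas_ge_le_integral_of_nonneg (Filter.Eventually.of_forall fun g => by positivity)
    hi (Real.exp (R / 4))
  rw [h] at this
  have hsub : (stdGaussian (E d)).real {g | R < ‖g‖ ^ 2} ≤
      (stdGaussian (E d)).real {g | Real.exp (R / 4) ≤ Real.exp (‖g‖ ^ 2 / 4)} := by
    refine measureReal_mono fun g hg => ?_
    simp only [Set.mem_ofPred_eq] at hg ⊢
    exact Real.exp_le_exp.mpr (by linarith)
  have h3 : Real.exp (R / 4) * Real.exp (-R / 4) = 1 := by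
    rw [← Real.exp_add, ← Real.exp_zero]; congr 1; ring
  calc _ ≤ _ := hsub
    _ = Real.exp (R / 4) * (stdGaussian (E d)).real
        {g | Real.exp (R / 4) ≤ Real.exp (‖g‖ ^ 2 / 4)} * Real.exp (-R / 4) := by
      rw [mul_right_comm, h3, one_mul]
    _ ≤ _ := by gcongr

/-- The interval has length 2t, and on it the density is at least 1/6, because exp(-1/2) ≥ 1/2 and
√(2π) ≤ 3. -/
theorem gaussianReal_Icc_ge {t : ℝ} (ht : 0 ≤ t) (ht1 : t ≤ 1) (u : ℝ) :
    t / 3 ≤ (gaussianReal u 1).real (Set.Icc (u - t) (u + t)) := by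
  have h : (gaussianReal u 1).real (Set.Icc (u - t) (u + t)) =
      ∫ x in Set.Icc (u - t) (u + t), gaussianPDFReal u 1 x := by
    rw [measureReal_def, gaussianReal_apply_eq_integral _ one_ne_zero]
    exact ENNReal.toReal_ofReal (setIntegral_nonneg measurableSet_Icc
      fun x _ => gaussianPDFReal_nonneg _ _ _)
  have h2 : ∫ x in Set.Icc (u - t) (u + t), (1 / 6 : ℝ) ≤
      ∫ x in Set.Icc (u - t) (u + t), gaussianPDFReal u 1 x := by
    refine setIntegral_mono_on (by simp) (integrable_gaussianPDFReal _ _).integrableOn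
      measurableSet_Icc fun x hx => ?_
    rw [gaussianPDFReal]
    simp only [NNReal.coe_one, mul_one]
    have h1 : (x - u) ^ 2 ≤ 1 := by
      rw [sq_le_one_iff_abs_le_one, abs_le]
      constructor <;> linarith [hx.1, hx.2]
    have h2 : (1 / 2 : ℝ) ≤ Real.exp (-(x - u) ^ 2 / 2) := by
      have := Real.add_one_le_exp (-(x - u) ^ 2 / 2)
      linarith
    have h3 : √(2 * Real.pi) ≤ 3 := by
      rw [Real.sqrt_le_left (by norm_num)]
      nlinarith [Real.pi_lt_d2]
    have h4 : (1 / 3 : ℝ) ≤ (√(2 * Real.pi))⁻¹ := by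
      rw [one_div]
      exact inv_anti₀ (by positivity) h3
    calc (1 / 6 : ℝ) = 1 / 3 * (1 / 2) := by norm_num
      _ ≤ _ := by gcongr
  rw [h]
  refine le_trans (le_of_eq ?_) h2
  simp only [integral_const, smul_eq_mul, MeasurableSet.univ, measureReal_restrict_apply,
    Set.univ_inter, Real.volume_real_Icc]
  rw [max_eq_left (by linarith)]
  ring

/-- A lower bound for the probability that a Gaussian vector is close to its mean. -/
theorem multivariateGaussian_closedBall_ge (u : E d) {r : ℝ} (hr : 0 ≤ r) (hr1 : r ≤ 1) :
    (r / (3 * d)) ^ d ≤ (multivariateGaussian u 1).real {y | ‖y - u‖ ≤ r} := by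
  rcases Nat.eq_zero_or_pos d with rfl | hd
  · have : {y : E 0 | ‖y - u‖ ≤ r} = Set.univ := by
      ext y
      simp [Subsingleton.elim y u, hr]
    simp [this]
  have hd1 : (1 : ℝ) ≤ d := by exact_mod_cast hd
  -- A cube of half side r/d lies in the ball since d(r/d)² ≤ r². The smaller half side compared
  -- with r/√d only affects the constant in the power of d.
  have hsub : Set.univ.pi (fun i => Set.Icc (u i - r / d) (u i + r / d)) ⊆
      WithLp.toLp 2 ⁻¹' {y : E d | ‖y - u‖ ≤ r} := by
    intro y hy
    simp only [Set.mem_pi, Set.mem_univ, Set.mem_Icc, forall_const] at hy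
    simp only [Set.mem_preimage, Set.mem_ofPred_eq]
    refine abs_le_of_sq_le_sq' ?_ hr |>.2
    rw [EuclideanSpace.real_norm_sq_eq]
    calc _ ≤ ∑ i : Fin d, (r / d) ^ 2 := by
          refine Finset.sum_le_sum fun i _ => ?_
          refine sq_le_sq' ?_ ?_
          · have := (hy i).1; simp; linarith
          · have := (hy i).2; simp; linarith
      _ = r ^ 2 / d := by
          simp only [Finset.sum_const, Finset.card_univ, Fintype.card_fin, nsmul_eq_mul]
          field_simp
      _ ≤ r ^ 2 := div_le_self (by positivity) hd1
  have hm : MeasurableSet {y : E d | ‖y - u‖ ≤ r} :=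
    measurableSet_le (by fun_prop) (by fun_prop)
  rw [multivariateGaussian_one_eq_map_pi, measureReal_def, Measure.map_apply (by fun_prop) hm]
  refine le_trans ?_ (ENNReal.toReal_mono (measure_ne_top _ _) (measure_mono hsub))
  rw [Measure.pi_pi, ENNReal.toReal_prod]
  calc (r / (3 * d)) ^ d = ∏ i : Fin d, (r / d / 3) := by
        rw [Finset.prod_const, Finset.card_univ, Fintype.card_fin]
        congr 1
        ring
    _ ≤ _ := Finset.prod_le_prod (fun i _ => by positivity) fun i _ =>
        gaussianReal_Icc_ge (by positivity) ((div_le_self hr hd1).trans hr1) (u i)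

end GMM

namespace GMM

/-! ### The expectation of the statistic -/

variable {d : ℕ}

local notation "E" d => EuclideanSpace ℝ (Fin d)

/-- The contribution of one sample and one Gaussian vector to the statistic, see `statTerm`. -/
noncomputable def vecTerm (r M2 : ℝ) (x : E d) (p : (E d) × E d) : ℝ :=
  if M2 < ‖r • p.2‖ ^ 2 then 0 else
    Real.exp (‖r • p.2‖ ^ 2 - ‖p.1 - x‖ ^ 2 / 2) * Real.cos (2 * inner ℝ (p.1 - x) (r • p.2))

theorem sum_range_coords_sub_sq (X x : E d) :
    ∑ i ∈ Finset.range d, (coords X i - coords x i) ^ 2 = ‖X - x‖ ^ 2 := by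
  rw [EuclideanSpace.real_norm_sq_eq, Finset.sum_range]
  simp [coords]

theorem statTerm_coords (r M2 : ℝ) (X x : E d) (G : ℕ → ℝ) :
    statTerm d r M2 (coords X) G (coords x) =
      vecTerm r M2 x (X, WithLp.toLp 2 fun i : Fin d => G i) := by
  have h1 : ∑ i ∈ Finset.range d, (r * G i) ^ 2 = ‖r • WithLp.toLp 2 fun i : Fin d => G i‖ ^ 2 := by
    rw [EuclideanSpace.real_norm_sq_eq, Finset.sum_range]
    simp
  have h2 : ∑ i ∈ Finset.range d, (coords X i - coords x i) * (r * G i) =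
      inner ℝ (X - x) (r • WithLp.toLp 2 fun i : Fin d => G i) := by
    rw [Finset.sum_range, PiLp.inner_apply]
    simp [coords, mul_comm]
  rw [statTerm, vecTerm, h1, h2, sum_range_coords_sub_sq]

/-- This is what the cut-off buys: the exponential is used only where |ζ|² ≤ M2. -/
theorem abs_vecTerm_le (r M2 : ℝ) (x : E d) (p : (E d) × E d) :
    |vecTerm r M2 x p| ≤ Real.exp M2 := by
  rw [vecTerm]
  split_ifs with h
  · simp [Real.exp_nonneg]
  · rw [abs_mul, Real.abs_exp]
    refine (mul_le_of_le_one_right (Real.exp_nonneg _) (Real.abs_cos_le_one _)).trans ?_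
    exact Real.exp_le_exp.mpr (by have := sq_nonneg ‖p.1 - x‖; linarith)

theorem measurable_vecTerm (r M2 : ℝ) :
    Measurable fun q : (E d) × (E d) × E d => vecTerm r M2 q.1 q.2 := by
  unfold vecTerm
  exact Measurable.ite (measurableSet_lt (by fun_prop) (by fun_prop)) (by fun_prop) (by fun_prop)

theorem measurable_vecTerm_right (r M2 : ℝ) (x : E d) : Measurable (vecTerm r M2 x) := by
  unfold vecTerm
  exact Measurable.ite (measurableSet_lt (by fun_prop) (by fun_prop)) (by fun_prop) (by fun_prop)

/-- The Fourier transform of the truncated Gaussian. -/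
noncomputable def cutKernel (r M2 : ℝ) (u : E d) : ℝ :=
  ∫ g, (if M2 < ‖r • g‖ ^ 2 then 0 else Real.cos (inner ℝ u (r • g))) ∂stdGaussian (E d)

/-- Without the cut-off the integral is the characteristic function of N(0, r²I). The integrands
differ by at most 1, and only where |rg|² > M2, so the error is a Gaussian tail. -/
theorem abs_cutKernel_sub_le {r : ℝ} (hr : 0 < r) (M2 : ℝ) (u : E d) :
    |cutKernel r M2 u - Real.exp (-(r ^ 2 / 2) * ‖u‖ ^ 2)| ≤
      √2 ^ d * Real.exp (-(M2 / (4 * r ^ 2))) := by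
  have hset : MeasurableSet {g : E d | M2 < ‖r • g‖ ^ 2} :=
    measurableSet_lt (by fun_prop) (by fun_prop)
  have hexp : Real.exp (-(r ^ 2 / 2) * ‖u‖ ^ 2) =
      ∫ g, Real.cos (inner ℝ u (r • g)) ∂stdGaussian (E d) := by
    have := integral_cos_inner_stdGaussian (r • u)
    simp_rw [real_inner_smul_left, ← real_inner_smul_right] at this
    rw [this, norm_smul, Real.norm_eq_abs, mul_pow, sq_abs]
    congr 1
    ring
  have hcos : Integrable (fun g : E d => Real.cos (inner ℝ u (r • g))) (stdGaussian (E d)) :=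
    Integrable.of_bound (Measurable.aestronglyMeasurable (by fun_prop)) 1
      (Filter.Eventually.of_forall fun g => Real.abs_cos_le_one _)
  have hcut : Integrable (fun g : E d => if M2 < ‖r • g‖ ^ 2 then 0 else
      Real.cos (inner ℝ u (r • g))) (stdGaussian (E d)) := by
    refine Integrable.of_bound (Measurable.aestronglyMeasurable
      (Measurable.ite hset (by fun_prop) (by fun_prop))) 1
      (Filter.Eventually.of_forall fun g => ?_)
    split_ifs
    · simp
    · exact Real.abs_cos_le_one _
  rw [hexp, cutKernel, ← integral_sub hcut hcos]
  have hle : |∫ g, ((if M2 < ‖r • g‖ ^ 2 then 0 else Real.cos (inner ℝ u (r • g))) -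
      Real.cos (inner ℝ u (r • g))) ∂stdGaussian (E d)| ≤
      ∫ g, {g : E d | M2 < ‖r • g‖ ^ 2}.indicator 1 g ∂stdGaussian (E d) := by
    rw [← Real.norm_eq_abs]
    refine norm_integral_le_of_norm_le ((integrable_const (1 : ℝ)).indicator hset)
      (Filter.Eventually.of_forall fun g => ?_)
    simp only [Set.indicator, Set.mem_ofPred_eq]
    split_ifs with h
    · simpa using Real.abs_cos_le_one _
    · simp
  refine hle.trans ?_
  rw [integral_indicator_one hset]
  have hset' : {g : E d | M2 < ‖r • g‖ ^ 2} = {g : E d | M2 / r ^ 2 < ‖g‖ ^ 2} := by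
    ext g
    simp only [Set.mem_ofPred_eq, norm_smul, mul_pow, Real.norm_eq_abs, sq_abs]
    rw [div_lt_iff₀ (by positivity), mul_comm]
  rw [hset']
  refine (stdGaussian_norm_sq_gt_le _).trans (le_of_eq ?_)
  congr 2
  field_simp

/-- For fixed ζ = rg, integrating over the sample first produces a factor exp(-|ζ|²), which cancels
the exp(|ζ|²) in the statistic. What is left to integrate over g is `cutKernel`. -/
theorem integral_vecTerm_gaussian (r M2 : ℝ) (x μ : E d) :
    ∫ p, vecTerm r M2 x p ∂(multivariateGaussian μ 1).prod (stdGaussian (E d)) =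
      (√2)⁻¹ ^ d * (Real.exp (-‖μ - x‖ ^ 2 / 4) * cutKernel r M2 (μ - x)) := by
  have hint : Integrable (vecTerm r M2 x) ((multivariateGaussian μ 1).prod (stdGaussian (E d))) :=
    Integrable.of_bound (measurable_vecTerm_right r M2 x).aestronglyMeasurable (Real.exp M2)
      (Filter.Eventually.of_forall fun p => abs_vecTerm_le r M2 x p)
  rw [integral_prod_symm _ hint]
  have h : ∀ g : E d, ∫ X, vecTerm r M2 x (X, g) ∂multivariateGaussian μ 1 =
      (√2)⁻¹ ^ d * (Real.exp (-‖μ - x‖ ^ 2 / 4) *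
        (if M2 < ‖r • g‖ ^ 2 then 0 else Real.cos (inner ℝ (μ - x) (r • g)))) := by
    intro g
    simp only [vecTerm]
    split_ifs with hg
    · simp
    · have h1 : ∀ X : E d, Real.exp (‖r • g‖ ^ 2 - ‖X - x‖ ^ 2 / 2) *
          Real.cos (2 * inner ℝ (X - x) (r • g)) = Real.exp (‖r • g‖ ^ 2) *
            (Real.exp (-‖X - x‖ ^ 2 / 2) * Real.cos (2 * inner ℝ (X - x) (r • g))) := by
        intro X
        rw [← mul_assoc, ← Real.exp_add]
        congr 2
        ring
      simp_rw [h1]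
      rw [integral_const_mul]
      have h2 := integral_exp_mul_cos_window (μ - x) (r • g)
      rw [← multivariateGaussian_map_sub, integral_map (by fun_prop)
        (Measurable.aestronglyMeasurable (by fun_prop))] at h2
      rw [h2]
      have h3 : Real.exp (-‖μ - x‖ ^ 2 / 4 - ‖r • g‖ ^ 2) * Real.exp (‖r • g‖ ^ 2) =
          Real.exp (-‖μ - x‖ ^ 2 / 4) := by
        rw [← Real.exp_add]
        congr 1
        ring
      rw [← h3]
      ring
  simp_rw [h]
  rw [integral_const_mul, integral_const_mul, cutKernel]

/-- The sum over all components of the kernel with window. -/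
noncomputable def kernelSum {k : ℕ} (μ : Fin k → E d) (r M2 : ℝ) (x : E d) : ℝ :=
  ∑ j, Real.exp (-‖μ j - x‖ ^ 2 / 4) * cutKernel r M2 (μ j - x)

theorem integral_vecTerm_mixture {k : ℕ} (hk : k ≠ 0) (μ : Fin k → E d) (r M2 : ℝ) (x : E d) :
    ∫ p, vecTerm r M2 x p ∂(mixture μ).prod (stdGaussian (E d)) =
      (√2)⁻¹ ^ d / k * kernelSum μ r M2 x := by
  have := isProbabilityMeasure_mixture hk μ
  have hint : ∀ (ν : Measure (E d)) [IsProbabilityMeasure ν],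
      Integrable (vecTerm r M2 x) (ν.prod (stdGaussian (E d))) := fun ν _ =>
    Integrable.of_bound (measurable_vecTerm_right r M2 x).aestronglyMeasurable (Real.exp M2)
      (Filter.Eventually.of_forall fun p => abs_vecTerm_le r M2 x p)
  rw [integral_prod _ (hint _), mixture, integral_smul_measure, integral_finsetSum_measure
    fun j _ => (hint (multivariateGaussian (μ j) 1)).integral_prod_left]
  simp_rw [← integral_prod _ (hint _), integral_vecTerm_gaussian, ← Finset.mul_sum]
  rw [ENNReal.toReal_inv, ENNReal.toReal_natCast, smul_eq_mul, kernelSum]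
  ring

end GMM

namespace GMM

/-! ### Gaussian sums over separated points -/

variable {d : ℕ}

local notation "E" d => EuclideanSpace ℝ (Fin d)

theorem integral_exp_neg_mul_sq {a : ℝ} (ha : 0 < a) :
    ∫ v : E d, Real.exp (-a * ‖v‖ ^ 2) = (Real.pi / a) ^ ((d : ℝ) / 2) := by
  simpa using GaussianFourier.integral_rexp_neg_mul_sq_norm (V := E d) ha

theorem integrable_exp_neg_mul_sq {a : ℝ} (ha : 0 < a) :
    Integrable (fun v : E d => Real.exp (-a * ‖v‖ ^ 2)) := by
  by_contra h
  have := integral_undef h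
  rw [integral_exp_neg_mul_sq ha] at this
  have hpi := Real.pi_pos
  exact absurd this (by positivity)

/-- By the symmetry v ↦ -v, twice the right side is the integral of f(u + v) + f(u - v) over the
centred ball, and this sum equals 2 f(u) f(v) cosh(2a⟨u, v⟩) ≥ 2 f(u) f(v). -/
theorem exp_mul_setIntegral_ball_le {a : ℝ} (ha : 0 < a) (ρ : ℝ) (u : E d) :
    Real.exp (-a * ‖u‖ ^ 2) * ∫ v in Metric.ball (0 : E d) ρ, Real.exp (-a * ‖v‖ ^ 2) ≤
      ∫ v in Metric.ball u ρ, Real.exp (-a * ‖v‖ ^ 2) := by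
  set f : (E d) → ℝ := fun v => Real.exp (-a * ‖v‖ ^ 2) with hf
  have hfi : Integrable f := integrable_exp_neg_mul_sq ha
  set B := Metric.ball (0 : E d) ρ with hB
  have h1 : ∫ v in Metric.ball u ρ, f v = ∫ v in B, f (u + v) := by
    rw [← integral_indicator Metric.isOpen_ball.measurableSet,
      ← integral_indicator Metric.isOpen_ball.measurableSet, ← integral_add_left_eq_self _ u]
    congr 1 with v
    simp [Set.indicator, Metric.mem_ball, dist_eq_norm]
  have h2 : ∫ v in B, f (u + v) = ∫ v in B, f (u - v) := by
    rw [← integral_indicator Metric.isOpen_ball.measurableSet,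
      ← integral_indicator Metric.isOpen_ball.measurableSet, ← integral_neg_eq_self]
    congr 1 with v
    simp [Set.indicator, sub_eq_add_neg]
  have hi1 : Integrable fun v => f (u + v) := hfi.comp_add_left u
  have hi2 : Integrable fun v => f (u - v) := hfi.comp_sub_left u
  have h3 : 2 * ∫ v in Metric.ball u ρ, f v = ∫ v in B, (f (u + v) + f (u - v)) := by
    rw [integral_add hi1.integrableOn hi2.integrableOn, ← h2, h1]
    ring
  have h4 : ∫ v in B, 2 * (f u * f v) ≤ ∫ v in B, (f (u + v) + f (u - v)) := by
    refine integral_mono ((hfi.const_mul _).const_mul _).integrableOn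
      (hi1.add hi2).integrableOn fun v => ?_
    simp only [hf]
    have e1 : ∀ b : ℝ, Real.exp (-a * (‖u‖ ^ 2 + 2 * b + ‖v‖ ^ 2)) =
        Real.exp (-a * ‖u‖ ^ 2) * Real.exp (-a * ‖v‖ ^ 2) * Real.exp (-(2 * a * b)) := by
      intro b
      rw [← Real.exp_add, ← Real.exp_add]
      congr 1
      ring
    have e2 : Real.exp (-a * ‖u + v‖ ^ 2) =
        Real.exp (-a * ‖u‖ ^ 2) * Real.exp (-a * ‖v‖ ^ 2) *
          Real.exp (-(2 * a * inner ℝ u v)) := by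
      rw [norm_add_sq_real, e1]
    have e3 : Real.exp (-a * ‖u - v‖ ^ 2) =
        Real.exp (-a * ‖u‖ ^ 2) * Real.exp (-a * ‖v‖ ^ 2) *
          Real.exp (2 * a * inner ℝ u v) := by
      have := e1 (-inner ℝ u v)
      rw [norm_sub_sq_real, show ‖u‖ ^ 2 - 2 * inner ℝ u v + ‖v‖ ^ 2 =
        ‖u‖ ^ 2 + 2 * -inner ℝ u v + ‖v‖ ^ 2 by ring, this]
      congr 2
      ring
    rw [e2, e3]
    have h5 := Real.add_one_le_exp (2 * a * inner ℝ u v)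
    have h6 := Real.add_one_le_exp (-(2 * a * inner ℝ u v))
    nlinarith [mul_pos (Real.exp_pos (-a * ‖u‖ ^ 2)) (Real.exp_pos (-a * ‖v‖ ^ 2))]
  rw [integral_const_mul, integral_const_mul, ← h3] at h4
  linarith

/-- The balls of radius ρ around the points are disjoint, so the integrals over them add up to at
most the full integral. This replaces counting points in shells. -/
theorem sum_exp_mul_setIntegral_le {ι : Type*} (s : Finset ι) (u : ι → E d) {a ρ : ℝ} (ha : 0 < a)
    (hu : ∀ i ∈ s, ∀ j ∈ s, i ≠ j → 2 * ρ ≤ ‖u i - u j‖) :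
    (∑ j ∈ s, Real.exp (-a * ‖u j‖ ^ 2)) *
      ∫ v in Metric.ball (0 : E d) ρ, Real.exp (-a * ‖v‖ ^ 2) ≤
      ∫ v : E d, Real.exp (-a * ‖v‖ ^ 2) := by
  have hfi := integrable_exp_neg_mul_sq (d := d) ha
  calc _ ≤ ∑ j ∈ s, ∫ v in Metric.ball (u j) ρ, Real.exp (-a * ‖v‖ ^ 2) := by
        rw [Finset.sum_mul]
        exact Finset.sum_le_sum fun j _ => exp_mul_setIntegral_ball_le ha ρ (u j)
    _ = ∫ v in ⋃ j ∈ s, Metric.ball (u j) ρ, Real.exp (-a * ‖v‖ ^ 2) := by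
        rw [integral_biUnion_finset _ (fun j _ => Metric.isOpen_ball.measurableSet) ?_
          fun j _ => hfi.integrableOn]
        intro i hi j hj hij
        refine Metric.ball_disjoint_ball ?_
        rw [dist_eq_norm]
        have := hu i hi j hj hij
        linarith
    _ ≤ _ := setIntegral_le_integral hfi (Filter.Eventually.of_forall fun v => by positivity)

/-- With a rate that is large compared to the dimension, Gaussian sums over separated points are
bounded by an absolute constant. -/
theorem sum_exp_le_two {ι : Type*} (s : Finset ι) (u : ι → E d) {a Δ : ℝ} (hd : 1 ≤ d)
    (hΔ : 0 < Δ) (ha : 16 * d / (Δ * Δ) ≤ a)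
    (hu : ∀ i ∈ s, ∀ j ∈ s, i ≠ j → Δ ≤ ‖u i - u j‖) :
    ∑ j ∈ s, Real.exp (-a * ‖u j‖ ^ 2) ≤ 2 := by
  have hd1 : (1 : ℝ) ≤ d := by exact_mod_cast hd
  set b := 16 * d / (Δ * Δ) with hb
  have hb0 : 0 < b := by positivity
  have h0 : ∑ j ∈ s, Real.exp (-a * ‖u j‖ ^ 2) ≤ ∑ j ∈ s, Real.exp (-b * ‖u j‖ ^ 2) := by
    refine Finset.sum_le_sum fun j _ => Real.exp_le_exp.mpr ?_
    nlinarith [sq_nonneg ‖u j‖]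
  refine h0.trans ?_
  have h1 := sum_exp_mul_setIntegral_le s u (ρ := Δ / 2) hb0
    (fun i hi j hj hij => by have := hu i hi j hj hij; linarith)
  have hfi := integrable_exp_neg_mul_sq (d := d) hb0
  have hfi2 := integrable_exp_neg_mul_sq (d := d) (half_pos hb0)
  set J := ∫ v : E d, Real.exp (-b * ‖v‖ ^ 2) with hJ
  have hJv : J = (Real.pi / b) ^ ((d : ℝ) / 2) := integral_exp_neg_mul_sq hb0
  have hpi := Real.pi_pos
  have hJ0 : 0 < J := by rw [hJv]; positivity
  -- At most half of the mass lies outside the ball: there half of the exponent is at least 2d, and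
  -- halving the rate costs 2^(d/2) ≤ exp(2d)/2.
  have hout : ∫ v in (Metric.ball (0 : E d) (Δ / 2))ᶜ, Real.exp (-b * ‖v‖ ^ 2) ≤ J / 2 := by
    have e1 : ∫ v in (Metric.ball (0 : E d) (Δ / 2))ᶜ, Real.exp (-b * ‖v‖ ^ 2) ≤
        ∫ v in (Metric.ball (0 : E d) (Δ / 2))ᶜ,
          Real.exp (-(2 * d)) * Real.exp (-(b / 2) * ‖v‖ ^ 2) := by
      refine setIntegral_mono_on hfi.integrableOn (hfi2.const_mul _).integrableOn
        Metric.isOpen_ball.measurableSet.compl fun v hv => ?_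
      simp only [Set.mem_compl_iff, Metric.mem_ball, dist_zero_right, not_lt] at hv
      rw [← Real.exp_add]
      refine Real.exp_le_exp.mpr ?_
      have h2 : (Δ / 2) ^ 2 ≤ ‖v‖ ^ 2 := pow_le_pow_left₀ (by positivity) hv 2
      have h3 : b / 2 * (Δ / 2) ^ 2 = 2 * d := by rw [hb]; field_simp; ring
      nlinarith
    have e2 : ∫ v in (Metric.ball (0 : E d) (Δ / 2))ᶜ,
        Real.exp (-(2 * d)) * Real.exp (-(b / 2) * ‖v‖ ^ 2) ≤
        Real.exp (-(2 * d)) * (2 ^ ((d : ℝ) / 2) * J) := by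
      refine (setIntegral_le_integral (hfi2.const_mul _)
        (Filter.Eventually.of_forall fun v => by positivity)).trans (le_of_eq ?_)
      rw [integral_const_mul, integral_exp_neg_mul_sq (half_pos hb0), hJv,
        ← Real.mul_rpow (by norm_num) (by positivity)]
      congr 2
      field_simp
    have e3 : Real.exp (-(2 * d)) * 2 ^ ((d : ℝ) / 2) ≤ 1 / 2 := by
      rw [Real.rpow_def_of_pos two_pos, ← Real.exp_add]
      have : -(2 * d) + Real.log 2 * ((d : ℝ) / 2) ≤ -Real.log 2 := by
        have := Real.log_two_lt_d9
        nlinarith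
      refine (Real.exp_le_exp.mpr this).trans (le_of_eq ?_)
      rw [Real.exp_neg, Real.exp_log two_pos]
      norm_num
    calc _ ≤ _ := e1.trans e2
      _ = Real.exp (-(2 * d)) * 2 ^ ((d : ℝ) / 2) * J := by ring
      _ ≤ 1 / 2 * J := by gcongr
      _ = J / 2 := by ring
  have hin := integral_add_compl (Metric.isOpen_ball (x := (0 : E d)) (ε := Δ / 2)).measurableSet
    hfi
  have hS : 0 ≤ ∑ j ∈ s, Real.exp (-b * ‖u j‖ ^ 2) :=
    Finset.sum_nonneg fun _ _ => Real.exp_nonneg _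
  nlinarith

/-- Gaussian sums over separated points with a fixed rate. -/
theorem sum_exp_quarter_le {ι : Type*} (s : Finset ι) (u : ι → E d) {Δ t : ℝ} (hd : 1 ≤ d)
    (hΔ : 0 < Δ) (ht : 0 < t) (ht1 : t ≤ 1) (htΔ : d * t ^ 2 ≤ (Δ / 2) ^ 2)
    (hu : ∀ i ∈ s, ∀ j ∈ s, i ≠ j → Δ ≤ ‖u i - u j‖) :
    ∑ j ∈ s, Real.exp (-‖u j‖ ^ 2 / 4) ≤ (3 / t) ^ d := by
  have hd1 : (1 : ℝ) ≤ d := by exact_mod_cast hd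
  have hq : (0 : ℝ) < 1 / 4 := by norm_num
  have h1 := sum_exp_mul_setIntegral_le s u (ρ := Δ / 2) hq
    (fun i hi j hj hij => by have := hu i hi j hj hij; linarith)
  have hfi := integrable_exp_neg_mul_sq (d := d) hq
  rw [integral_exp_neg_mul_sq hq] at h1
  -- The mass of the ball is bounded below by that of a cube inside it. The condition on d t² makes
  -- the cube fit, and t ≤ 1 keeps the integrand at least exp(-d/4) on it.
  set box : Set (E d) := WithLp.ofLp ⁻¹' Set.univ.pi fun _ => Set.Ioo (-t) t with hbox
  have hboxm : MeasurableSet box := by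
    rw [hbox]
    exact (MeasurableSet.univ_pi fun _ => measurableSet_Ioo).preimage (by fun_prop)
  have hvol : volume box = ENNReal.ofReal ((2 * t) ^ d) := by
    rw [hbox, (PiLp.volume_preserving_ofLp (Fin d)).measure_preimage
      (MeasurableSet.univ_pi fun _ => measurableSet_Ioo).nullMeasurableSet, Real.volume_pi_Ioo]
    simp only [sub_neg_eq_add, Finset.prod_const, Finset.card_univ, Fintype.card_fin]
    rw [ENNReal.ofReal_pow (by positivity), two_mul]
  have hnorm : ∀ v ∈ box, ‖v‖ ^ 2 < d * t ^ 2 := by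
    intro v hv
    simp only [hbox, Set.mem_preimage, Set.mem_pi, Set.mem_univ, forall_const, Set.mem_Ioo] at hv
    rw [EuclideanSpace.real_norm_sq_eq]
    calc _ < ∑ i : Fin d, t ^ 2 :=
          Finset.sum_lt_sum_of_nonempty ⟨⟨0, hd⟩, Finset.mem_univ _⟩
            fun i _ => sq_lt_sq' (hv i).1 (hv i).2
      _ = d * t ^ 2 := by simp
  have hsub : box ⊆ Metric.ball (0 : E d) (Δ / 2) := by
    intro v hv
    rw [Metric.mem_ball, dist_zero_right]
    exact lt_of_pow_lt_pow_left₀ 2 (by positivity) ((hnorm v hv).trans_le htΔ)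
  have hlow : (2 * t) ^ d * Real.exp (-(d / 4)) ≤
      ∫ v in Metric.ball (0 : E d) (Δ / 2), Real.exp (-(1 / 4) * ‖v‖ ^ 2) := by
    calc _ = ∫ v in box, Real.exp (-(d / 4)) := by
          rw [setIntegral_const, measureReal_def, hvol, ENNReal.toReal_ofReal (by positivity),
            smul_eq_mul]
      _ ≤ ∫ v in box, Real.exp (-(1 / 4) * ‖v‖ ^ 2) := by
          refine setIntegral_mono_on (integrableOn_const (by rw [hvol]; simp)) hfi.integrableOn
            hboxm fun v hv => Real.exp_le_exp.mpr ?_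
          have h2 := hnorm v hv
          have h3 : d * t ^ 2 ≤ d * 1 := by
            gcongr
            nlinarith
          linarith
      _ ≤ _ := setIntegral_mono_set hfi.integrableOn
          (Filter.Eventually.of_forall fun v => by positivity) hsub.eventuallyLE
  have hS : 0 ≤ ∑ j ∈ s, Real.exp (-(1 / 4) * ‖u j‖ ^ 2) :=
    Finset.sum_nonneg fun _ _ => Real.exp_nonneg _
  have h2 : (∑ j ∈ s, Real.exp (-(1 / 4) * ‖u j‖ ^ 2)) * ((2 * t) ^ d * Real.exp (-(d / 4))) ≤
      (Real.pi / (1 / 4)) ^ ((d : ℝ) / 2) := (mul_le_mul_of_nonneg_left hlow hS).trans h1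
  have h3 : (Real.pi / (1 / 4)) ^ ((d : ℝ) / 2) ≤
      (3 / t) ^ d * ((2 * t) ^ d * Real.exp (-(d / 4))) := by
    have e1 : (Real.pi / (1 / 4)) ^ ((d : ℝ) / 2) = √(4 * Real.pi) ^ d := by
      rw [Real.sqrt_eq_rpow, ← Real.rpow_natCast, ← Real.rpow_mul (by have := Real.pi_pos; positivity)]
      congr 1 <;> ring
    have e2 : Real.exp (-((d : ℝ) / 4)) = Real.exp (-(1 / 4)) ^ d := by
      rw [← Real.exp_nat_mul]
      congr 1
      ring
    rw [e1, e2, ← mul_assoc, ← mul_pow, ← mul_pow]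
    -- Per coordinate the claim is √(4π) ≤ 6 exp(-1/4).
    refine pow_le_pow_left₀ (by positivity) ?_ d
    rw [show 3 / t * (2 * t) = 6 by field_simp; norm_num]
    have h4 := Real.add_one_le_exp (-(1 / 4 : ℝ))
    have h5 : √(4 * Real.pi) ≤ 4 := by
      rw [Real.sqrt_le_left (by norm_num)]
      nlinarith [Real.pi_lt_four]
    linarith
  have h4 : 0 < (2 * t) ^ d * Real.exp (-(d / 4)) := by positivity
  have := le_of_mul_le_mul_right (h2.trans h3) h4
  refine le_trans (le_of_eq ?_) this
  refine Finset.sum_congr rfl fun j _ => ?_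
  congr 1
  ring

end GMM

namespace GMM

/-! ### Estimates for the parameters -/

namespace Admissible

variable {k d : ℕ} {Δ ε : ℝ} (h : Admissible k d Δ ε)

include h

theorem accPar_pos : 0 < accPar ε := lt_min h.acc_pos one_pos

theorem accPar_lt : 100 * accPar ε < Δ := by
  have h1 : ε < Δ / 100 := h.acc_lt.trans_le (min_le_left _ _)
  have h2 : accPar ε ≤ ε := min_le_left _ _
  linarith

theorem one_le_dim : (1 : ℝ) ≤ d := by exact_mod_cast h.dim_pos

theorem two_le' : (2 : ℝ) ≤ k := by exact_mod_cast h.two_le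

theorem log_pos : 0 < Real.log k := Real.log_pos (by linarith [h.two_le'])

theorem four_le_logPar : 4 ≤ logPar Δ ε := by
  have he := h.accPar_pos
  have h1 : (100 : ℝ) ≤ Δ / accPar ε := by
    rw [le_div_iff₀ he]
    exact h.accPar_lt.le
  rw [logPar, Real.le_log_iff_exp_le (by linarith)]
  refine le_trans ?_ h1
  have h2 := Real.exp_one_lt_d9
  have h3 : Real.exp 4 = Real.exp 1 ^ 4 := by rw [← Real.exp_nat_mul]; norm_num
  rw [h3]
  calc Real.exp 1 ^ 4 ≤ 2.7182818286 ^ 4 := by gcongr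
    _ ≤ 100 := by norm_num

theorem min_pos : 0 < min (d : ℝ) (Real.log k) :=
  lt_min (by linarith [h.one_le_dim]) h.log_pos

theorem logPar_le_packPar : logPar Δ ε ≤ packPar k d Δ ε := by
  have := h.min_pos
  rw [packPar]
  linarith

theorem log_window_pos : 0 < Real.log (2 + d / (Δ * Δ)) := by
  have hΔ := h.sep_pos
  have : 0 ≤ (d : ℝ) / (Δ * Δ) := by positivity
  exact Real.log_pos (by linarith)

theorem window_min_pos : 0 < min (d + Real.log k) (d * Real.log (2 + d / (Δ * Δ))) := by
  have h1 := h.one_le_dim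
  have h2 := h.log_pos
  have h3 := h.log_window_pos
  exact lt_min (by positivity) (by positivity)

theorem logPar_le_windowPar : logPar Δ ε ≤ windowPar k d Δ ε := by
  have := h.window_min_pos
  rw [windowPar]
  linarith

theorem ratePar_pos : 0 < ratePar k d Δ ε := by
  have h1 := h.logPar_le_packPar
  have h2 := h.four_le_logPar
  have h3 := h.sep_pos
  have : 0 < packPar k d Δ ε := by linarith
  rw [ratePar]
  positivity

theorem exp_neg_logPar : Real.exp (-logPar Δ ε) = accPar ε / Δ := by
  rw [logPar, Real.exp_neg, Real.exp_log (div_pos h.sep_pos h.accPar_pos), inv_div]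

theorem gapPar_ge_sq : accPar ε ^ 2 / 4 ≤ gapPar k d Δ ε := by
  rw [gapPar, kernelPar]
  nlinarith [mul_pos h.ratePar_pos (pow_pos h.accPar_pos 2)]

theorem gapPar_pos : 0 < gapPar k d Δ ε :=
  lt_of_lt_of_le (by have := h.accPar_pos; positivity) h.gapPar_ge_sq

/-- Allows errors (e/Δ)^a with a ≥ 2 to be absorbed into the gap. Only the bound `packPar` ≥
`logPar` ≥ 4 enters, and 64 = 16 · 4. -/
theorem gapPar_ge_exp : 64 * Real.exp (-2 * logPar Δ ε) ≤ gapPar k d Δ ε := by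
  have h0 := h.sep_pos
  have h1 : Real.exp (-2 * logPar Δ ε) = (accPar ε / Δ) ^ 2 := by
    rw [← h.exp_neg_logPar, ← Real.exp_nat_mul]
    congr 1
    push_cast
    ring
  have h2 : 64 / (Δ * Δ) ≤ ratePar k d Δ ε := by
    rw [ratePar]
    gcongr
    linarith [h.logPar_le_packPar, h.four_le_logPar]
  have h3 : 64 * (accPar ε / Δ) ^ 2 = 64 / (Δ * Δ) * (accPar ε * accPar ε) := by
    field_simp
  rw [h1, h3, gapPar, kernelPar]
  have : 0 ≤ accPar ε * accPar ε := mul_self_nonneg _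
  nlinarith

/-- The only use of the bound ε < Δ/(32√min{d, log k}): it limits the share of min{d, log k} in γe²
to 16/1024. The share of log(Δ/e) is at most 16/100, since log(Δ/e) ≤ Δ/e and e < Δ/100, and the
window adds e²/4 ≤ 1/4. -/
theorem gapPar_le_one : gapPar k d Δ ε ≤ 1 := by
  have h0 := h.sep_pos
  have he := h.accPar_pos
  have he1 : accPar ε ≤ 1 := min_le_right _ _
  set m := min (d : ℝ) (Real.log k) with hm
  have hm0 : 0 < m := h.min_pos
  have h1 : accPar ε ^ 2 * m ≤ Δ ^ 2 / 1024 := by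
    have h2 : accPar ε ≤ Δ / (32 * √m) :=
      (min_le_left _ _).trans (h.acc_lt.le.trans (min_le_right _ _))
    have hs : 0 < √m := Real.sqrt_pos.mpr hm0
    rw [le_div_iff₀ (by positivity)] at h2
    have h3 : (accPar ε * (32 * √m)) ^ 2 ≤ Δ ^ 2 := pow_le_pow_left₀ (by positivity) h2 2
    have h4 : √m ^ 2 = m := Real.sq_sqrt hm0.le
    nlinarith
  have h2 : accPar ε ^ 2 * logPar Δ ε ≤ Δ ^ 2 / 100 := by
    have h3 : logPar Δ ε ≤ Δ / accPar ε := by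
      rw [logPar]
      exact (Real.log_le_sub_one_of_pos (div_pos h0 he)).trans (by linarith)
    calc _ ≤ accPar ε ^ 2 * (Δ / accPar ε) := by gcongr
      _ = accPar ε * Δ := by field_simp
      _ ≤ _ := by nlinarith [h.accPar_lt]
  have h3 : ratePar k d Δ ε * accPar ε ^ 2 ≤ 1 / 2 := by
    rw [ratePar, packPar, ← hm, div_mul_eq_mul_div, div_le_iff₀ (by positivity)]
    nlinarith
  rw [gapPar, kernelPar]
  nlinarith

end Admissible

/-! ### The kernel sum near and far from the means -/

variable {k d : ℕ} {Δ ε : ℝ}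

local notation "E" d => EuclideanSpace ℝ (Fin d)

/-- One bound for each entry of the minimum: either every term of the sum is at most 1, or the
packing bound `sum_exp_quarter_le` is used, which does not see k. -/
theorem sqrt_two_pow_mul_sum_le (h : Admissible k d Δ ε) {μ : Fin k → E d} (hμ : Separated Δ μ)
    (x : E d) : √2 ^ d * ∑ j, Real.exp (-‖μ j - x‖ ^ 2 / 4) ≤
      Real.exp (5 * min (d + Real.log k) (d * Real.log (2 + d / (Δ * Δ)))) := by
  have hd := h.one_le_dim
  have hk := h.two_le'
  have hΔ := h.sep_pos
  have hs2 : √2 ≤ Real.exp 1 := by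
    have h1 := Real.add_one_le_exp (1 : ℝ)
    have h2 : √2 ≤ 2 := by rw [Real.sqrt_le_left (by norm_num)]; norm_num
    linarith
  have h1 : √2 ^ d * ∑ j, Real.exp (-‖μ j - x‖ ^ 2 / 4) ≤ Real.exp (5 * (d + Real.log k)) := by
    calc _ ≤ Real.exp 1 ^ d * ∑ j : Fin k, (1 : ℝ) := by
          gcongr with j
          exact Real.exp_le_one_iff.mpr (by have := sq_nonneg ‖μ j - x‖; linarith)
      _ = Real.exp (d + Real.log k) := by
          rw [Real.exp_add, Real.exp_log (by linarith), ← Real.exp_nat_mul]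
          simp
      _ ≤ _ := Real.exp_le_exp.mpr (by linarith [h.log_pos])
  have h2 : √2 ^ d * ∑ j, Real.exp (-‖μ j - x‖ ^ 2 / 4) ≤
      Real.exp (5 * (d * Real.log (2 + d / (Δ * Δ)))) := by
    set D := (d : ℝ) / (Δ * Δ) with hD
    have hD0 : 0 < D := by positivity
    -- This is min(1, Δ/(2√d)), the largest half side that `sum_exp_quarter_le` allows.
    set t := min 1 (1 / (2 * √D)) with ht
    have hsD : 0 < √D := Real.sqrt_pos.mpr hD0
    have ht0 : 0 < t := lt_min one_pos (by positivity)
    have ht2 : t ≤ 1 / (2 * √D) := min_le_right _ _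
    have hpack := sum_exp_quarter_le Finset.univ (fun j => μ j - x) (Δ := Δ) (t := t) h.dim_pos
      hΔ ht0 (min_le_left _ _) ?_ (fun i _ j _ hij => by simpa using hμ i j hij)
    · calc _ ≤ √2 ^ d * (3 / t) ^ d := by gcongr
        _ = (√2 * (3 / t)) ^ d := by rw [mul_pow]
        _ ≤ ((2 + D) ^ 5) ^ d := by
            refine pow_le_pow_left₀ (by positivity) ?_ d
            have h3 : 1 / t ≤ 1 + 2 * √D := by
              rw [div_le_iff₀ ht0, ht]
              rcases min_cases 1 (1 / (2 * √D)) with ⟨e, -⟩ | ⟨e, -⟩ <;> rw [e]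
              · linarith
              · rw [add_mul]
                have : 2 * √D * (1 / (2 * √D)) = 1 := by field_simp
                rw [this]
                have : (0 : ℝ) ≤ 1 * (1 / (2 * √D)) := by positivity
                linarith
            have h4 : √2 ≤ 2 := by rw [Real.sqrt_le_left (by norm_num)]; norm_num
            have h5 : 2 * √D ≤ 1 + D := by nlinarith [Real.sq_sqrt hD0.le, sq_nonneg (√D - 1)]
            have h6 : (16 : ℝ) ≤ (2 + D) ^ 4 := by
              calc (16 : ℝ) = 2 ^ 4 := by norm_num
                _ ≤ _ := by gcongr; linarith
            calc √2 * (3 / t) = √2 * (3 * (1 / t)) := by ring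
              _ ≤ 2 * (3 * (2 + D)) := by gcongr; linarith
              _ ≤ 16 * (2 + D) := by linarith
              _ ≤ (2 + D) ^ 4 * (2 + D) := by gcongr
              _ = _ := by ring
        _ = _ := by
            rw [← Real.exp_log (show 0 < 2 + D by linarith), ← Real.exp_nat_mul,
              ← Real.exp_nat_mul, Real.log_exp]
            congr 1
            push_cast
            ring
    · have : t ^ 2 ≤ (1 / (2 * √D)) ^ 2 := pow_le_pow_left₀ ht0.le ht2 2
      have h5 : (d : ℝ) * (1 / (2 * √D)) ^ 2 = (Δ / 2) ^ 2 := by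
        rw [div_pow, mul_pow, Real.sq_sqrt hD0.le, hD]
        field_simp
      calc _ ≤ (d : ℝ) * (1 / (2 * √D)) ^ 2 := by gcongr
        _ = _ := h5
  rcases min_cases (d + Real.log k) (d * Real.log (2 + d / (Δ * Δ))) with ⟨e, -⟩ | ⟨e, -⟩ <;>
    rw [e]
  exacts [h1, h2]

theorem exp_logPar_le (h : Admissible k d Δ ε) {a : ℝ} (ha : 2 ≤ a) :
    2 * Real.exp (-a * logPar Δ ε) ≤ gapPar k d Δ ε / 32 := by
  have h1 : Real.exp (-a * logPar Δ ε) ≤ Real.exp (-2 * logPar Δ ε) :=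
    Real.exp_le_exp.mpr (by nlinarith [h.four_le_logPar])
  have h2 := h.gapPar_ge_exp
  linarith

/-- The factor 40 in `cutPar` gives the tail exponent M2/(4 · 2γ) = 5 · `windowPar`. The part of it
with the minimum pays for √2^d times the sum of the window weights; exp(-5 log(Δ/e)) remains. -/
theorem abs_kernelSum_sub_le (h : Admissible k d Δ ε) {μ : Fin k → E d} (hμ : Separated Δ μ)
    (x : E d) : |kernelSum μ √(2 * ratePar k d Δ ε) (cutPar k d Δ ε) x -
      ∑ j, Real.exp (-kernelPar k d Δ ε * ‖μ j - x‖ ^ 2)| ≤ gapPar k d Δ ε / 32 := by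
  have hr := h.ratePar_pos
  have hr2 : √(2 * ratePar k d Δ ε) ^ 2 = 2 * ratePar k d Δ ε := Real.sq_sqrt (by positivity)
  have hcut : cutPar k d Δ ε / (4 * √(2 * ratePar k d Δ ε) ^ 2) = 5 * windowPar k d Δ ε := by
    rw [hr2, cutPar]
    field_simp
    ring
  have hterm : ∀ j, Real.exp (-kernelPar k d Δ ε * ‖μ j - x‖ ^ 2) =
      Real.exp (-‖μ j - x‖ ^ 2 / 4) *
        Real.exp (-(√(2 * ratePar k d Δ ε) ^ 2 / 2) * ‖μ j - x‖ ^ 2) := by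
    intro j
    rw [← Real.exp_add, hr2, kernelPar]
    congr 1
    ring
  simp_rw [kernelSum, hterm]
  rw [← Finset.sum_sub_distrib]
  simp_rw [← mul_sub]
  refine (Finset.abs_sum_le_sum_abs _ _).trans ?_
  simp_rw [abs_mul, Real.abs_exp]
  calc _ ≤ ∑ j, Real.exp (-‖μ j - x‖ ^ 2 / 4) *
        (√2 ^ d * Real.exp (-(5 * windowPar k d Δ ε))) := by
        refine Finset.sum_le_sum fun j _ => mul_le_mul_of_nonneg_left ?_ (Real.exp_nonneg _)
        rw [← hcut]
        exact abs_cutKernel_sub_le (Real.sqrt_pos.mpr (by positivity)) _ _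
    _ = √2 ^ d * (∑ j, Real.exp (-‖μ j - x‖ ^ 2 / 4)) * Real.exp (-(5 * windowPar k d Δ ε)) := by
        rw [← Finset.sum_mul]
        ring
    _ ≤ Real.exp (5 * min (d + Real.log k) (d * Real.log (2 + d / (Δ * Δ)))) *
        Real.exp (-(5 * windowPar k d Δ ε)) := by
        gcongr
        exact sqrt_two_pow_mul_sum_le h hμ x
    _ = Real.exp (-5 * logPar Δ ε) := by
        rw [← Real.exp_add, windowPar]
        congr 1
        ring
    _ ≤ _ := by
        have := exp_logPar_le h (a := 5) (by norm_num)
        have := Real.exp_nonneg (-5 * logPar Δ ε)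
        linarith

/-- At distance Δ/2 the exponent γΔ²/4 equals 4(min{d, log k} + log(Δ/e)). The logarithm gives the
smallness, the minimum controls the number of terms: by counting if log k ≤ d, by `sum_exp_le_two`
otherwise. -/
theorem sum_erase_exp_le (h : Admissible k d Δ ε) {μ : Fin k → E d} (hμ : Separated Δ μ)
    (x : E d) (j₀ : Fin k) (hx : ∀ j ≠ j₀, Δ / 2 ≤ ‖μ j - x‖) :
    ∑ j ∈ Finset.univ.erase j₀, Real.exp (-kernelPar k d Δ ε * ‖μ j - x‖ ^ 2) ≤
      gapPar k d Δ ε / 32 := by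
  have hΔ := h.sep_pos
  have hl := h.four_le_logPar
  have hk := h.two_le'
  have hsq : ∀ j ∈ Finset.univ.erase j₀, Δ * Δ / 4 ≤ ‖μ j - x‖ ^ 2 := by
    intro j hj
    have := pow_le_pow_left₀ (by positivity) (hx j (Finset.ne_of_mem_erase hj)) 2
    nlinarith
  refine le_trans ?_ (exp_logPar_le h (a := 4) (by norm_num))
  rcases le_total (Real.log k) (d : ℝ) with hc | hc
  · have hrate : ratePar k d Δ ε * (Δ * Δ / 4) = 4 * Real.log k + 4 * logPar Δ ε := by
      rw [ratePar, packPar, min_eq_right hc]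
      field_simp
      ring
    calc _ ≤ ∑ j ∈ Finset.univ.erase j₀, Real.exp (-Real.log k + -4 * logPar Δ ε) := by
          refine Finset.sum_le_sum fun j hj => Real.exp_le_exp.mpr ?_
          have h1 := mul_le_mul_of_nonneg_left (hsq j hj) h.ratePar_pos.le
          rw [kernelPar]
          nlinarith [h.log_pos, sq_nonneg ‖μ j - x‖]
      _ ≤ k * Real.exp (-Real.log k + -4 * logPar Δ ε) := by
          rw [Finset.sum_const, nsmul_eq_mul]
          gcongr
          exact (Finset.card_erase_le).trans (by simp)
      _ = Real.exp (-4 * logPar Δ ε) := by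
          rw [Real.exp_add, Real.exp_neg, Real.exp_log (by linarith), ← mul_assoc,
            mul_inv_cancel₀ (by linarith), one_mul]
      _ ≤ _ := by linarith [Real.exp_nonneg (-4 * logPar Δ ε)]
  · have hrate : ratePar k d Δ ε = 16 * d / (Δ * Δ) + 16 * logPar Δ ε / (Δ * Δ) := by
      rw [ratePar, packPar, min_eq_left hc]
      ring
    calc _ ≤ ∑ j ∈ Finset.univ.erase j₀, Real.exp (-4 * logPar Δ ε) *
          Real.exp (-(16 * d / (Δ * Δ)) * ‖μ j - x‖ ^ 2) := by
          refine Finset.sum_le_sum fun j hj => ?_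
          rw [← Real.exp_add]
          refine Real.exp_le_exp.mpr ?_
          have h1 : 16 * logPar Δ ε / (Δ * Δ) * (Δ * Δ / 4) ≤
              16 * logPar Δ ε / (Δ * Δ) * ‖μ j - x‖ ^ 2 :=
            mul_le_mul_of_nonneg_left (hsq j hj) (by positivity)
          have h2 : 16 * logPar Δ ε / (Δ * Δ) * (Δ * Δ / 4) = 4 * logPar Δ ε := by
            field_simp
            ring
          rw [kernelPar, hrate]
          nlinarith [sq_nonneg ‖μ j - x‖]
      _ ≤ Real.exp (-4 * logPar Δ ε) * 2 := by
          rw [← Finset.mul_sum]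
          gcongr
          exact sum_exp_le_two _ (fun j => μ j - x) h.dim_pos hΔ le_rfl
            fun i _ j _ hij => by simpa using hμ i j hij
      _ = _ := by ring

/-- The term of `μ j` loses at most gap/16 because (e/4)² = e²/16, and truncation at most gap/32. -/
theorem kernelSum_ge_of_near (h : Admissible k d Δ ε) {μ : Fin k → E d} (hμ : Separated Δ μ)
    {x : E d} {j : Fin k} (hx : ‖x - μ j‖ ≤ accPar ε / 4) :
    1 - 3 / 32 * gapPar k d Δ ε ≤
      kernelSum μ √(2 * ratePar k d Δ ε) (cutPar k d Δ ε) x := by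
  have h1 := (abs_le.mp (abs_kernelSum_sub_le h hμ x)).1
  have h2 : Real.exp (-kernelPar k d Δ ε * ‖μ j - x‖ ^ 2) ≤
      ∑ j, Real.exp (-kernelPar k d Δ ε * ‖μ j - x‖ ^ 2) :=
    Finset.single_le_sum (f := fun j => Real.exp (-kernelPar k d Δ ε * ‖μ j - x‖ ^ 2))
      (fun _ _ => Real.exp_nonneg _) (Finset.mem_univ j)
  have h3 := Real.add_one_le_exp (-kernelPar k d Δ ε * ‖μ j - x‖ ^ 2)
  have h4 : kernelPar k d Δ ε * ‖μ j - x‖ ^ 2 ≤ gapPar k d Δ ε / 16 := by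
    rw [norm_sub_rev]
    have h5 : ‖x - μ j‖ ^ 2 ≤ (accPar ε / 4) ^ 2 := pow_le_pow_left₀ (norm_nonneg _) hx 2
    have h6 : 0 ≤ kernelPar k d Δ ε := by
      have := h.ratePar_pos
      rw [kernelPar]
      positivity
    rw [gapPar]
    nlinarith [mul_le_mul_of_nonneg_left h5 h6]
  linarith

/-- The closest mean contributes at most exp(-gap) ≤ 1/(1 + gap) ≤ 1 - gap/2, where gap ≤ 1 is used;
the other means and the truncation add at most gap/32 each. -/
theorem kernelSum_le_of_far (h : Admissible k d Δ ε) {μ : Fin k → E d} (hμ : Separated Δ μ)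
    {x : E d} (hx : ∀ j, accPar ε < ‖x - μ j‖) :
    kernelSum μ √(2 * ratePar k d Δ ε) (cutPar k d Δ ε) x ≤ 1 - 7 / 16 * gapPar k d Δ ε := by
  have : Nonempty (Fin k) := ⟨⟨0, by have := h.two_le; omega⟩⟩
  obtain ⟨j₀, hj₀⟩ := Finite.exists_min fun j => ‖μ j - x‖
  have h1 := (abs_le.mp (abs_kernelSum_sub_le h hμ x)).2
  have h2 := sum_erase_exp_le h hμ x j₀ fun j hj => by
    have h3 := hμ j j₀ hj
    have h4 : ‖μ j - μ j₀‖ ≤ ‖μ j - x‖ + ‖μ j₀ - x‖ := by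
      rw [show μ j - μ j₀ = (μ j - x) - (μ j₀ - x) by abel]
      exact norm_sub_le _ _
    linarith [hj₀ j]
  rw [← Finset.add_sum_erase _ _ (Finset.mem_univ j₀)] at h1
  have h3 : Real.exp (-kernelPar k d Δ ε * ‖μ j₀ - x‖ ^ 2) ≤ 1 - gapPar k d Δ ε / 2 := by
    have h4 : gapPar k d Δ ε ≤ kernelPar k d Δ ε * ‖μ j₀ - x‖ ^ 2 := by
      have h5 : accPar ε ^ 2 ≤ ‖μ j₀ - x‖ ^ 2 := by
        rw [norm_sub_rev]
        exact pow_le_pow_left₀ h.accPar_pos.le (hx j₀).le 2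
      have h6 : 0 ≤ kernelPar k d Δ ε := by
        have := h.ratePar_pos
        rw [kernelPar]
        positivity
      rw [gapPar]
      nlinarith [mul_le_mul_of_nonneg_left h5 h6]
    have h5 := h.gapPar_le_one
    have h6 := h.gapPar_pos
    calc _ ≤ Real.exp (-gapPar k d Δ ε) := Real.exp_le_exp.mpr (by linarith)
      _ = (Real.exp (gapPar k d Δ ε))⁻¹ := Real.exp_neg _
      _ ≤ (1 + gapPar k d Δ ε)⁻¹ := by
          gcongr
          linarith [Real.add_one_le_exp (gapPar k d Δ ε)]
      _ ≤ _ := by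
          rw [inv_le_iff_one_le_mul₀ (by linarith)]
          nlinarith
  linarith

end GMM

namespace GMM

/-! ### Correctness of the selection -/

variable {k d : ℕ}

local notation "E" d => EuclideanSpace ℝ (Fin d)

theorem sqDist_coords (x y : E d) : sqDist d (coords x) (coords y) = ‖x - y‖ ^ 2 :=
  sum_range_coords_sub_sq x y

/-- The kept vectors form a maximal separated set among the candidates above the threshold, and
since far candidates fail the threshold test, each of them is near a mean. -/
theorem selected_spec (thr D e : ℝ) (hD : 0 < D) (stat : (ℕ → ℝ) → ℝ) (x : ℕ → E d)
    (μ : Fin k → E d) (T : ℕ)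
    (hfar : ∀ t < T, (∀ j, e < ‖x t - μ j‖) → stat (coords (x t)) ≤ thr) (t : ℕ) (ht : t ≤ T) :
    let sel := selected d thr D stat (fun t => coords (x t)) t
    (∀ y ∈ sel, ∃ v : E d, y = coords v ∧ ∃ j, ‖v - μ j‖ ≤ e) ∧
    sel.Pairwise (fun y z => ¬ sqDist d y z < D) ∧
    ∀ s < t, thr < stat (coords (x s)) → ∃ y ∈ sel, sqDist d y (coords (x s)) < D := by
  induction t with
  | zero => simp [selected]
  | succ t ih =>
    obtain ⟨h1, h2, h3⟩ := ih (by omega)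
    intro sel
    set l := selected d thr D stat (fun t => coords (x t)) t with hl
    have hsel : sel = if thr < stat (coords (x t)) ∧ ∀ y ∈ l, ¬ sqDist d y (coords (x t)) < D then
        l ++ [coords (x t)] else l := by
      simp only [sel, selected, hl]
    rw [hsel]
    split_ifs with hc
    · refine ⟨?_, ?_, ?_⟩
      · intro y hy
        rcases List.mem_append.mp hy with hy | hy
        · exact h1 y hy
        · refine ⟨x t, by simpa using hy, ?_⟩
          by_contra! hj
          exact absurd (hfar t (by omega) hj) (not_le.mpr hc.1)
      · rw [List.pairwise_append]
        refine ⟨h2, by simp, ?_⟩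
        intro y hy z hz
        rw [List.mem_singleton.mp hz]
        exact hc.2 y hy
      · intro s hs hthr
        rcases Nat.lt_succ_iff_lt_or_eq.mp hs with hs | rfl
        · obtain ⟨y, hy, hyD⟩ := h3 s hs hthr
          exact ⟨y, List.mem_append_left _ hy, hyD⟩
        · exact ⟨_, List.mem_append_right _ (List.mem_singleton_self _), by
            simpa [sqDist_coords] using hD⟩
    · refine ⟨h1, h2, ?_⟩
      intro s hs hthr
      rcases Nat.lt_succ_iff_lt_or_eq.mp hs with hs | rfl
      · exact h3 s hs hthr
      · by_contra! hcon
        exact hc ⟨hthr, fun y hy => not_lt.mpr (hcon y hy)⟩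

/-- Each kept vector is assigned a mean within e. Two vectors with the same mean would be within 2e
< Δ/2, so the assignment is injective. A candidate that hits μ_j passes the test, hence some kept
vector is within Δ/2 of it; if that vector belonged to another mean, this mean would be within Δ/2 +
e/4 + e < Δ of μ_j. So it is surjective. -/
theorem epsClose_of_selected {Δ ε e : ℝ} (he : 0 < e) (heε : e ≤ ε) (heΔ : 100 * e < Δ)
    {μ : Fin k → E d} (hμ : Separated Δ μ) (thr : ℝ) (stat : (ℕ → ℝ) → ℝ) (x : ℕ → E d) (T : ℕ)
    (hfar : ∀ t < T, (∀ j, e < ‖x t - μ j‖) → stat (coords (x t)) ≤ thr)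
    (hnear : ∀ t < T, ∀ j, ‖x t - μ j‖ ≤ e / 4 → thr < stat (coords (x t)))
    (hhit : ∀ j, ∃ t < T, ‖x t - μ j‖ ≤ e / 4) (s : State)
    (hs : ∀ j (hj : j < (selected d thr (Δ * Δ / 4) stat (fun t => coords (x t)) T).length),
      ∀ i < d, s.real (s.int 0 + j * d + i) =
        (selected d thr (Δ * Δ / 4) stat (fun t => coords (x t)) T)[j] i) :
    EpsClose ε (output k d s) μ := by
  have hΔ : 0 < Δ := by linarith
  obtain ⟨h1, h2, h3⟩ := selected_spec thr (Δ * Δ / 4) e (by positivity) stat x μ T hfar T le_rfl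
  set l := selected d thr (Δ * Δ / 4) stat (fun t => coords (x t)) T with hl
  have hlt : ∀ v w : E d, ¬ sqDist d (coords v) (coords w) < Δ * Δ / 4 → Δ / 2 ≤ ‖v - w‖ := by
    intro v w hvw
    rw [sqDist_coords, not_lt] at hvw
    by_contra! hcon
    nlinarith [norm_nonneg (v - w)]
  choose v hv f hf using fun i : Fin l.length => h1 l[i] (List.getElem_mem i.2)
  have hinj : Function.Injective f := by
    have key : ∀ i i' : Fin l.length, i < i' → f i ≠ f i' := by
      intro i i' hii hff
      have h4 := List.pairwise_iff_getElem.mp h2 i i' i.2 i'.2 hii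
      have e1 := hv i
      have e2 := hv i'
      simp only [Fin.getElem_fin] at e1 e2
      rw [e1, e2] at h4
      have h5 := hlt _ _ h4
      have h6 := hf i
      have h7 := hf i'
      rw [← hff] at h7
      have h8 : ‖v i - v i'‖ ≤ ‖v i - μ (f i)‖ + ‖v i' - μ (f i)‖ := by
        rw [show v i - v i' = (v i - μ (f i)) - (v i' - μ (f i)) by abel]
        exact norm_sub_le _ _
      linarith
    intro i i' hff
    rcases lt_trichotomy i i' with h | h | h
    · exact absurd hff (key _ _ h)
    · exact h
    · exact absurd hff.symm (key _ _ h)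
  have hsurj : Function.Surjective f := by
    intro j
    obtain ⟨t, ht, hxt⟩ := hhit j
    obtain ⟨y, hy, hyD⟩ := h3 t ht (hnear t ht j hxt)
    obtain ⟨i, hi, rfl⟩ := List.getElem_of_mem hy
    refine ⟨⟨i, hi⟩, ?_⟩
    have e1 := hv ⟨i, hi⟩
    have h6 := hf ⟨i, hi⟩
    simp only [Fin.getElem_fin] at e1
    set w := v ⟨i, hi⟩
    set j' := f ⟨i, hi⟩
    rw [e1, sqDist_coords] at hyD
    have h5 : ‖w - x t‖ < Δ / 2 := by
      by_contra! hcon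
      nlinarith
    by_contra hne
    have h7 := hμ j' j hne
    have h8 : ‖μ j' - μ j‖ ≤ ‖w - x t‖ + ‖x t - μ j‖ + ‖w - μ j'‖ := by
      rw [show μ j' - μ j = ((w - x t) + (x t - μ j)) - (w - μ j') by abel]
      exact (norm_sub_le _ _).trans (by gcongr; exact norm_add_le _ _)
    linarith
  have hlen : l.length = k := by
    simpa using Fintype.card_of_bijective ⟨hinj, hsurj⟩
  refine ⟨(finCongr hlen.symm).trans (Equiv.ofBijective f ⟨hinj, hsurj⟩), fun j => ?_⟩
  have hj : (j : ℕ) < l.length := by rw [hlen]; exact j.2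
  have hout : output k d s j = v ⟨j, hj⟩ := by
    ext i
    have e1 := hv ⟨j, hj⟩
    simp only [Fin.getElem_fin] at e1
    simp only [output]
    rw [hs j hj i i.2, e1]
    simp [coords]
  rw [hout]
  exact (hf ⟨j, hj⟩).trans heε

end GMM

namespace GMM

/-! ### Independence -/

/-- It suffices to check rectangles, which form a generating π-system; there the identity is the
product of those for `U` and `V`. -/
theorem iIndepFun_prodMap {ι Ω Ω' : Type*} {α β : ι → Type*} [MeasurableSpace Ω]
    [MeasurableSpace Ω'] [∀ i, MeasurableSpace (α i)] [∀ i, MeasurableSpace (β i)]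
    {P : Measure Ω} {Q : Measure Ω'} [IsProbabilityMeasure P] [IsProbabilityMeasure Q]
    {U : ∀ i, Ω → α i} {V : ∀ i, Ω' → β i} (hU : iIndepFun U P) (hV : iIndepFun V Q)
    (mU : ∀ i, Measurable (U i)) (mV : ∀ i, Measurable (V i)) :
    iIndepFun (fun i (ω : Ω × Ω') => (U i ω.1, V i ω.2)) (P.prod Q) := by
  have hm : ∀ i, Measurable (fun ω : Ω × Ω' => (U i ω.1, V i ω.2)) := fun i =>
    ((mU i).comp measurable_fst).prodMk ((mV i).comp measurable_snd)
  rw [iIndepFun_iff_iIndep]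
  refine iIndepSets.iIndep (fun i => (hm i).comap_le)
    (fun i => Set.preimage (fun ω : Ω × Ω' => (U i ω.1, V i ω.2)) ''
      Set.image2 (· ×ˢ ·) {s : Set (α i) | MeasurableSet s} {t : Set (β i) | MeasurableSet t})
    (fun i => ?_) (fun i => ?_) ?_
  · exact isPiSystem_prod.comap _
  · rw [← generateFrom_prod, MeasurableSpace.comap_generateFrom]
  · rw [iIndepSets_iff]
    intro s f hf
    choose! g hg hgf using hf
    choose! A hA B hB hAB using hg
    have hfs : ∀ i ∈ s, f i = (U i ⁻¹' A i) ×ˢ (V i ⁻¹' B i) := by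
      intro i hi
      rw [← hgf i hi, ← hAB i hi]
      rfl
    have h1 : ⋂ i ∈ s, f i = (⋂ i ∈ s, U i ⁻¹' A i) ×ˢ (⋂ i ∈ s, V i ⁻¹' B i) := by
      ext ω
      simp only [Set.mem_iInter, Set.mem_prod]
      constructor
      · intro h
        exact ⟨fun i hi => (hfs i hi ▸ h i hi).1, fun i hi => (hfs i hi ▸ h i hi).2⟩
      · intro h i hi
        rw [hfs i hi]
        exact ⟨h.1 i hi, h.2 i hi⟩
    rw [h1, Measure.prod_prod, hU.measure_inter_preimage_eq_mul s fun i hi => hA i hi,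
      hV.measure_inter_preimage_eq_mul s fun i hi => hB i hi, ← Finset.prod_mul_distrib]
    refine Finset.prod_congr rfl fun i hi => ?_
    rw [hfs i hi, Measure.prod_prod]

/-- Independence makes the joint law a product, so by Fubini a bound that holds for each frozen
value of `V` can be integrated. -/
theorem measure_mem_le_of_indepFun {Ω α β : Type*} [MeasurableSpace Ω] [MeasurableSpace α]
    [MeasurableSpace β] {P : Measure Ω} [IsProbabilityMeasure P] {U : Ω → α} {V : Ω → β}
    (h : IndepFun U V P) (mU : Measurable U) (mV : Measurable V) {S : Set (α × β)}
    (hS : MeasurableSet S) (δ : ENNReal) (hδ : ∀ v, P {ω | (U ω, v) ∈ S} ≤ δ) :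
    P {ω | (U ω, V ω) ∈ S} ≤ δ := by
  have h1 := (indepFun_iff_map_prod_eq_prod_map_map mU.aemeasurable mV.aemeasurable).mp h
  have : IsProbabilityMeasure (P.map V) := Measure.isProbabilityMeasure_map mV.aemeasurable
  have : IsProbabilityMeasure (P.map U) := Measure.isProbabilityMeasure_map mU.aemeasurable
  calc P {ω | (U ω, V ω) ∈ S} = P.map (fun ω => (U ω, V ω)) S :=
        (Measure.map_apply (mU.prodMk mV) hS).symm
    _ = ∫⁻ v, P.map U ((fun u => (u, v)) ⁻¹' S) ∂P.map V := by
        rw [h1, Measure.prod_apply_symm hS]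
    _ ≤ ∫⁻ _, δ ∂P.map V := by
        refine lintegral_mono fun v => ?_
        rw [Measure.map_apply mU (measurable_prodMk_right hS)]
        exact hδ v
    _ = δ := by simp

variable {k d : ℕ}

local notation "E" d => EuclideanSpace ℝ (Fin d)

/-- The block of `d` internal Gaussian variates with index `l`. -/
def gaussBlock (d l : ℕ) (g : ℕ → ℝ) : E d := WithLp.toLp 2 fun i : Fin d => g (l * d + i)

/-- The sample with index `l` and the Gaussian block with the same index. -/
def samplePair (l : ℕ) (ω : Tape d) : (E d) × E d := (ω.1 l, gaussBlock d l ω.2)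

theorem measurable_gaussBlock (l : ℕ) : Measurable (gaussBlock d l) := by
  unfold gaussBlock
  fun_prop

theorem measurable_samplePair (l : ℕ) : Measurable (samplePair (d := d) l) :=
  ((measurable_pi_apply l).comp measurable_fst).prodMk
    ((measurable_gaussBlock l).comp measurable_snd)

/-- The map (l, i) ↦ ld + i is injective, so the reindexed variates are again independent standard
normals; currying groups them into blocks. -/
theorem map_gaussBlock :
    (Measure.infinitePi fun _ : ℕ => gaussianReal 0 1).map (fun g l => gaussBlock d l g) =
      Measure.infinitePi fun _ : ℕ => stdGaussian (E d) := by
  have hinj : Function.Injective fun p : ℕ × Fin d => p.1 * d + p.2 := by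
    rintro ⟨a, i⟩ ⟨b, j⟩ h
    simp only at h
    have hd : 0 < d := i.pos
    have h1 : a = b := by
      have := congrArg (· / d) h
      simpa [Nat.add_comm, Nat.add_mul_div_right _ _ hd, Nat.div_eq_of_lt i.2,
        Nat.div_eq_of_lt j.2] using this
    subst h1
    simp only [Nat.add_left_cancel_iff] at h
    rw [Fin.ext h]
  have h1 := Measure.map_infinitePi_infinitePi_of_inj (P := fun _ : ℕ => gaussianReal 0 1) hinj
  have h2 := Measure.infinitePi_map_curry (fun (_ : ℕ) (_ : Fin d) => gaussianReal 0 1)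
  rw [← h1, Measure.map_map (by fun_prop) (by fun_prop)] at h2
  have h3 := Measure.infinitePi_map_pi (μ := fun _ : ℕ => Measure.infinitePi
    fun _ : Fin d => gaussianReal 0 1) (f := fun _ => WithLp.toLp 2)
    (fun _ => by fun_prop)
  rw [← h2, Measure.map_map (by fun_prop) (by fun_prop)] at h3
  simp_rw [Measure.infinitePi_eq_pi, ← stdGaussian_eq_map_pi] at h3
  exact h3

theorem iIndepFun_gaussBlock :
    iIndepFun (fun l => gaussBlock d l) (Measure.infinitePi fun _ : ℕ => gaussianReal 0 1) ∧
      ∀ l, (Measure.infinitePi fun _ : ℕ => gaussianReal 0 1).map (gaussBlock d l) =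
        stdGaussian (E d) := by
  have hl : ∀ l, (Measure.infinitePi fun _ : ℕ => gaussianReal 0 1).map (gaussBlock d l) =
        stdGaussian (E d) := by
    intro l
    have h := congrArg (Measure.map fun f => f l) (map_gaussBlock (d := d))
    rw [Measure.infinitePi_map_eval, Measure.map_map (measurable_pi_apply l)
      (measurable_pi_iff.mpr measurable_gaussBlock)] at h
    exact h
  refine ⟨?_, hl⟩
  rw [iIndepFun_iff_map_fun_eq_infinitePi_map measurable_gaussBlock, map_gaussBlock]
  simp_rw [hl]

theorem isProbabilityMeasure_tapeLaw (hk : k ≠ 0) (μ : Fin k → E d) :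
    IsProbabilityMeasure (tapeLaw μ) := by
  have := isProbabilityMeasure_mixture hk μ
  rw [tapeLaw]
  infer_instance

theorem iIndepFun_samplePair (hk : k ≠ 0) (μ : Fin k → E d) :
    iIndepFun (fun l => samplePair (d := d) l) (tapeLaw μ) := by
  have := isProbabilityMeasure_mixture hk μ
  exact iIndepFun_prodMap (iIndepFun_infinitePi (X := fun _ x => x) fun _ => measurable_id)
    iIndepFun_gaussBlock.1 measurable_pi_apply measurable_gaussBlock

theorem map_samplePair (hk : k ≠ 0) (μ : Fin k → E d) (l : ℕ) :
    (tapeLaw μ).map (samplePair l) = (mixture μ).prod (stdGaussian (E d)) := by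
  have := isProbabilityMeasure_mixture hk μ
  have h := Measure.map_prod_map (Measure.infinitePi fun _ : ℕ => mixture μ)
    (Measure.infinitePi fun _ : ℕ => gaussianReal 0 1) (measurable_pi_apply l)
    (measurable_gaussBlock (d := d) l)
  rw [Measure.infinitePi_map_eval, iIndepFun_gaussBlock.2] at h
  exact h.symm

/-! ### Concentration of the statistic -/

/-- The expectation of one term of the statistic. -/
noncomputable def meanTerm (μ : Fin k → E d) (r M2 : ℝ) (x : E d) : ℝ :=
  ∫ p, vecTerm r M2 x p ∂(mixture μ).prod (stdGaussian (E d))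

theorem measurable_meanTerm (hk : k ≠ 0) (μ : Fin k → E d) (r M2 : ℝ) :
    Measurable (meanTerm μ r M2) := by
  have := isProbabilityMeasure_mixture hk μ
  exact ((measurable_vecTerm r M2).stronglyMeasurable.integral_prod_right).measurable

/-- Hoeffding's inequality applied to `Y` and to `-Y`; a variable with values in [-B, B] is
sub-Gaussian with parameter (2B/2)² = B². -/
theorem measure_sum_ge_le_of_bounded {Ω : Type*} [MeasurableSpace Ω] {P : Measure Ω}
    [IsProbabilityMeasure P] {Y : ℕ → Ω → ℝ} (hY : iIndepFun Y P) (mY : ∀ l, Measurable (Y l))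
    {B m : ℝ} (hB : ∀ l ω, |Y l ω| ≤ B) (hm : ∀ l, ∫ ω, Y l ω ∂P = m) (n : ℕ) {s : ℝ}
    (hs : 0 ≤ s) :
    P.real {ω | s ≤ |∑ l ∈ Finset.range n, Y l ω - n * m|} ≤
      2 * Real.exp (-s ^ 2 / (2 * n * B ^ 2)) := by
  have hB0 : 0 ≤ B := by
    obtain ⟨ω⟩ : Nonempty Ω := nonempty_of_isProbabilityMeasure P
    exact (abs_nonneg _).trans (hB 0 ω)
  have hc : (((‖B - -B‖₊ / 2) ^ 2 : NNReal) : ℝ) = B ^ 2 := by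
    push_cast
    rw [Real.norm_eq_abs, sub_neg_eq_add, ← two_mul, abs_of_nonneg (by positivity)]
    ring
  have key : ∀ Y' : ℕ → Ω → ℝ, iIndepFun Y' P → (∀ l, Measurable (Y' l)) →
      (∀ l ω, |Y' l ω| ≤ B) → ∀ m', (∀ l, ∫ ω, Y' l ω ∂P = m') →
      P.real {ω | s ≤ ∑ l ∈ Finset.range n, (Y' l ω - m')} ≤
        Real.exp (-s ^ 2 / (2 * n * B ^ 2)) := by
    intro Y' hY' mY' hB' m' hm'
    rw [← hc]
    refine HasSubgaussianMGF.measure_sum_range_ge_le_of_iIndepFun (X := fun l ω => Y' l ω - m')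
      (hY'.comp (fun _ y => y - m') fun _ => by fun_prop) (fun l _ => ?_) hs
    have := hasSubgaussianMGF_of_mem_Icc (μ := P) (mY' l).aemeasurable
      (Filter.Eventually.of_forall fun ω => abs_le.mp (hB' l ω))
    rwa [hm' l] at this
  have h1 := key Y hY mY hB m hm
  have h2 := key (fun l ω => -Y l ω) (hY.comp (fun _ y => -y) fun _ => by fun_prop)
    (fun l => (mY l).neg) (fun l ω => by simpa using hB l ω) (-m)
    (fun l => by rw [integral_neg, hm l])
  have hsub : {ω | s ≤ |∑ l ∈ Finset.range n, Y l ω - n * m|} ⊆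
      {ω | s ≤ ∑ l ∈ Finset.range n, (Y l ω - m)} ∪
        {ω | s ≤ ∑ l ∈ Finset.range n, (-Y l ω - -m)} := by
    intro ω hω
    simp only [Set.mem_ofPred_eq, Set.mem_union, Finset.sum_sub_distrib, Finset.sum_neg_distrib,
      Finset.sum_const, Finset.card_range, nsmul_eq_mul] at hω ⊢
    rcases le_abs.mp hω with h | h
    · exact Or.inl h
    · exact Or.inr (by linarith)
  calc _ ≤ _ := measureReal_mono hsub
    _ ≤ _ := measureReal_union_le _ _
    _ ≤ _ := by linarith

theorem statSum_coords (ω : Tape d) (r M2 : ℝ) (n : ℕ) (x : E d) :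
    statSum ω r M2 n (coords x) = ∑ l ∈ Finset.range n, vecTerm r M2 x (samplePair l ω) := by
  simp only [statSum, statTerm_coords]
  rfl

theorem measure_stat_at_point_le (hk : k ≠ 0) (μ : Fin k → E d) (r M2 : ℝ) (n : ℕ) {s : ℝ}
    (hs : 0 ≤ s) (x : E d) :
    (tapeLaw μ).real {ω | s ≤ |∑ l ∈ Finset.range n, vecTerm r M2 x (samplePair l ω) -
      n * meanTerm μ r M2 x|} ≤ 2 * Real.exp (-s ^ 2 / (2 * n * Real.exp M2 ^ 2)) := by
  have := isProbabilityMeasure_tapeLaw hk μ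
  refine measure_sum_ge_le_of_bounded (Y := fun l ω => vecTerm r M2 x (samplePair l ω))
    ((iIndepFun_samplePair hk μ).comp (fun _ p => vecTerm r M2 x p)
      fun _ => measurable_vecTerm_right r M2 x)
    (fun l => (measurable_vecTerm_right r M2 x).comp (measurable_samplePair l))
    (fun l ω => abs_vecTerm_le r M2 x _) (fun l => ?_) n hs
  rw [meanTerm, ← map_samplePair hk μ l, integral_map (measurable_samplePair l).aemeasurable
    (measurable_vecTerm_right r M2 x).aestronglyMeasurable]

/-- Carries a deviation bound from fixed points over to a random one: as n ≤ m, sample `m` is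
independent of the pairs in the sum. No net of the space is needed. -/
theorem measure_sum_at_sample_le (hk : k ≠ 0) (μ : Fin k → E d) {f : (E d) → (E d) × (E d) → ℝ}
    (hf : Measurable fun q : (E d) × (E d) × E d => f q.1 q.2) {h : (E d) → ℝ} (hh : Measurable h)
    {n m : ℕ} (hm : n ≤ m) {s : ℝ} (δ : ENNReal)
    (hδ : ∀ x, tapeLaw μ {ω | s ≤ |∑ l ∈ Finset.range n, f x (samplePair l ω) - h x|} ≤ δ) :
    tapeLaw μ {ω | s ≤ |∑ l ∈ Finset.range n, f (ω.1 m) (samplePair l ω) - h (ω.1 m)|} ≤ δ := by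
  have := isProbabilityMeasure_tapeLaw hk μ
  have hind := (iIndepFun_samplePair hk μ).indepFun_finset (Finset.range n) {m}
    (by simpa using hm) measurable_samplePair
  have hind' := hind.comp (φ := id)
    (ψ := fun f : ({m} : Finset ℕ) → (E d) × E d => (f ⟨m, by simp⟩).1) measurable_id
    (by fun_prop)
  set S : Set ((Finset.range n → (E d) × E d) × E d) :=
    {q | s ≤ |∑ l : Finset.range n, f q.2 (q.1 l) - h q.2|} with hS
  have hSm : MeasurableSet S := by
    refine measurableSet_le measurable_const ?_
    have hsum : Measurable fun q : (Finset.range n → (E d) × E d) × E d =>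
        ∑ l : Finset.range n, f q.2 (q.1 l) := by
      refine Finset.measurable_sum _ fun l _ => ?_
      have : Measurable fun q : (Finset.range n → (E d) × E d) × E d => (q.2, q.1 l) := by fun_prop
      exact hf.comp this
    exact (hsum.sub (hh.comp measurable_snd)).norm
  have hset : ∀ (ω : Tape d) (x : E d),
      ((fun l : Finset.range n => samplePair (l : ℕ) ω), x) ∈ S ↔
      s ≤ |∑ l ∈ Finset.range n, f x (samplePair l ω) - h x| := by
    intro ω x
    simp only [hS, Set.mem_ofPred_eq]
    rw [Finset.sum_coe_sort (Finset.range n) fun l => f x (samplePair l ω)]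
  have key := measure_mem_le_of_indepFun hind'
    (measurable_pi_iff.mpr fun l => measurable_samplePair _)
    ((measurable_fst.comp (measurable_pi_apply _)).comp
      (measurable_pi_iff.mpr fun l => measurable_samplePair _)) hSm δ (fun x => ?_)
  · refine le_trans (le_of_eq ?_) key
    congr 1
    ext ω
    exact (hset ω (ω.1 m)).symm
  · refine le_trans (le_of_eq ?_) (hδ x)
    congr 1
    ext ω
    exact hset ω x

theorem measure_stat_at_sample_le (hk : k ≠ 0) (μ : Fin k → E d) (r M2 : ℝ) {n m : ℕ} {s : ℝ}
    (hs : 0 ≤ s) (hm : n ≤ m) :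
    tapeLaw μ {ω | s ≤ |statSum ω r M2 n (coords (ω.1 m)) - n * meanTerm μ r M2 (ω.1 m)|} ≤
      ENNReal.ofReal (2 * Real.exp (-s ^ 2 / (2 * n * Real.exp M2 ^ 2))) := by
  have := isProbabilityMeasure_tapeLaw hk μ
  simp_rw [statSum_coords]
  refine measure_sum_at_sample_le hk μ (measurable_vecTerm r M2)
    (h := fun x => n * meanTerm μ r M2 x) ((measurable_meanTerm hk μ r M2).const_mul _) hm _
    fun x => ?_
  rw [← ofReal_measureReal]
  exact ENNReal.ofReal_le_ofReal (measure_stat_at_point_le hk μ r M2 n hs x)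

/-! ### Hitting all components -/

theorem mixture_far_le (hk : k ≠ 0) (μ : Fin k → E d) (j : Fin k) {ρ : ℝ} (hρ : 0 ≤ ρ)
    (hρ1 : ρ ≤ 1) :
    (mixture μ).real {y | ρ < ‖y - μ j‖} ≤ 1 - (ρ / (3 * d)) ^ d / k := by
  have := isProbabilityMeasure_mixture hk μ
  have hm : MeasurableSet {y : E d | ‖y - μ j‖ ≤ ρ} := measurableSet_le (by fun_prop) (by fun_prop)
  have hc : {y : E d | ρ < ‖y - μ j‖} = {y : E d | ‖y - μ j‖ ≤ ρ}ᶜ := by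
    ext y
    simp
  rw [hc, probReal_compl_eq_one_sub hm]
  have h1 : (k : ℝ)⁻¹ * (multivariateGaussian (μ j) 1).real {y | ‖y - μ j‖ ≤ ρ} ≤
      (mixture μ).real {y | ‖y - μ j‖ ≤ ρ} := by
    rw [mixture, measureReal_ennreal_smul_apply, ENNReal.toReal_inv, ENNReal.toReal_natCast]
    gcongr
    refine ENNReal.toReal_mono (measure_ne_top _ _) ?_
    rw [Measure.finsetSum_apply]
    exact Finset.single_le_sum (f := fun j' => multivariateGaussian (μ j') 1 _)
      (fun _ _ => zero_le) (Finset.mem_univ j)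
  have h2 := multivariateGaussian_closedBall_ge (μ j) hρ hρ1
  have h3 : (ρ / (3 * d)) ^ d / k ≤
      (k : ℝ)⁻¹ * (multivariateGaussian (μ j) 1).real {y | ‖y - μ j‖ ≤ ρ} := by
    rw [div_eq_inv_mul]
    gcongr
  linarith

/-- Each of `T` independent samples misses the ball with probability at most 1 - q ≤ exp(-q), where
q = (ρ/(3d))^d/k. -/
theorem measure_no_hit_le (hk : k ≠ 0) (μ : Fin k → E d) (j : Fin k) {ρ : ℝ} (hρ : 0 ≤ ρ)
    (hρ1 : ρ ≤ 1) (n T : ℕ) :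
    tapeLaw μ {ω | ∀ t < T, ρ < ‖ω.1 (n + t) - μ j‖} ≤
      ENNReal.ofReal (Real.exp (-((ρ / (3 * d)) ^ d / k * T))) := by
  have := isProbabilityMeasure_mixture hk μ
  set A : Set (E d) := {y | ρ < ‖y - μ j‖} with hA
  have hAm : MeasurableSet A := measurableSet_lt (by fun_prop) (by fun_prop)
  have h1 : {ω : Tape d | ∀ t < T, ρ < ‖ω.1 (n + t) - μ j‖} =
      (Set.pi (Finset.Ico n (n + T)) fun _ => A) ×ˢ Set.univ := by
    ext ω
    simp only [Set.mem_ofPred_eq, Set.mem_prod, Set.mem_pi, Finset.coe_Ico, Set.mem_Ico, hA,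
      Set.mem_univ, and_true, and_imp]
    constructor
    · intro h i hi hi'
      have := h (i - n) (by omega)
      rwa [Nat.add_sub_cancel' hi] at this
    · intro h t ht
      exact h (n + t) (by omega) (by omega)
  rw [h1, tapeLaw, Measure.prod_prod, measure_univ, mul_one,
    Measure.infinitePi_pi _ fun _ _ => hAm, Finset.prod_const, Nat.card_Ico,
    Nat.add_sub_cancel_left, ← ofReal_measureReal, ← ENNReal.ofReal_pow measureReal_nonneg]
  refine ENNReal.ofReal_le_ofReal ?_
  have h2 := mixture_far_le hk μ j hρ hρ1
  calc _ ≤ Real.exp (-((ρ / (3 * d)) ^ d / k)) ^ T := by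
        refine pow_le_pow_left₀ measureReal_nonneg (h2.trans ?_) T
        have := Real.add_one_le_exp (-((ρ / (3 * d)) ^ d / k))
        linarith
    _ = _ := by
        rw [← Real.exp_nat_mul]
        congr 1
        ring

end GMM

namespace GMM

/-! ### The probability of success -/

variable {k d : ℕ} {Δ ε : ℝ}

local notation "E" d => EuclideanSpace ℝ (Fin d)

namespace Admissible

theorem one_le_hitPar (h : Admissible k d Δ ε) : 1 ≤ hitPar d ε := by
  have hd := h.one_le_dim
  have he := h.accPar_pos
  have he1 : accPar ε ≤ 1 := min_le_right _ _
  rw [hitPar]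
  refine Real.one_le_exp (mul_nonneg (by positivity) (Real.log_nonneg ?_))
  rw [le_div_iff₀ he]
  linarith

theorem hitPar_eq (h : Admissible k d Δ ε) : (accPar ε / 4 / (3 * d)) ^ d = (hitPar d ε)⁻¹ := by
  have hd := h.one_le_dim
  have he := h.accPar_pos
  rw [hitPar, Real.exp_nat_mul, Real.exp_log (by positivity), ← inv_pow]
  congr 1
  field_simp
  norm_num

theorem one_le_mul_log (h : Admissible k d Δ ε) : 1 ≤ k * Real.log k := by
  have hk := h.two_le'
  have h1 : Real.log 2 ≤ Real.log k := Real.log_le_log (by norm_num) hk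
  nlinarith [Real.log_two_gt_d9]

theorem two_le_candPar (h : Admissible k d Δ ε) (c : ℕ) : 2 ≤ candPar c k d ε := by
  have h1 := h.one_le_mul_log
  have h2 := h.one_le_hitPar
  have h3 : (0 : ℝ) ≤ c := c.cast_nonneg
  rw [candPar]
  calc (2 : ℝ) = 2 * 1 * 1 := by norm_num
    _ ≤ _ := by gcongr; linarith

theorem failPar_ge_one (h : Admissible k d Δ ε) (c : ℕ) : 1 ≤ failPar c k d ε := by
  have h1 := h.two_le_candPar c
  have h2 := h.log_pos
  have h3 : Real.log (Real.exp 1) ≤ Real.log (8 * candPar c k d ε) :=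
    Real.log_le_log (Real.exp_pos _) (by linarith [Real.exp_one_lt_d9])
  rw [Real.log_exp] at h3
  have h4 : 0 ≤ (c : ℝ) * Real.log k := by positivity
  rw [failPar]
  linarith

theorem sizePar_pos (h : Admissible k d Δ ε) (c : ℕ) : 0 < sizePar c k d Δ ε := by
  have h1 := h.failPar_ge_one c
  have h2 := h.gapPar_pos
  have h3 := h.two_le'
  rw [sizePar]
  positivity

/-- The 8 in `failPar` is 2 for rounding up the number of candidates, 2 for the two-sided deviation,
and 2 for using half of the allowed probability. -/
theorem card_mul_exp_neg_failPar_le (h : Admissible k d Δ ε) (c : ℕ) :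
    ⌈candPar c k d ε⌉₊ * (2 * Real.exp (-failPar c k d ε)) ≤ (k : ℝ) ^ (-(c : ℝ)) / 2 := by
  have h1 := h.two_le_candPar c
  have hk : (0 : ℝ) < k := by linarith [h.two_le']
  have h2 := (Nat.ceil_lt_add_one (by linarith : 0 ≤ candPar c k d ε)).le
  have h3 : Real.exp (-failPar c k d ε) = (k : ℝ) ^ (-(c : ℝ)) / (8 * candPar c k d ε) := by
    rw [failPar, neg_add, Real.exp_add, Real.exp_neg (Real.log _), Real.exp_log (by linarith),
      Real.rpow_def_of_pos hk, div_eq_mul_inv]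
    congr 2
    ring
  have h4 : 0 < (k : ℝ) ^ (-(c : ℝ)) := Real.rpow_pos_of_pos hk _
  rw [h3]
  calc _ ≤ 2 * candPar c k d ε * (2 * ((k : ℝ) ^ (-(c : ℝ)) / (8 * candPar c k d ε))) := by
        gcongr
        linarith
    _ = _ := by field_simp; norm_num

/-- Of the exponent c + 2, one power of k pays for the union over the means and one for the factor
1/2. -/
theorem card_mul_exp_neg_hit_le (h : Admissible k d Δ ε) (c : ℕ) :
    k * Real.exp (-((accPar ε / 4 / (3 * d)) ^ d / k * ⌈candPar c k d ε⌉₊)) ≤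
      (k : ℝ) ^ (-(c : ℝ)) / 2 := by
  have hk2 := h.two_le'
  have hk : (0 : ℝ) < k := by linarith
  have hh := h.one_le_hitPar
  have h1 : (c + 2) * Real.log k ≤
      (accPar ε / 4 / (3 * d)) ^ d / k * ⌈candPar c k d ε⌉₊ := by
    rw [h.hitPar_eq]
    calc _ = (hitPar d ε)⁻¹ / k * candPar c k d ε := by
          rw [candPar]
          field_simp
      _ ≤ _ := by
        gcongr
        exact Nat.le_ceil _
  calc _ ≤ k * Real.exp (-((c + 2) * Real.log k)) := by gcongr
    _ = (k : ℝ) ^ (-(c : ℝ)) / k := by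
      rw [show -(((c : ℝ) + 2) * Real.log k) = Real.log k * -c - Real.log k - Real.log k by ring,
        Real.exp_sub, Real.exp_sub, Real.exp_log hk, ← Real.rpow_def_of_pos hk]
      field_simp
    _ ≤ _ := by gcongr

end Admissible

/-- Half the admissible fluctuation of the statistic. -/
noncomputable def fluctPar (c k d : ℕ) (Δ ε : ℝ) : ℝ :=
  ⌈sizePar c k d Δ ε⌉₊ * ((√2)⁻¹ ^ d / k) * gapPar k d Δ ε / 16

namespace Admissible

/-- `sizePar` is chosen for this: the Hoeffding exponent with n terms is n gap²/(512 · 2^d k² exp(2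
`cutPar`)), where 512 = 2 · 16². -/
theorem failPar_le (h : Admissible k d Δ ε) (c : ℕ) : failPar c k d ε ≤
    fluctPar c k d Δ ε ^ 2 /
      (2 * ⌈sizePar c k d Δ ε⌉₊ * Real.exp (cutPar k d Δ ε) ^ 2) := by
  have h1 := h.failPar_ge_one c
  have h2 := h.gapPar_pos
  have h3 := h.two_le'
  have hn : 0 < (⌈sizePar c k d Δ ε⌉₊ : ℝ) := by
    exact_mod_cast Nat.ceil_pos.mpr (h.sizePar_pos c)
  have hn' := Nat.le_ceil (sizePar c k d Δ ε)
  rw [sizePar, div_le_iff₀ (by positivity)] at hn'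
  rw [← sizePar] at hn'
  have e1 : Real.exp (2 * cutPar k d Δ ε) = Real.exp (cutPar k d Δ ε) ^ 2 := by
    rw [← Real.exp_nat_mul]
    norm_num
  have e2 : Real.exp (d * Real.log 2) = 2 ^ d := by
    rw [Real.exp_nat_mul, Real.exp_log (by norm_num)]
  have e3 : (√2)⁻¹ ^ d * (√2)⁻¹ ^ d = (2 ^ d : ℝ)⁻¹ := by
    rw [← mul_pow, ← mul_inv, Real.mul_self_sqrt (by norm_num), inv_pow]
  rw [e1, e2] at hn'
  have e4 : fluctPar c k d Δ ε ^ 2 = ⌈sizePar c k d Δ ε⌉₊ ^ 2 *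
      ((2 ^ d : ℝ)⁻¹ / k ^ 2) * gapPar k d Δ ε ^ 2 / 256 := by
    rw [fluctPar, ← e3]
    ring
  rw [e4, le_div_iff₀ (by positivity)]
  calc _ = failPar c k d ε * 512 * 2 ^ d * Real.exp (cutPar k d Δ ε) ^ 2 * (k * k) *
        (⌈sizePar c k d Δ ε⌉₊ * ((2 ^ d : ℝ)⁻¹ / k ^ 2) / 256) := by
        field_simp
        norm_num
    _ ≤ ⌈sizePar c k d Δ ε⌉₊ * (gapPar k d Δ ε * gapPar k d Δ ε) *
        (⌈sizePar c k d Δ ε⌉₊ * ((2 ^ d : ℝ)⁻¹ / k ^ 2) / 256) := by gcongr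
    _ = _ := by ring

end Admissible

/-- Half of the allowed probability goes to a deviation at some candidate, half to a mean that no
candidate hits. -/
theorem measure_bad_le (h : Admissible k d Δ ε) (c : ℕ) (μ : Fin k → E d) :
    tapeLaw μ {ω | ¬ ((∀ t < ⌈candPar c k d ε⌉₊,
      |statSum ω √(2 * ratePar k d Δ ε) (cutPar k d Δ ε) ⌈sizePar c k d Δ ε⌉₊
          (coords (ω.1 (⌈sizePar c k d Δ ε⌉₊ + t))) - ⌈sizePar c k d Δ ε⌉₊ *
        meanTerm μ √(2 * ratePar k d Δ ε) (cutPar k d Δ ε) (ω.1 (⌈sizePar c k d Δ ε⌉₊ + t))| <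
        fluctPar c k d Δ ε) ∧
      ∀ j, ∃ t < ⌈candPar c k d ε⌉₊, ‖ω.1 (⌈sizePar c k d Δ ε⌉₊ + t) - μ j‖ ≤ accPar ε / 4)} ≤
    ENNReal.ofReal ((k : ℝ) ^ (-(c : ℝ))) := by
  have hk : k ≠ 0 := by have := h.two_le; omega
  have hk0 : (0 : ℝ) ≤ k := k.cast_nonneg
  have hs : 0 ≤ fluctPar c k d Δ ε := by
    have := h.gapPar_pos
    rw [fluctPar]
    positivity
  have he := h.accPar_pos
  have he1 : accPar ε ≤ 1 := min_le_right _ _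
  have hfail := h.failPar_le c
  have hA := h.card_mul_exp_neg_failPar_le c
  have hB := h.card_mul_exp_neg_hit_le c
  set n := ⌈sizePar c k d Δ ε⌉₊
  set T := ⌈candPar c k d ε⌉₊
  set r := √(2 * ratePar k d Δ ε)
  set M2 := cutPar k d Δ ε
  set s := fluctPar c k d Δ ε
  have hsub : {ω : Tape d | ¬ ((∀ t < T, |statSum ω r M2 n (coords (ω.1 (n + t))) -
        n * meanTerm μ r M2 (ω.1 (n + t))| < s) ∧
        ∀ j, ∃ t < T, ‖ω.1 (n + t) - μ j‖ ≤ accPar ε / 4)} ⊆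
      (⋃ t ∈ Finset.range T, {ω | s ≤ |statSum ω r M2 n (coords (ω.1 (n + t))) -
        n * meanTerm μ r M2 (ω.1 (n + t))|}) ∪
      ⋃ j ∈ (Finset.univ : Finset (Fin k)),
        {ω | ∀ t < T, accPar ε / 4 < ‖ω.1 (n + t) - μ j‖} := by
    intro ω hω
    rw [Set.mem_ofPred_eq, not_and_or] at hω
    rcases hω with hω | hω
    · left
      push Not at hω
      obtain ⟨t, ht, hω⟩ := hω
      simp only [Set.mem_iUnion, Finset.mem_range]
      exact ⟨t, ht, hω⟩
    · right
      push Not at hω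
      obtain ⟨j, hω⟩ := hω
      simp only [Set.mem_iUnion, Finset.mem_univ, exists_true_left]
      exact ⟨j, hω⟩
  refine (measure_mono hsub).trans ((measure_union_le _ _).trans ?_)
  have h1 : tapeLaw μ (⋃ t ∈ Finset.range T, {ω : Tape d | s ≤
      |statSum ω r M2 n (coords (ω.1 (n + t))) - n * meanTerm μ r M2 (ω.1 (n + t))|}) ≤
      ENNReal.ofReal ((k : ℝ) ^ (-(c : ℝ)) / 2) := by
    refine (measure_biUnion_finset_le _ _).trans ?_
    refine (Finset.sum_le_sum fun t _ =>
      measure_stat_at_sample_le hk μ r M2 hs (Nat.le_add_right n t)).trans ?_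
    rw [Finset.sum_const, Finset.card_range, nsmul_eq_mul, ← ENNReal.ofReal_natCast,
      ← ENNReal.ofReal_mul T.cast_nonneg]
    refine ENNReal.ofReal_le_ofReal (le_trans ?_ hA)
    gcongr
    rw [neg_div]
    exact neg_le_neg hfail
  have h2 : tapeLaw μ (⋃ j ∈ (Finset.univ : Finset (Fin k)),
      {ω : Tape d | ∀ t < T, accPar ε / 4 < ‖ω.1 (n + t) - μ j‖}) ≤
      ENNReal.ofReal ((k : ℝ) ^ (-(c : ℝ)) / 2) := by
    refine (measure_biUnion_finset_le _ _).trans ?_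
    refine (Finset.sum_le_sum fun j _ =>
      measure_no_hit_le hk μ j (by positivity) (by linarith) n T).trans ?_
    rw [Finset.sum_const, Finset.card_univ, Fintype.card_fin, nsmul_eq_mul,
      ← ENNReal.ofReal_natCast, ← ENNReal.ofReal_mul hk0]
    exact ENNReal.ofReal_le_ofReal hB
  refine (add_le_add h1 h2).trans ?_
  have h0 : 0 ≤ (k : ℝ) ^ (-(c : ℝ)) := Real.rpow_nonneg hk0 _
  rw [← ENNReal.ofReal_add (by positivity) (by positivity), add_halves]

/-- Off the bad event the normalised statistic errs by less than gap/16. It exceeds 1 - 5gap/32 near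
a mean and is below 1 - 3gap/8 far from all means; the threshold 1 - gap/4 lies in between. -/
theorem mainProg_correct (h : Admissible k d Δ ε) (c : ℕ) {μ : Fin k → E d}
    (hμ : Separated Δ μ) :
    tapeLaw μ {ω | ¬ ∃ t s, HaltsIn (mainProg c) ω (input k d Δ ε) t s ∧
      EpsClose ε (output k d s) μ} ≤ ENNReal.ofReal ((k : ℝ) ^ (-(c : ℝ))) := by
  -- Monotonicity suffices, so measurability of the event of success is not an issue.
  refine (measure_mono fun ω hω => ?_).trans (measure_bad_le h c μ)
  contrapose hω
  rw [Set.mem_ofPred_eq, not_not] at hω ⊢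
  obtain ⟨hstat, hhit⟩ := hω
  obtain ⟨t, s, hts, -, -, hs⟩ := (mainProg_run c k d Δ ε ω).haltsIn
  refine ⟨t, s, hts, ?_⟩
  have hk : k ≠ 0 := by have := h.two_le; omega
  have hk0 : (0 : ℝ) < k := by linarith [h.two_le']
  have hg := h.gapPar_pos
  have hn : 0 < (⌈sizePar c k d Δ ε⌉₊ : ℝ) := by
    exact_mod_cast Nat.ceil_pos.mpr (h.sizePar_pos c)
  have hthr : threshold c k d Δ ε = ⌈sizePar c k d Δ ε⌉₊ * ((√2)⁻¹ ^ d / k) *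
      (1 - gapPar k d Δ ε / 4) := by
    have e2 : √(Real.exp (d * Real.log 2)) = √2 ^ d := by
      rw [Real.exp_nat_mul, Real.exp_log (by norm_num), Real.sqrt_eq_iff_mul_self_eq
        (by positivity) (by positivity), ← mul_pow, Real.mul_self_sqrt (by norm_num)]
    rw [threshold, e2, inv_pow]
    field_simp
  have hq : 0 < ⌈sizePar c k d Δ ε⌉₊ * ((√2)⁻¹ ^ d / k) := by positivity
  refine epsClose_of_selected h.accPar_pos (min_le_left _ _) h.accPar_lt hμ
    (threshold c k d Δ ε) _ (fun t => ω.1 (⌈sizePar c k d Δ ε⌉₊ + t)) ⌈candPar c k d ε⌉₊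
    (fun t ht hfar => ?_) (fun t ht j hj => ?_) hhit s hs
  · have h1 := (abs_lt.mp (hstat t ht)).2
    have h2 := kernelSum_le_of_far h hμ hfar
    rw [meanTerm, integral_vecTerm_mixture hk, fluctPar] at h1
    rw [hthr]
    nlinarith [mul_le_mul_of_nonneg_left h2 hq.le, mul_pos hq hg]
  · have h1 := (abs_lt.mp (hstat t ht)).1
    have h2 := kernelSum_ge_of_near h hμ hj
    rw [meanTerm, integral_vecTerm_mixture hk, fluctPar] at h1
    rw [hthr]
    nlinarith [mul_le_mul_of_nonneg_left h2 hq.le, mul_pos hq hg]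

end GMM

namespace GMM

/-! ### The running time -/

theorem totalCost_le {n T d : ℕ} (hn : 1 ≤ n) (hT : 1 ≤ T) (hd : 1 ≤ d) :
    totalCost n T d ≤ 100 * d * (n * T + T * T) := by
  obtain ⟨n, rfl⟩ := Nat.exists_eq_add_of_le hn
  obtain ⟨T, rfl⟩ := Nat.exists_eq_add_of_le hT
  obtain ⟨d, rfl⟩ := Nat.exists_eq_add_of_le hd
  rw [totalCost, roundCost]
  ring_nf
  nlinarith [Nat.zero_le (n * T * d), Nat.zero_le (T ^ 2 * d), Nat.zero_le (n * T),
    Nat.zero_le (n * d), Nat.zero_le (T * d), Nat.zero_le (T ^ 2)]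

theorem add_le_totalCost (n T d : ℕ) : n + T ≤ totalCost n T d := by
  rw [totalCost, roundCost]
  nlinarith [Nat.zero_le (n * d), Nat.zero_le (T * (n * (d * 14 + 15) + T * (d * 8 + 11) + d * 6))]

theorem one_le_log_two_add {d : ℕ} (hd : 1 ≤ d) : 1 ≤ Real.log (2 + d) := by
  have hd1 : (1 : ℝ) ≤ d := by exact_mod_cast hd
  rw [Real.le_log_iff_exp_le (by linarith)]
  linarith [Real.exp_one_lt_d9]

namespace Admissible

variable {k d : ℕ} {Δ ε : ℝ}

theorem half_le_log (h : Admissible k d Δ ε) : 1 / 2 ≤ Real.log k := by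
  have h1 : Real.log 2 ≤ Real.log k := Real.log_le_log (by norm_num) h.two_le'
  linarith [Real.log_two_gt_d9]

/-- The crude log x ≤ x is enough, because a further factor `hitPar` disappears in the dimension
factor of the time bound. -/
theorem failPar_le_mul (h : Admissible k d Δ ε) (c : ℕ) :
    failPar c k d ε ≤ 20 * (c + 2) * Real.log k * hitPar d ε := by
  have hk := h.two_le'
  have hl := h.half_le_log
  have hH := h.one_le_hitPar
  have hc : (0 : ℝ) ≤ c := c.cast_nonneg
  have h1 : Real.log (8 * candPar c k d ε) =
      Real.log (8 * (c + 2)) + (Real.log k + Real.log (Real.log k)) + Real.log (hitPar d ε) := by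
    rw [candPar, ← mul_assoc, ← mul_assoc, Real.log_mul (by positivity) (by positivity),
      Real.log_mul (by positivity) (by positivity),
      Real.log_mul (x := (k : ℝ)) (by positivity) (by positivity)]
  have h2 := Real.log_le_self (show (0 : ℝ) ≤ 8 * (c + 2) by positivity)
  have h3 := Real.log_le_self h.log_pos.le
  have h4 := Real.log_le_self (show 0 ≤ hitPar d ε by linarith)
  have h5 : 8 * ((c : ℝ) + 2) ≤ 16 * (c + 2) * Real.log k := by nlinarith
  have h6 : hitPar d ε ≤ 2 * Real.log k * hitPar d ε := by nlinarith
  have h7 : (c + 2 + 16 * (c + 2)) * Real.log k ≤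
      (c + 2 + 16 * (c + 2)) * Real.log k * hitPar d ε :=
    le_mul_of_one_le_right (by positivity) hH
  have h8 : 0 ≤ Real.log k * hitPar d ε := by positivity
  rw [failPar, h1]
  nlinarith

theorem card_cand_le (h : Admissible k d Δ ε) (c : ℕ) :
    (⌈candPar c k d ε⌉₊ : ℝ) ≤ 2 * (c + 2) * k * Real.log k * hitPar d ε := by
  have h1 := h.two_le_candPar c
  have h2 := (Nat.ceil_lt_add_one (by linarith : 0 ≤ candPar c k d ε)).le
  have h3 : candPar c k d ε + 1 ≤ 2 * candPar c k d ε := by linarith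
  refine (h2.trans h3).trans (le_of_eq ?_)
  rw [candPar]
  ring

theorem accPar_le_one : accPar ε ≤ 1 := min_le_right _ _

/-- Only the window part e²/4 of the gap is used. The resulting power of 1/e is absorbed later,
since d ≥ 1. -/
theorem sizePar_le (h : Admissible k d Δ ε) (c : ℕ) : sizePar c k d Δ ε ≤
    163840 * (c + 2) * k ^ 2 * Real.log k * hitPar d ε * Real.exp (d * Real.log 2) *
      Real.exp (2 * cutPar k d Δ ε) / accPar ε ^ 4 := by
  have he := h.accPar_pos
  have hk := h.two_le'
  have hg := h.gapPar_ge_sq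
  have hl := h.log_pos
  have hH := h.one_le_hitPar
  have hg' : accPar ε ^ 4 / 16 ≤ gapPar k d Δ ε * gapPar k d Δ ε := by
    calc _ = accPar ε ^ 2 / 4 * (accPar ε ^ 2 / 4) := by ring
      _ ≤ _ := mul_le_mul hg hg (by positivity) h.gapPar_pos.le
  rw [sizePar]
  calc _ ≤ 20 * (c + 2) * Real.log k * hitPar d ε * 512 * Real.exp (d * Real.log 2) *
        Real.exp (2 * cutPar k d Δ ε) * (k * k) / (accPar ε ^ 4 / 16) := by
        gcongr
        exact h.failPar_le_mul c
    _ = _ := by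
      field_simp
      ring

theorem card_size_le (h : Admissible k d Δ ε) (c : ℕ) : (⌈sizePar c k d Δ ε⌉₊ : ℝ) ≤
    327680 * (c + 2) * k ^ 2 * Real.log k * hitPar d ε * Real.exp (d * Real.log 2) *
      Real.exp (2 * cutPar k d Δ ε) / accPar ε ^ 4 := by
  have h1 : 1 ≤ sizePar c k d Δ ε := by
    have hg := h.gapPar_pos
    have hg1 := h.gapPar_le_one
    have hf := h.failPar_ge_one c
    have hk := h.two_le'
    have hM : 0 ≤ cutPar k d Δ ε := by
      have h1 := h.ratePar_pos
      have h2 := h.logPar_le_windowPar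
      have h3 := h.four_le_logPar
      rw [cutPar]
      have : 0 ≤ windowPar k d Δ ε := by linarith
      positivity
    rw [sizePar, le_div_iff₀ (by positivity)]
    calc 1 * (gapPar k d Δ ε * gapPar k d Δ ε) ≤ 1 * (1 * 1) := by gcongr
      _ ≤ 1 * 512 * 1 * 1 * (1 * 1) := by norm_num
      _ ≤ _ := by
        gcongr
        · exact Real.one_le_exp (by positivity)
        · exact Real.one_le_exp (by positivity)
        · linarith
        · linarith
  have h2 := (Nat.ceil_lt_add_one (by linarith : 0 ≤ sizePar c k d Δ ε)).le
  have h3 := h.sizePar_le c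
  refine h2.trans ((by linarith : _ ≤ 2 * sizePar c k d Δ ε).trans
    ((mul_le_mul_of_nonneg_left h3 (by norm_num)).trans (le_of_eq ?_)))
  ring

theorem log_inv_accPar_nonneg (h : Admissible k d Δ ε) : 0 ≤ Real.log (accPar ε)⁻¹ :=
  Real.log_nonneg ((one_le_inv₀ h.accPar_pos).mpr accPar_le_one)

theorem freqSq_nonneg (h : Admissible k d Δ ε) : 0 ≤ freqSq k d Δ ε := by
  have h1 := h.min_pos
  have h2 := h.window_min_pos
  have h3 : 0 ≤ Real.log (Δ / ε) := by
    have : ε < Δ / 100 := h.acc_lt.trans_le (min_le_left _ _)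
    refine Real.log_nonneg ?_
    rw [le_div_iff₀ h.acc_pos]
    linarith [h.acc_pos]
  rw [← sq] at h2
  have := h.sep_pos
  rw [freqSq]
  positivity

/-- For ε ≤ 1, `cutPar` is exactly 640 M². For ε > 1 the algorithm aims at accuracy 1, so log Δ
replaces log(Δ/ε); then Δ > 100 and log ε ≤ log Δ ≤ Δ, and after division by Δ² the excess is at
most 4d log(2 + d). -/
theorem cutPar_le (h : Admissible k d Δ ε) :
    cutPar k d Δ ε ≤ 640 * freqSq k d Δ ε + 2560 * (d * Real.log (2 + d)) := by
  have hd := h.one_le_dim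
  have hΔ := h.sep_pos
  have hu := one_le_log_two_add h.dim_pos
  have hcut : cutPar k d Δ ε = 640 * (packPar k d Δ ε * windowPar k d Δ ε / Δ ^ 2) := by
    rw [cutPar, ratePar]
    field_simp
    ring
  rcases le_total ε 1 with hε | hε
  · have he : accPar ε = ε := min_eq_left hε
    have : cutPar k d Δ ε = 640 * freqSq k d Δ ε := by
      rw [hcut, packPar, windowPar, logPar, he, freqSq, ← sq]
      ring
    rw [this]
    have : 0 ≤ d * Real.log (2 + d) := by positivity
    linarith
  · have he : accPar ε = 1 := min_eq_right hε
    have hΔε : ε < Δ / 100 := h.acc_lt.trans_le (min_le_left _ _)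
    have hm := h.min_pos
    have hw := h.window_min_pos
    have hF : freqSq k d Δ ε = (min (d : ℝ) (Real.log k) + Real.log (Δ / ε)) *
        (min (d + Real.log k) (d * Real.log (2 + d / (Δ * Δ))) + Real.log (Δ / ε)) / Δ ^ 2 := by
      rw [freqSq, ← sq]
      ring
    have hmd : min (d : ℝ) (Real.log k) ≤ d := min_le_left _ _
    have hwd : min (d + Real.log k) (d * Real.log (2 + d / (Δ * Δ))) ≤ d * Real.log (2 + d) := by
      refine (min_le_right _ _).trans ?_
      have : (d : ℝ) / (Δ * Δ) ≤ d := div_le_self (by positivity) (by nlinarith)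
      gcongr
    have hlog : Real.log (Δ / ε) = Real.log Δ - Real.log ε :=
      Real.log_div hΔ.ne' h.acc_pos.ne'
    have hlogε : 0 ≤ Real.log ε := Real.log_nonneg hε
    have hlogε' : Real.log ε ≤ Real.log Δ := Real.log_le_log h.acc_pos (by linarith)
    have hlogΔ : Real.log Δ ≤ Δ := Real.log_le_self hΔ.le
    have hdu : (d : ℝ) ≤ d * Real.log (2 + d) := le_mul_of_one_le_right (by positivity) hu
    rw [hcut, packPar, windowPar, logPar, he, div_one, hF, hlog]
    set m := min (d : ℝ) (Real.log k)
    set w := min (d + Real.log k) (d * Real.log (2 + d / (Δ * Δ)))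
    set U := d * Real.log (2 + d)
    have hU : 1 ≤ U := hd.trans hdu
    have key : (m + Real.log Δ) * (w + Real.log Δ) ≤
        (m + (Real.log Δ - Real.log ε)) * (w + (Real.log Δ - Real.log ε)) + 4 * U * Δ ^ 2 := by
      have h1 : Real.log ε * (m + w) ≤ Δ * (2 * U) := by
        apply mul_le_mul <;> linarith
      have h2 : Δ * (2 * U) ≤ Δ ^ 2 * (2 * U) := by
        gcongr
        nlinarith
      have h3 : Real.log ε * Real.log Δ ≤ Δ * Δ := by apply mul_le_mul <;> linarith
      have h4 : Δ ^ 2 * 2 ≤ Δ ^ 2 * (2 * U) := by gcongr; linarith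
      nlinarith [sq_nonneg (Real.log ε)]
    have h5 : (m + Real.log Δ) * (w + Real.log Δ) / Δ ^ 2 ≤
        (m + (Real.log Δ - Real.log ε)) * (w + (Real.log Δ - Real.log ε)) / Δ ^ 2 + 4 * U := by
      rw [div_add' _ _ _ (by positivity)]
      gcongr
    linarith

theorem totalCost_le_exp (h : Admissible k d Δ ε) (c : ℕ) :
    (totalCost ⌈sizePar c k d Δ ε⌉₊ ⌈candPar c k d ε⌉₊ d : ℝ) ≤
      131072000 * (c + 2) ^ 2 * (k ^ 3 * Real.log k ^ 2) * Real.exp (5130 * (d * Real.log (2 + d)) +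
        6 * (d * Real.log (accPar ε)⁻¹) + 1280 * freqSq k d Δ ε) := by
  have he := h.accPar_pos
  have he1 : accPar ε ≤ 1 := accPar_le_one
  have hd := h.one_le_dim
  have hk := h.two_le'
  have hl := h.log_pos
  have hH := h.one_le_hitPar
  have hv := h.log_inv_accPar_nonneg
  have hcut := h.cutPar_le
  have hM : 0 ≤ cutPar k d Δ ε := by
    have h1 := h.ratePar_pos
    have h2 := h.logPar_le_windowPar
    have h3 := h.four_le_logPar
    rw [cutPar]
    have : 0 ≤ windowPar k d Δ ε := by linarith
    positivity
  have hT := h.card_cand_le c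
  have hn := h.card_size_le c
  have hT0 : 1 ≤ ⌈candPar c k d ε⌉₊ := Nat.ceil_pos.mpr (by linarith [h.two_le_candPar c])
  have hn0 : 1 ≤ ⌈sizePar c k d Δ ε⌉₊ := Nat.ceil_pos.mpr (h.sizePar_pos c)
  have hcost : (totalCost ⌈sizePar c k d Δ ε⌉₊ ⌈candPar c k d ε⌉₊ d : ℝ) ≤
      100 * d * (⌈sizePar c k d Δ ε⌉₊ * ⌈candPar c k d ε⌉₊ +
        ⌈candPar c k d ε⌉₊ * ⌈candPar c k d ε⌉₊) := by
    exact_mod_cast totalCost_le hn0 hT0 h.dim_pos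
  -- Since W ≥ 1, the bound for n also bounds T, so nT + T² is at most a single product.
  set W := Real.exp (d * Real.log 2) * Real.exp (2 * cutPar k d Δ ε) / accPar ε ^ 4 with hW
  have hW1 : 1 ≤ W := by
    rw [hW, le_div_iff₀ (by positivity), one_mul]
    calc accPar ε ^ 4 ≤ 1 := pow_le_one₀ he.le he1
      _ = 1 * 1 := by norm_num
      _ ≤ _ := by
        gcongr
        · exact Real.one_le_exp (by positivity)
        · exact Real.one_le_exp (by positivity)
  have hn' : (⌈sizePar c k d Δ ε⌉₊ : ℝ) ≤
      327680 * (c + 2) * k ^ 2 * Real.log k * hitPar d ε * W := by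
    refine hn.trans (le_of_eq ?_)
    rw [hW]
    ring
  have hT' : (⌈candPar c k d ε⌉₊ : ℝ) ≤
      327680 * (c + 2) * k ^ 2 * Real.log k * hitPar d ε * W := by
    refine hT.trans ?_
    calc _ = 2 * (c + 2) * (k * 1) * Real.log k * hitPar d ε * 1 := by ring
      _ ≤ 327680 * (c + 2) * (k * k) * Real.log k * hitPar d ε * W := by
        gcongr
        · norm_num
        · linarith
      _ = _ := by ring
  -- The coefficients are 5130 = 1 + 2 · 4 + 1 + 2 · 2560, 6 = 2 + 4 and 1280 = 2 · 640.
  have hexp : d * hitPar d ε ^ 2 * W ≤ Real.exp (5130 * (d * Real.log (2 + d)) +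
        6 * (d * Real.log (accPar ε)⁻¹) + 1280 * freqSq k d Δ ε) := by
    have hu := one_le_log_two_add h.dim_pos
    have h1 : (d : ℝ) ≤ Real.exp (d * Real.log (2 + d)) := by
      calc (d : ℝ) ≤ 2 + d := by linarith
        _ = Real.exp (Real.log (2 + d)) := (Real.exp_log (by positivity)).symm
        _ ≤ _ := by
          gcongr
          exact le_mul_of_one_le_left (by linarith) hd
    have h2 : hitPar d ε ≤ Real.exp (d * (4 * Real.log (2 + d) + Real.log (accPar ε)⁻¹)) := by
      rw [hitPar]
      gcongr
      have h12 : Real.log 12 ≤ 3 * Real.log (2 + d) := by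
        calc Real.log 12 ≤ Real.log ((2 + d) ^ 3) := by
              refine Real.log_le_log (by norm_num) ?_
              calc (12 : ℝ) ≤ 3 ^ 3 := by norm_num
                _ ≤ (2 + d) ^ 3 := by gcongr; linarith
          _ = _ := by rw [Real.log_pow]; norm_num
      have hld : Real.log d ≤ Real.log (2 + d) := Real.log_le_log (by linarith) (by linarith)
      rw [div_eq_mul_inv, Real.log_mul (by positivity) (by positivity),
        Real.log_mul (by norm_num) (by positivity)]
      linarith
    have h3 : Real.exp (d * Real.log 2) ≤ Real.exp (d * Real.log (2 + d)) := by
      gcongr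
      linarith
    have h4 : (accPar ε ^ 4)⁻¹ ≤ Real.exp (4 * (d * Real.log (accPar ε)⁻¹)) := by
      calc _ = Real.exp (4 * Real.log (accPar ε)⁻¹) := by
            rw [show (4 : ℝ) = (4 : ℕ) by norm_num, Real.exp_nat_mul,
              Real.exp_log (by positivity), inv_pow]
        _ ≤ _ := by
          gcongr
          exact le_mul_of_one_le_left hv hd
    rw [hW, div_eq_mul_inv]
    calc _ ≤ Real.exp (d * Real.log (2 + d)) *
          Real.exp (d * (4 * Real.log (2 + d) + Real.log (accPar ε)⁻¹)) ^ 2 *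
          (Real.exp (d * Real.log (2 + d)) *
            Real.exp (2 * (640 * freqSq k d Δ ε + 2560 * (d * Real.log (2 + d)))) *
            Real.exp (4 * (d * Real.log (accPar ε)⁻¹))) := by gcongr
      _ = _ := by
        rw [← Real.exp_nat_mul, ← Real.exp_add, ← Real.exp_add, ← Real.exp_add, ← Real.exp_add]
        congr 1
        push_cast
        ring
  calc _ ≤ _ := hcost
    _ = 100 * d * ⌈candPar c k d ε⌉₊ * (⌈sizePar c k d Δ ε⌉₊ + ⌈candPar c k d ε⌉₊) := by ring
    _ ≤ 100 * d * (2 * (c + 2) * k * Real.log k * hitPar d ε) *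
        (327680 * (c + 2) * k ^ 2 * Real.log k * hitPar d ε * W +
          327680 * (c + 2) * k ^ 2 * Real.log k * hitPar d ε * W) := by gcongr
    _ = 131072000 * (c + 2) ^ 2 * (k ^ 3 * Real.log k ^ 2) * (d * hitPar d ε ^ 2 * W) := by ring
    _ ≤ _ := by gcongr

end Admissible

theorem mainProg_runsWithin {k d : ℕ} {Δ ε B : ℝ} (c : ℕ)
    (hB : (totalCost ⌈sizePar c k d Δ ε⌉₊ ⌈candPar c k d ε⌉₊ d : ℝ) ≤ B) :
    RunsWithin (mainProg c) k d Δ ε B := by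
  intro ω
  obtain ⟨t, s, hts, ht, hs, -⟩ := (mainProg_run c k d Δ ε ω).haltsIn
  refine ⟨t, s, hts, le_trans (by exact_mod_cast ht) hB, le_trans ?_ hB⟩
  rw [hs]
  exact_mod_cast add_le_totalCost _ _ _

/-- For d ≥ 2 one has 2 + d ≤ d². At d = 1 the exponent d log d vanishes, so the prefactor has to
absorb 3^K. -/
theorem exists_exp_log_two_add_le {K : ℝ} (hK : 0 ≤ K) : ∃ A : ℝ, 1 ≤ A ∧ ∀ d : ℕ, 1 ≤ d →
    Real.exp (K * (d * Real.log (2 + d))) ≤ A * Real.exp (A * (d * Real.log d)) := by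
  have hA : 2 * K + 1 ≤ Real.exp (2 * K) := Real.add_one_le_exp _
  refine ⟨Real.exp (2 * K), by linarith, fun d hd => ?_⟩
  rcases hd.eq_or_lt with rfl | hd
  · have h3 : Real.log 3 ≤ 2 := by
      have := Real.log_le_sub_one_of_pos (show (0 : ℝ) < 3 by norm_num)
      linarith
    have : (2 : ℝ) + 1 = 3 := by norm_num
    simp only [Nat.cast_one, Real.log_one, one_mul, mul_zero, Real.exp_zero, mul_one, this]
    rw [Real.exp_le_exp]
    linarith [mul_le_mul_of_nonneg_left h3 hK]
  · have hd2 : (2 : ℝ) ≤ d := by exact_mod_cast hd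
    have h1 : Real.log (2 + d) ≤ 2 * Real.log d := by
      calc Real.log (2 + d) ≤ Real.log (d ^ 2) := Real.log_le_log (by linarith) (by nlinarith)
        _ = _ := by rw [Real.log_pow]; norm_num
    have h2 : 0 ≤ d * Real.log d := mul_nonneg (by linarith) (Real.log_nonneg (by linarith))
    calc _ ≤ 1 * Real.exp (2 * K * (d * Real.log d)) := by
          rw [one_mul, Real.exp_le_exp]
          linarith [mul_le_mul_of_nonneg_left h1 (by positivity : 0 ≤ K * d)]
      _ ≤ _ := by
        gcongr
        · exact Real.one_le_exp (by positivity)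
        · linarith

/-- The same C has to serve as prefactor and in every exponent, so the largest constant is taken.
The factor (Δ/ε)⁴ enters only through being at least 1. -/
theorem exists_totalCost_le_timeBound (c : ℕ) : ∃ C : ℝ, 0 < C ∧
    ∀ (k d : ℕ) (Δ ε : ℝ), Admissible k d Δ ε →
      (totalCost ⌈sizePar c k d Δ ε⌉₊ ⌈candPar c k d ε⌉₊ d : ℝ) ≤ timeBound C k d Δ ε := by
  obtain ⟨A, hA1, hA⟩ := exists_exp_log_two_add_le (show (0 : ℝ) ≤ 5130 by norm_num)
  refine ⟨131072000 * (c + 2) ^ 2 * A, by positivity, fun k d Δ ε h => ?_⟩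
  have hc : (1 : ℝ) ≤ (c + 2) ^ 2 := by nlinarith [(c.cast_nonneg : (0 : ℝ) ≤ c)]
  have hCA : A ≤ 131072000 * ((c : ℝ) + 2) ^ 2 * A := by nlinarith
  have hC : 131072000 ≤ 131072000 * ((c : ℝ) + 2) ^ 2 * A := by nlinarith
  have he := h.accPar_pos
  have hd := h.one_le_dim
  have hv := h.log_inv_accPar_nonneg
  have hF := h.freqSq_nonneg
  have hld : 0 ≤ Real.log d := Real.log_nonneg hd
  have hΔε : 1 ≤ (Δ / ε) ^ 4 := by
    refine one_le_pow₀ ?_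
    rw [le_div_iff₀ h.acc_pos]
    linarith [h.acc_pos, h.acc_lt.trans_le (min_le_left _ _)]
  have hX : 0 ≤ (k : ℝ) ^ 3 * Real.log k ^ 2 := by positivity
  have h1 : Real.exp (5130 * (d * Real.log (2 + d)) + 6 * (d * Real.log (accPar ε)⁻¹) +
      1280 * freqSq k d Δ ε) ≤ A * (Real.exp (A * (d * Real.log d)) *
      Real.exp (6 * (d * Real.log (accPar ε)⁻¹)) * Real.exp (1280 * freqSq k d Δ ε)) := by
    rw [Real.exp_add, Real.exp_add]
    calc _ ≤ A * Real.exp (A * (d * Real.log d)) * Real.exp (6 * (d * Real.log (accPar ε)⁻¹)) *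
          Real.exp (1280 * freqSq k d Δ ε) := by
          gcongr
          exact hA d h.dim_pos
      _ = _ := by ring
  -- The left side is (d/e)^(Cd), which is one of the two entries of the maximum because e = min(ε,
  -- 1).
  have h2 : ∀ C : ℝ, 0 ≤ C → Real.exp (C * (d * Real.log d)) *
      Real.exp (C * (d * Real.log (accPar ε)⁻¹)) ≤
      max (((d : ℝ) / ε) ^ (C * d)) ((d : ℝ) ^ (C * d)) := by
    intro C hC0
    have h3 : Real.exp (C * (d * Real.log d)) * Real.exp (C * (d * Real.log (accPar ε)⁻¹)) =
        ((d : ℝ) / accPar ε) ^ (C * d) := by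
      rw [Real.rpow_def_of_pos (by positivity), div_eq_mul_inv,
        Real.log_mul (by positivity) (by positivity), ← Real.exp_add]
      congr 1
      ring
    rw [h3]
    rcases le_total ε 1 with hε | hε
    · rw [accPar, min_eq_left hε]
      exact le_max_left _ _
    · rw [accPar, min_eq_right hε, div_one]
      exact le_max_right _ _
  rw [timeBound]
  calc _ ≤ _ := h.totalCost_le_exp c
    _ ≤ 131072000 * (c + 2) ^ 2 * (k ^ 3 * Real.log k ^ 2) * (A * (Real.exp (A * (d * Real.log d)) *
        Real.exp (6 * (d * Real.log (accPar ε)⁻¹)) * Real.exp (1280 * freqSq k d Δ ε))) := by gcongr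
    _ = 131072000 * (c + 2) ^ 2 * A * (1 * (k ^ 3 * Real.log k ^ 2)) *
        (Real.exp (A * (d * Real.log d)) * Real.exp (6 * (d * Real.log (accPar ε)⁻¹))) *
        Real.exp (1280 * freqSq k d Δ ε) := by ring
    _ ≤ 131072000 * (c + 2) ^ 2 * A * ((Δ / ε) ^ 4 * (k ^ 3 * Real.log k ^ 2)) *
        (Real.exp (131072000 * (c + 2) ^ 2 * A * (d * Real.log d)) *
          Real.exp (131072000 * (c + 2) ^ 2 * A * (d * Real.log (accPar ε)⁻¹))) *
        Real.exp (131072000 * (c + 2) ^ 2 * A * freqSq k d Δ ε) := by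
      gcongr <;> linarith
    _ ≤ _ := by
      rw [mul_assoc ((Δ / ε) ^ 4)]
      gcongr
      exact h2 _ (by linarith)

end GMM

namespace GMM

/-! ### Low dimension and nearly critical separation -/

section LowDimension

variable {k d : ℕ} {Δ ε A a b : ℝ}

/-- log(2 + d) is O(log log k), which cancels the denominator in the bound on d. -/
theorem dim_mul_log_two_add_le (h : Admissible k d Δ ε) (hA : 0 < A)
    (hl : 1 ≤ Real.log k) (hll : 1 ≤ Real.log (Real.log k))
    (hdA : (d : ℝ) ≤ A * (Real.log k / Real.log (Real.log k))) :
    d * Real.log (2 + d) ≤ A * (3 * A + 1) * Real.log k := by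
  have hd := h.one_le_dim
  have hdl : (d : ℝ) ≤ A * Real.log k :=
    hdA.trans (mul_le_mul_of_nonneg_left (div_le_self (by linarith) hll) hA.le)
  have h1 : Real.log (2 + d) ≤ (3 * A + 1) * Real.log (Real.log k) := by
    calc Real.log (2 + d) ≤ Real.log (3 * A * Real.log k) :=
          Real.log_le_log (by linarith) (by linarith)
      _ = Real.log (3 * A) + Real.log (Real.log k) := Real.log_mul (by positivity) (by positivity)
      _ ≤ 3 * A + Real.log (Real.log k) := by
        gcongr
        exact Real.log_le_self (by positivity)
      _ ≤ _ := by nlinarith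
  calc _ ≤ A * (Real.log k / Real.log (Real.log k)) *
        ((3 * A + 1) * Real.log (Real.log k)) :=
        mul_le_mul hdA h1 (Real.log_nonneg (by linarith)) (by positivity)
    _ = _ := by field_simp

/-- The bound on d gives (log k)/d ≥ (log log k)/A ≥ 3 > exp(1). -/
theorem one_le_log_log_div (h : Admissible k d Δ ε) (hA : 0 < A)
    (hll : max 1 (3 * A) ≤ Real.log (Real.log k))
    (hdA : (d : ℝ) ≤ A * (Real.log k / Real.log (Real.log k))) :
    1 ≤ Real.log (Real.log k / d) := by
  have hd := h.one_le_dim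
  have hl := h.log_pos
  have h1 : 3 * A ≤ Real.log (Real.log k) := (le_max_right _ _).trans hll
  have h2 : 3 ≤ Real.log k / d := by
    rw [le_div_iff₀ (by positivity)]
    rw [← mul_div_assoc, le_div_iff₀ (by linarith)] at hdA
    have h3 : (d : ℝ) * (3 * A) ≤ A * Real.log k := 
      (mul_le_mul_of_nonneg_left h1 (by positivity)).trans hdA
    nlinarith
  rw [Real.le_log_iff_exp_le (by linarith)]
  linarith [Real.exp_one_lt_d9]

/-- For ε ≤ 1 the upper and lower bounds on Δ combine to 1/ε ≤ (b/a) log k, so log(1/e) is O(log log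
k), and the bound on d applies as before. -/
theorem dim_mul_log_inv_accPar_le (h : Admissible k d Δ ε) (hA : 0 < A) (ha : 0 < a) (hb : 0 < b)
    (hl : 1 ≤ Real.log k) (hll : 1 ≤ Real.log (Real.log k))
    (hL : 1 ≤ Real.log (Real.log k / d))
    (hdA : (d : ℝ) ≤ A * (Real.log k / Real.log (Real.log k)))
    (hΔ : a * (d / √(Real.log k) * √(Real.log (Real.log k / d))) ≤ Δ)
    (hε : Δ / ε ≤ b * √d) :
    d * Real.log (accPar ε)⁻¹ ≤ A * (b / a + 1) * Real.log k := by
  have hd := h.one_le_dim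
  have h1 : Real.log (accPar ε)⁻¹ ≤ (b / a + 1) * Real.log (Real.log k) := by
    rcases le_total 1 ε with hε1 | hε1
    · rw [accPar, min_eq_right hε1, inv_one, Real.log_one]
      positivity
    rw [accPar, min_eq_left hε1]
    have hε0 := h.acc_pos
    have hs1 : √(d : ℝ) ≤ d := by
      rw [Real.sqrt_le_left (by positivity)]
      nlinarith
    have hs2 : √(Real.log k) ≤ Real.log k := by
      rw [Real.sqrt_le_left (by positivity)]
      nlinarith
    have hs3 : 1 ≤ √(Real.log (Real.log k / d)) := Real.one_le_sqrt.mpr hL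
    have hs4 : 0 < √(Real.log k) := Real.sqrt_pos.mpr (by linarith)
    have h2 : a * d ≤ Δ * Real.log k := by
      calc a * d = a * (d / √(Real.log k) * 1) * √(Real.log k) := by field_simp
        _ ≤ a * (d / √(Real.log k) * √(Real.log (Real.log k / d))) * √(Real.log k) := by gcongr
        _ ≤ _ := by
          have := h.sep_pos
          gcongr
    have h3 : Δ ≤ b * d * ε := by
      rw [div_le_iff₀ hε0] at hε
      exact hε.trans (by gcongr)
    have h4 : ε⁻¹ ≤ b / a * Real.log k := by
      rw [inv_le_iff_one_le_mul₀ hε0, div_mul_eq_mul_div, div_mul_eq_mul_div, le_div_iff₀ ha]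
      have : a * d ≤ b * d * ε * Real.log k := h2.trans (by gcongr)
      nlinarith
    calc Real.log ε⁻¹ ≤ Real.log (b / a * Real.log k) := Real.log_le_log (by positivity) h4
      _ = Real.log (b / a) + Real.log (Real.log k) := Real.log_mul (by positivity) (by positivity)
      _ ≤ b / a + Real.log (Real.log k) := by
        gcongr
        exact Real.log_le_self (by positivity)
      _ ≤ b / a * Real.log (Real.log k) + Real.log (Real.log k) := by
        gcongr
        exact le_mul_of_one_le_right (by positivity) hll
      _ = _ := by ring
  calc _ ≤ A * (Real.log k / Real.log (Real.log k)) *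
        ((b / a + 1) * Real.log (Real.log k)) :=
        mul_le_mul hdA h1 h.log_inv_accPar_nonneg (by positivity)
    _ = _ := by field_simp

/-- With L = log((log k)/d), the two factors of M² are O(d) and O(dL), the latter through the entry
d log(2 + d/Δ²) of the minimum and d/Δ² ≤ (log k)/(a²d). The separation gives 1/Δ² ≤ (log
k)/(a²d²L), so the product is O(log k). -/
theorem freqSq_le_log (h : Admissible k d Δ ε) (ha : 0 < a) (hb : 0 < b)
    (hL : 1 ≤ Real.log (Real.log k / d))
    (hΔ : a * (d / √(Real.log k) * √(Real.log (Real.log k / d))) ≤ Δ)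
    (hε : Δ / ε ≤ b * √d) :
    freqSq k d Δ ε ≤ (1 + b) * (1 + 1 / a ^ 2 + b) / a ^ 2 * Real.log k := by
  have hd := h.one_le_dim
  have hl := h.log_pos
  have hΔ0 := h.sep_pos
  set L := Real.log (Real.log k / d) with hLdef
  have hy : 2 ≤ Real.log k / d := by
    have := Real.log_le_sub_one_of_pos (show 0 < Real.log k / d by positivity)
    linarith
  have hs1 : √(d : ℝ) ≤ d := by
    rw [Real.sqrt_le_left (by positivity)]
    nlinarith
  have hlog : Real.log (Δ / ε) ≤ b * d :=
    (Real.log_le_self (div_pos hΔ0 h.acc_pos).le).trans (hε.trans (by gcongr))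
  have hlog0 : 0 ≤ Real.log (Δ / ε) := by
    refine Real.log_nonneg ?_
    rw [le_div_iff₀ h.acc_pos]
    linarith [h.acc_pos, h.acc_lt.trans_le (min_le_left _ _)]
  have hsq : a ^ 2 * d ^ 2 * L / Real.log k ≤ Δ ^ 2 := by
    calc _ = (a * (d / √(Real.log k) * √L)) ^ 2 := by
          rw [mul_pow, mul_pow, div_pow, Real.sq_sqrt hl.le, Real.sq_sqrt (by linarith)]
          ring
      _ ≤ _ := by gcongr
  have hinv : 1 / Δ ^ 2 ≤ Real.log k / (a ^ 2 * d ^ 2 * L) :=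
    (one_div_le_one_div_of_le (by positivity) hsq).trans_eq (one_div_div _ _)
  have h1 : min (d : ℝ) (Real.log k) + Real.log (Δ / ε) ≤ (1 + b) * d := by
    linarith [min_le_left (d : ℝ) (Real.log k)]
  have h2 : d / Δ ^ 2 ≤ 1 / a ^ 2 * (Real.log k / d) := by
    calc d / Δ ^ 2 = d * (1 / Δ ^ 2) := by ring
      _ ≤ d * (Real.log k / (a ^ 2 * d ^ 2 * 1)) := by
        refine mul_le_mul_of_nonneg_left (hinv.trans ?_) (by positivity)
        gcongr
      _ = _ := by field_simp
  have h3 : Real.log (2 + d / Δ ^ 2) ≤ (1 + 1 / a ^ 2) * L := by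
    calc Real.log (2 + d / Δ ^ 2) ≤ Real.log ((1 + 1 / a ^ 2) * (Real.log k / d)) :=
          Real.log_le_log (by positivity) (by linarith)
      _ = Real.log (1 + 1 / a ^ 2) + L := Real.log_mul (by positivity) (by positivity)
      _ ≤ 1 / a ^ 2 + L := by
        gcongr
        linarith [Real.log_le_sub_one_of_pos (show 0 < 1 + 1 / a ^ 2 by positivity)]
      _ ≤ 1 / a ^ 2 * L + L := by
        gcongr
        exact le_mul_of_one_le_right (by positivity) hL
      _ = _ := by ring
  have h4 : min (d + Real.log k) (d * Real.log (2 + d / Δ ^ 2)) + Real.log (Δ / ε) ≤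
      (1 + 1 / a ^ 2 + b) * (d * L) := by
    calc _ ≤ d * Real.log (2 + d / Δ ^ 2) + b * d := add_le_add (min_le_right _ _) hlog
      _ ≤ d * ((1 + 1 / a ^ 2) * L) + b * d * L :=
        add_le_add (mul_le_mul_of_nonneg_left h3 (by positivity))
          (le_mul_of_one_le_right (by positivity) hL)
      _ = _ := by ring
  have h5 : 0 ≤ min (d : ℝ) (Real.log k) + Real.log (Δ / ε) := by linarith [h.min_pos]
  have h6 : 0 ≤ min (d + Real.log k) (d * Real.log (2 + d / Δ ^ 2)) + Real.log (Δ / ε) := by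
    have := h.window_min_pos
    rw [← sq] at this
    linarith
  rw [freqSq]
  calc _ ≤ Real.log k / (a ^ 2 * d ^ 2 * L) * ((1 + b) * d) *
        ((1 + 1 / a ^ 2 + b) * (d * L)) := by gcongr
    _ = _ := by
      field_simp

end LowDimension

theorem exists_totalCost_le_pow (c : ℕ) {A a b : ℝ} (hA : 0 < A) (ha : 0 < a) (hb : 0 < b) :
    ∃ K k₀ : ℕ, ∀ (k d : ℕ) (Δ ε : ℝ), k₀ ≤ k → Admissible k d Δ ε →
      (d : ℝ) ≤ A * (Real.log k / Real.log (Real.log k)) →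
      a * (d / √(Real.log k) * √(Real.log (Real.log k / d))) ≤ Δ →
      Δ / ε ≤ b * √d →
      (totalCost ⌈sizePar c k d Δ ε⌉₊ ⌈candPar c k d ε⌉₊ d : ℝ) ≤ (k : ℝ) ^ K := by
  set R : ℝ := 131072000 * (c + 2) ^ 2 + 5 + 5130 * (A * (3 * A + 1)) +
    6 * (A * (b / a + 1)) + 1280 * ((1 + b) * (1 + 1 / a ^ 2 + b) / a ^ 2) with hR
  -- R collects the exponents of k; k₀ is chosen to ensure log log k ≥ max(1, 3A).
  refine ⟨⌈R⌉₊, ⌈Real.exp (Real.exp (max 1 (3 * A)))⌉₊, fun k d Δ ε hk h hdA hΔ hε => ?_⟩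
  have hk2 := h.two_le'
  have hl0 := h.log_pos
  have hk' := Nat.ceil_le.mp hk
  rw [← Real.le_log_iff_exp_le (by linarith), ← Real.le_log_iff_exp_le hl0] at hk'
  have hll : 1 ≤ Real.log (Real.log k) := (le_max_left _ _).trans hk'
  have hl : 1 ≤ Real.log k := by linarith [Real.log_le_self hl0.le]
  have hL := one_le_log_log_div h hA hk' hdA
  have h1 := dim_mul_log_two_add_le h hA hl hll hdA
  have h2 := dim_mul_log_inv_accPar_le h hA ha hb hl hll hL hdA hΔ hε
  have h3 := freqSq_le_log h ha hb hL hΔ hε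
  have hD : 131072000 * ((c : ℝ) + 2) ^ 2 ≤ Real.exp (131072000 * (c + 2) ^ 2 * Real.log k) := by
    refine le_trans ?_ (Real.exp_le_exp.mpr (le_mul_of_one_le_right (by positivity) hl))
    linarith [Real.add_one_le_exp (131072000 * ((c : ℝ) + 2) ^ 2)]
  have hX : (k : ℝ) ^ 3 * Real.log k ^ 2 ≤ Real.exp (5 * Real.log k) := by
    calc (k : ℝ) ^ 3 * Real.log k ^ 2 ≤ (k : ℝ) ^ 3 * (k : ℝ) ^ 2 := by
          gcongr
          exact Real.log_le_self (by linarith)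
      _ = (k : ℝ) ^ 5 := by ring
      _ = _ := by
        rw [show (5 : ℝ) = (5 : ℕ) by norm_num, Real.exp_nat_mul, Real.exp_log (by linarith)]
  calc _ ≤ _ := h.totalCost_le_exp c
    _ ≤ Real.exp (131072000 * (c + 2) ^ 2 * Real.log k) * Real.exp (5 * Real.log k) *
        Real.exp (5130 * (A * (3 * A + 1) * Real.log k) + 6 * (A * (b / a + 1) * Real.log k) +
          1280 * ((1 + b) * (1 + 1 / a ^ 2 + b) / a ^ 2 * Real.log k)) := by gcongr
    _ = Real.exp (R * Real.log k) := by
      rw [← Real.exp_add, ← Real.exp_add, hR]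
      congr 1
      ring
    _ ≤ Real.exp (⌈R⌉₊ * Real.log k) := by
      gcongr
      exact Nat.le_ceil R
    _ = _ := by rw [Real.exp_nat_mul, Real.exp_log (by linarith)]

end GMM

/-! ### Choice of the program and conclusion -/

theorem theorem2p1 (c : ℝ) (hc : 0 < c) :
    ∃ p : GMM.Prog,
      -- correctness with high probability, and the general bound on runtime and sample size
      (∃ C : ℝ, 0 < C ∧
        ∀ (k d : ℕ) (Δ ε : ℝ), GMM.Admissible k d Δ ε →
          GMM.RunsWithin p k d Δ ε (GMM.timeBound C k d Δ ε) ∧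
          ∀ μ : Fin k → EuclideanSpace ℝ (Fin d), GMM.Separated Δ μ →
            GMM.tapeLaw μ
              {ω | ¬ ∃ t s, GMM.HaltsIn p ω (GMM.input k d Δ ε) t s ∧
                GMM.EpsClose ε (GMM.output k d s) μ} ≤ ENNReal.ofReal ((k : ℝ) ^ (-c))) ∧
      -- polynomial runtime in low dimension and at the near-critical separation
      (∀ A a b : ℝ, 0 < A → 0 < a → 0 < b →
        ∃ K k₀ : ℕ, ∀ (k d : ℕ) (Δ ε : ℝ), k₀ ≤ k → GMM.Admissible k d Δ ε →
          (d : ℝ) ≤ A * (Real.log k / Real.log (Real.log k)) →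
          a * (d / Real.sqrt (Real.log k) * Real.sqrt (Real.log (Real.log k / d))) ≤ Δ →
          Δ / ε ≤ b * Real.sqrt d →
          GMM.RunsWithin p k d Δ ε ((k : ℝ) ^ K)) := by
  -- Programs contain natural constants only, so c is rounded up, which only lowers the failure
  -- probability.
  refine ⟨GMM.mainProg ⌈c⌉₊, ?_, fun A a b hA ha hb => ?_⟩
  · obtain ⟨C, hC, hcost⟩ := GMM.exists_totalCost_le_timeBound ⌈c⌉₊
    refine ⟨C, hC, fun k d Δ ε h => ⟨GMM.mainProg_runsWithin _ (hcost k d Δ ε h), fun μ hμ => ?_⟩⟩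
    refine (GMM.mainProg_correct h ⌈c⌉₊ hμ).trans (ENNReal.ofReal_le_ofReal ?_)
    refine Real.rpow_le_rpow_of_exponent_le (by linarith [h.two_le']) ?_
    exact neg_le_neg (Nat.le_ceil c)
  · obtain ⟨K, k₀, hcost⟩ := GMM.exists_totalCost_le_pow ⌈c⌉₊ hA ha hb
    exact ⟨K, k₀, fun k d Δ ε hk h hdA hΔ hε =>
      GMM.mainProg_runsWithin _ (hcost k d Δ ε hk h hdA hΔ hε)⟩
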